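/- Let $N_1,N_2\ge 1$, $N=N_1+N_2$, and write $x=(x_1,x_2)\in\mathbb R^{N_1}\times\mathbb R^{N_2}=\mathbb R^N$. Let $\Omega\subset\mathbb R^N$ be bounded and open with Lipschitz boundary, let $\Gamma\subset\partial\Omega$ be a measurable subset with positive $(N-1)$-dimensional surface measure ($d\sigma$ denotes surface measure on $\Gamma$), let $R_1\subset\mathbb R^{N_1}$ and $R_2\subset\mathbb R^{N_2}$ be bounded and open, and put $R=R_1\times R_2$. Let $J,G:\mathbb R^N\to[0,\infty)$ be continuous and integrable, with $J(0)>0$, $J(-x)=J(x)$, and $G\not\equiv 0$. Let $u_0\in H^1(\Omega)$ and $v_0\in L^2(R)$ be independent of $\varepsilon$. For $0<\varepsilon\le 1$ let $(u^\varepsilon,v^\varepsilon)$, with $u^\varepsilon\in C([0,\infty);H^1(\Omega))$ and $v^\varepsilon\in C([0,\infty);L^2(R))$, be a weak solution of $$ \begin{cases} \partial_t u^\varepsilon=\Delta u^\varepsilon & \text{in }\Omega\times(0,\infty),\\ \partial_\eta u^\varepsilon=0 & \text{on }(\partial\Omega\setminus\Gamma)\times(0,\infty),\\ \partial_\eta u^\varepsilon(x,t)=\displaystyle\int_{R}G(x_1-y_1,x_2-\varepsilon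 y_2)\,(v^\varepsilon(y,t)-u^\varepsilon(x,t))\,dy & \text{on }\Gamma\times(0,\infty),\\ \partial_t v^\varepsilon(x,t)=\displaystyle\int_R J(x_1-y_1,\varepsilon(x_2-y_2))(v^\varepsilon(y,t)-v^\varepsilon(x,t))\,dy\\ \qquad\qquad-\displaystyle\int_\Gamma G(x_1-y_1,\varepsilon x_2-y_2)(v^\varepsilon(x,t)-u^\varepsilon(y,t))\,d\sigma(y) & \text{in }R\times(0,\infty),\\ u^\varepsilon(\cdot,0)=u_0,\quad v^\varepsilon(\cdot,0)=v_0 . \end{cases} $$ Here and below, a weak solution is a pair for which the identities obtained by multiplying the equation for $u$ (respectively $v$) by a test function in $C^1([0,\infty);H^1(\Omega))$ (respectively in $C^1$ in time with values in $L^2$ of the nonlocal domain), integrating over $[0,T]$, and integrating by parts in time and, for the Laplacian, in space, hold for all $T\ge 0$; values on $\Gamma$ are understood as traces. Put $V^\varepsilon(x_1,t)=\int_{R_2}v^\varepsilon(x_1,x_2,t)\,dx_2$. Then there exist $u^*\in C([0,\infty);H^1(\Omega))$, $V^*\in C([0,\infty);L^2(R_1))$ and $v^*:[0,\infty)\to L^2(R)$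 with $V^*(x_1,t)=\int_{R_2}v^*(x_1,x_2,t)\,dx_2$ such that for every $T>0$, as $\varepsilon\to0^+$, $$ u^\varepsilon\rightharpoonup u^*\ \text{in }L^\infty(0,T;L^2(\Omega)),\qquad v^\varepsilon\rightharpoonup v^*\ \text{in }L^\infty(0,T;L^2(R)),\qquad V^\varepsilon\rightharpoonup V^*\ \text{in }L^\infty(0,T;L^2(R_1)), $$ weakly. Moreover, $(u^*,V^*)$ is the unique weak solution in the class $C([0,\infty);H^1(\Omega))\times C([0,\infty);L^2(R_1))$ of the limit problem $$ \begin{cases} \partial_t u^*=\Delta u^* & \text{in }\Omega\times(0,\infty),\\ \partial_\eta u^*=0 & \text{on }(\partial\Omega\setminus\Gamma)\times(0,\infty),\\ \partial_\eta u^*(x,t)=\displaystyle\int_{R_1}G(x_1-y_1,x_2)\,(V^*(y_1,t)-|R_2|\,u^*(x,t))\,dy_1 & \text{on }\Gamma\times(0,\infty),\\ \partial_t V^*(x_1,t)=|R_2|\displaystyle\int_{R_1}J(x_1-y_1,0)(V^*(y_1,t)-V^*(x_1,t))\,dy_1\\ \qquad\qquad-\displaystyle\int_\Gamma G(x_1-y_1,-y_2)(V^*(x_1,t)-|R_2|\,u^*(y,t))\,d\sigma(y)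 & \text{in }R_1\times(0,\infty),\\ u^*(\cdot,0)=u_0,\qquad V^*(x_1,0)=\displaystyle\int_{R_2}v_0(x_1,x_2)\,dx_2 . \end{cases} $$ -/

import Mathlib

open MeasureTheory Set Filter Topology
open scoped ENNReal NNReal ContDiff

noncomputable section

/-! ## Sobolev space, Lipschitz domains, surface measure, traces -/

section Sobolev

theorem continuous_fderiv_test {E : Type*} [NormedAddCommGroup E] [InnerProductSpace ℝ E]
    {φ : E → ℝ} (hφ : ContDiff ℝ ∞ φ) (e : E) :
    Continuous fun x => fderiv ℝ φ x e :=
  (hφ.continuous_fderiv (by simp)).clm_apply continuous_const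

theorem hasCompactSupport_fderiv_test {E : Type*} [NormedAddCommGroup E] [InnerProductSpace ℝ E]
    {φ : E → ℝ} (hφ : HasCompactSupport φ) (e : E) :
    HasCompactSupport fun x => fderiv ℝ φ x e :=
  hφ.fderiv_apply (𝕜 := ℝ) e

variable {E : Type*} [NormedAddCommGroup E] [InnerProductSpace ℝ E] [FiniteDimensional ℝ E]
  [MeasurableSpace E] [BorelSpace E]

/-- `D` is the weak gradient of `u` on `Ω`: for every test function `φ ∈ C_c^∞(Ω)` and every
direction `e`, `∫_Ω u ∂_e φ = - ∫_Ω (D · e) φ`. -/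
def IsWeakGradient (Ω : Set E) (u : E → ℝ) (D : E → E) : Prop :=
  ∀ φ : E → ℝ, ContDiff ℝ ∞ φ → HasCompactSupport φ → tsupport φ ⊆ Ω → ∀ e : E,
    ∫ x in Ω, u x * fderiv ℝ φ x e = - ∫ x in Ω, inner ℝ (D x) e * φ x

theorem integrable_mul_test (Ω : Set E) (f : Lp ℝ 2 (volume.restrict Ω)) {ψ : E → ℝ}
    (hc : Continuous ψ) (hs : HasCompactSupport ψ) :
    Integrable (fun x => f x * ψ x) (volume.restrict Ω) :=
  MemLp.integrable_mul (p := 2) (q := 2) (Lp.memLp f) (hc.memLp_of_hasCompactSupport hs)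

theorem integrable_inner_mul_test (Ω : Set E) (D : Lp E 2 (volume.restrict Ω)) (e : E)
    {ψ : E → ℝ} (hc : Continuous ψ) (hs : HasCompactSupport ψ) :
    Integrable (fun x => inner ℝ (D x) e * ψ x) (volume.restrict Ω) :=
  MemLp.integrable_mul (p := 2) (q := 2) ((Lp.memLp D).inner_const e)
    (hc.memLp_of_hasCompactSupport hs)

/-- The Sobolev space `H¹(Ω)`: the pairs `(u, ∇u)` with `u ∈ L²(Ω)` and weak gradient
`∇u ∈ L²(Ω; E)`. The norm inherited from the `ℓ²`-product is the usual one,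
`‖u‖² = ∫_Ω |u|² + ∫_Ω |∇u|²`. -/
def H1 (Ω : Set E) :
    Submodule ℝ (WithLp 2 (Lp ℝ 2 (volume.restrict Ω) × Lp E 2 (volume.restrict Ω))) where
  carrier := {p | IsWeakGradient Ω p.fst p.snd}
  zero_mem' := by
    intro φ _ _ _ e
    have h1 : ∫ x in Ω, ((0 : Lp ℝ 2 (volume.restrict Ω)) : E → ℝ) x * fderiv ℝ φ x e = 0 := by
      refine integral_eq_zero_of_ae ?_
      filter_upwards [Lp.coeFn_zero ℝ 2 (volume.restrict Ω)] with x hx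
      rw [hx, Pi.zero_apply, zero_mul]
    have h2 : ∫ x in Ω, inner ℝ (((0 : Lp E 2 (volume.restrict Ω)) : E → E) x) e * φ x = 0 := by
      refine integral_eq_zero_of_ae ?_
      filter_upwards [Lp.coeFn_zero E 2 (volume.restrict Ω)] with x hx
      rw [hx, Pi.zero_apply, inner_zero_left, zero_mul]
      rfl
    exact h1.trans (by rw [← neg_zero, ← h2]; rfl)
  add_mem' := by
    intro p q hp hq φ h1 h2 h3 e
    have hd := continuous_fderiv_test h1 e
    have hds := hasCompactSupport_fderiv_test h2 e
    have e1 : ∫ x in Ω, ((p + q).fst : E → ℝ) x * fderiv ℝ φ x e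
        = (∫ x in Ω, p.fst x * fderiv ℝ φ x e) + ∫ x in Ω, q.fst x * fderiv ℝ φ x e := by
      rw [← integral_add (integrable_mul_test Ω p.fst hd hds)
        (integrable_mul_test Ω q.fst hd hds)]
      refine integral_congr_ae ?_
      filter_upwards [Lp.coeFn_add p.fst q.fst] with x hx
      simp only [WithLp.add_fst, hx, Pi.add_apply, add_mul]
    have e2 : ∫ x in Ω, inner ℝ (((p + q).snd : E → E) x) e * φ x
        = (∫ x in Ω, inner ℝ (p.snd x) e * φ x) + ∫ x in Ω, inner ℝ (q.snd x) e * φ x := by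
      rw [← integral_add (integrable_inner_mul_test Ω p.snd e h1.continuous h2)
        (integrable_inner_mul_test Ω q.snd e h1.continuous h2)]
      refine integral_congr_ae ?_
      filter_upwards [Lp.coeFn_add p.snd q.snd] with x hx
      simp only [WithLp.add_snd, hx, Pi.add_apply, inner_add_left, add_mul]
    rw [e1, e2, hp φ h1 h2 h3 e, hq φ h1 h2 h3 e, neg_add]
  smul_mem' := by
    intro c p hp φ h1 h2 h3 e
    have e1 : ∫ x in Ω, ((c • p).fst : E → ℝ) x * fderiv ℝ φ x e
        = c * ∫ x in Ω, p.fst x * fderiv ℝ φ x e := by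
      rw [← integral_const_mul]
      refine integral_congr_ae ?_
      filter_upwards [Lp.coeFn_smul c p.fst] with x hx
      simp only [WithLp.smul_fst, hx, Pi.smul_apply, smul_eq_mul, mul_assoc]
    have e2 : ∫ x in Ω, inner ℝ (((c • p).snd : E → E) x) e * φ x
        = c * ∫ x in Ω, inner ℝ (p.snd x) e * φ x := by
      rw [← integral_const_mul]
      refine integral_congr_ae ?_
      filter_upwards [Lp.coeFn_smul c p.snd] with x hx
      simp only [WithLp.smul_snd, hx, Pi.smul_apply, real_inner_smul_left, mul_assoc]
    rw [e1, e2, hp φ h1 h2 h3 e, mul_neg]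

/-- The underlying `L²(Ω)` function of an element of `H¹(Ω)`. -/
def fnH1 {Ω : Set E} (u : H1 Ω) : Lp ℝ 2 (volume.restrict Ω) :=
  (u : WithLp 2 (Lp ℝ 2 (volume.restrict Ω) × Lp E 2 (volume.restrict Ω))).fst

/-- The weak gradient of an element of `H¹(Ω)`. -/
def gradH1 {Ω : Set E} (u : H1 Ω) : Lp E 2 (volume.restrict Ω) :=
  (u : WithLp 2 (Lp ℝ 2 (volume.restrict Ω) × Lp E 2 (volume.restrict Ω))).snd

/-- `Ω` has Lipschitz boundary: near each boundary point `p`, for a suitable unit vector `e`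
(the vertical axis of rotated coordinates), `Ω` is the region strictly below the graph of a
Lipschitz function `γ` of the coordinates `x - ⟪x, e⟫ e` orthogonal to `e`. -/
def HasLipschitzBoundary (Ω : Set E) : Prop :=
  ∀ p ∈ frontier Ω, ∃ (e : E) (K : ℝ≥0) (γ : E → ℝ) (δ : ℝ),
    ‖e‖ = 1 ∧ LipschitzWith K γ ∧ 0 < δ ∧
      ∀ x ∈ Metric.ball p δ, x ∈ Ω ↔ inner ℝ x e < γ (x - inner ℝ x e • e)

/-- The `(N-1)`-dimensional surface measure `dσ` on a piece `Γ` of a hypersurface, `N = dim E`: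
Hausdorff measure, normalized to agree with Lebesgue measure on hyperplanes. -/
def surfaceMeasure (Γ : Set E) : Measure E :=
  (Measure.euclideanHausdorffMeasure (Module.finrank ℝ E - 1)).restrict Γ

/-- `w ∈ L²(Γ)` is the trace on `Γ ⊆ ∂Ω` of `u ∈ H¹(Ω)`: there are smooth functions on the whole
space whose restrictions converge to `u` in `H¹(Ω)` and to `w` in `L²(Γ)`. -/
def HasTrace (Ω Γ : Set E) (u : H1 Ω) (w : Lp ℝ 2 (surfaceMeasure Γ)) : Prop :=
  ∃ f : ℕ → E → ℝ, (∀ n, ContDiff ℝ ∞ (f n)) ∧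
    Tendsto (fun n => eLpNorm (fun x => f n x - fnH1 u x) 2 (volume.restrict Ω)) atTop (𝓝 0) ∧
    Tendsto (fun n => eLpNorm (fun x => gradient (f n) x - gradH1 u x) 2 (volume.restrict Ω))
      atTop (𝓝 0) ∧
    Tendsto (fun n => eLpNorm (fun x => f n x - w x) 2 (surfaceMeasure Γ)) atTop (𝓝 0)

/-! ## Weak solutions of the coupled system -/

/-- Weak solutions `(u, v)`, `u ∈ C([0,∞); H¹(Ω))`, `v ∈ C([0,∞); L²(Y, ρ))`, of
* `∂u/∂t = Δu` in `Ω × (0,∞)`, `∂u/∂η = 0` on `(∂Ω \ Γ) × (0,∞)`,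
* `∂u/∂η(x,t) = ∫_Y g(x,y) (v(y,t) - c u(x,t)) dρ(y)` on `Γ × (0,∞)`,
* `∂v/∂t(y,t) = c ∫_Y j(y,z) (v(z,t) - v(y,t)) dρ(z) - ∫_Γ h(y,x) (v(y,t) - c u(x,t)) dσ(x)`
  in `Y × (0,∞)`,
* `u(·,0) = u₀`, `v(·,0) = v₀`.
The equations are multiplied by test functions `φ ∈ C¹([0,∞); H¹(Ω))`, `ψ ∈ C¹([0,∞); L²(Y, ρ))`
and integrated over `[0,T]`, with integration by parts in time and in space. Values on `Γ` are
those of the traces: `tr t` is the trace of `u t`, and `τ t` is the trace of `φ t`. -/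
structure IsWeakSolution (Ω Γ : Set E) {Y : Type*} [MeasurableSpace Y] (ρ : Measure Y) (c : ℝ)
    (j : Y → Y → ℝ) (g : E → Y → ℝ) (h : Y → E → ℝ) (u₀ : H1 Ω) (v₀ : Lp ℝ 2 ρ)
    (u : ℝ → H1 Ω) (v : ℝ → Lp ℝ 2 ρ) : Prop where
  continuousOn_u : ContinuousOn u (Ici 0)
  continuousOn_v : ContinuousOn v (Ici 0)
  initial_u : u 0 = u₀
  initial_v : v 0 = v₀
  weak_form : ∃ tr : ℝ → Lp ℝ 2 (surfaceMeasure Γ), (∀ t, 0 ≤ t → HasTrace Ω Γ (u t) (tr t)) ∧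
    (∀ (φ : ℝ → H1 Ω) (τ : ℝ → Lp ℝ 2 (surfaceMeasure Γ)), ContDiff ℝ 1 φ →
      (∀ t, 0 ≤ t → HasTrace Ω Γ (φ t) (τ t)) → ∀ T : ℝ, 0 ≤ T →
      (∫ x in Ω, fnH1 (u T) x * fnH1 (φ T) x)
          - ∫ t in (0 : ℝ)..T, ∫ x in Ω, fnH1 (u t) x * fnH1 (deriv φ t) x
        = (∫ x in Ω, fnH1 u₀ x * fnH1 (φ 0) x)
          - (∫ t in (0 : ℝ)..T, ∫ x in Ω, inner ℝ (gradH1 (u t) x) (gradH1 (φ t) x))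
          + ∫ t in (0 : ℝ)..T, ∫ x, (∫ y, g x y * (v t y - c * tr t x) ∂ρ) * τ t x
              ∂(surfaceMeasure Γ)) ∧
    (∀ ψ : ℝ → Lp ℝ 2 ρ, ContDiff ℝ 1 ψ → ∀ T : ℝ, 0 ≤ T →
      (∫ y, v T y * ψ T y ∂ρ) - ∫ t in (0 : ℝ)..T, ∫ y, v t y * deriv ψ t y ∂ρ
        = (∫ y, v₀ y * ψ 0 y ∂ρ)
          + (∫ t in (0 : ℝ)..T, ∫ y, (c * ∫ z, j y z * (v t z - v t y) ∂ρ) * ψ t y ∂ρ)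
          - ∫ t in (0 : ℝ)..T, ∫ y,
              (∫ x, h y x * (v t y - c * tr t x) ∂(surfaceMeasure Γ)) * ψ t y ∂ρ)

end Sobolev

/-! ## The rescaled problem and the limit problem -/

/-- `ℝ^N = ℝ^{N₁} × ℝ^{N₂}` with its Euclidean structure. -/
abbrev Space (N₁ N₂ : ℕ) : Type :=
  WithLp 2 (EuclideanSpace ℝ (Fin N₁) × EuclideanSpace ℝ (Fin N₂))

/-- The point `(x₁, x₂)` of `ℝ^N`. -/
def pt {N₁ N₂ : ℕ} (x₁ : EuclideanSpace ℝ (Fin N₁)) (x₂ : EuclideanSpace ℝ (Fin N₂)) :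
    Space N₁ N₂ :=
  WithLp.toLp 2 (x₁, x₂)

/-- Lebesgue measure on `R = R₁ × R₂`. -/
abbrev volR {N₁ N₂ : ℕ} (R₁ : Set (EuclideanSpace ℝ (Fin N₁)))
    (R₂ : Set (EuclideanSpace ℝ (Fin N₂))) :
    Measure (EuclideanSpace ℝ (Fin N₁) × EuclideanSpace ℝ (Fin N₂)) :=
  (volume.restrict R₁).prod (volume.restrict R₂)

/-- Solutions `(u^ε, v^ε)` of the problem on `Ω ∪ R`, `R = R₁ × R₂`, obtained from the thin domain
`R₁ × ε R₂` by rescaling. The kernels are `J(x₁ - y₁, ε (x₂ - y₂))` for `x, y ∈ R`,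
`G(x₁ - y₁, x₂ - ε y₂)` for `x ∈ Γ, y ∈ R`, and `G(x₁ - y₁, ε x₂ - y₂)` for `x ∈ R, y ∈ Γ`. -/
def IsRescaledSolution {N₁ N₂ : ℕ} (Ω Γ : Set (Space N₁ N₂))
    (R₁ : Set (EuclideanSpace ℝ (Fin N₁))) (R₂ : Set (EuclideanSpace ℝ (Fin N₂)))
    (J G : Space N₁ N₂ → ℝ) (ε : ℝ) (u₀ : H1 Ω) (v₀ : Lp ℝ 2 (volR R₁ R₂))
    (u : ℝ → H1 Ω) (v : ℝ → Lp ℝ 2 (volR R₁ R₂)) : Prop :=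
  IsWeakSolution Ω Γ (volR R₁ R₂) 1
    (fun x y => J (pt (x.1 - y.1) (ε • (x.2 - y.2))))
    (fun x y => G (pt (x.fst - y.1) (x.snd - ε • y.2)))
    (fun x y => G (pt (x.1 - y.fst) (ε • x.2 - y.snd)))
    u₀ v₀ u v

/-- Solutions `(u, V)` of the limit problem on `Ω ∪ R₁`, with `c = |R₂|` and the kernels
`J*(x - y) = J(x₁ - y₁, 0)` for `x, y ∈ R₁`, `G*(x - y) = G(x₁ - y₁, x₂ - 0)` for
`x ∈ Γ, y ∈ R₁`, and `G*(x - y) = G(x₁ - y₁, 0 - y₂)` for `x ∈ R₁, y ∈ Γ`. -/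
def IsLimitSolution {N₁ N₂ : ℕ} (Ω Γ : Set (Space N₁ N₂))
    (R₁ : Set (EuclideanSpace ℝ (Fin N₁))) (R₂ : Set (EuclideanSpace ℝ (Fin N₂)))
    (J G : Space N₁ N₂ → ℝ) (u₀ : H1 Ω) (V₀ : Lp ℝ 2 (volume.restrict R₁))
    (u : ℝ → H1 Ω) (V : ℝ → Lp ℝ 2 (volume.restrict R₁)) : Prop :=
  IsWeakSolution Ω Γ (volume.restrict R₁) (volume.real R₂)
    (fun x y => J (pt (x - y) 0))
    (fun x y => G (pt (x.fst - y) (x.snd - 0)))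
    (fun x y => G (pt (x - y.fst) (0 - y.snd)))
    u₀ V₀ u V

/-- `V(x₁) = ∫_{R₂} v(x₁, x₂) dx₂` for almost every `x₁ ∈ R₁`. -/
def IsFiberIntegral {N₁ N₂ : ℕ} {R₁ : Set (EuclideanSpace ℝ (Fin N₁))}
    {R₂ : Set (EuclideanSpace ℝ (Fin N₂))} (v : Lp ℝ 2 (volR R₁ R₂))
    (V : Lp ℝ 2 (volume.restrict R₁)) : Prop :=
  ∀ᵐ x₁ ∂(volume.restrict R₁), V x₁ = ∫ x₂ in R₂, v (x₁, x₂)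

/-- `f^ε ⇀ f` weakly in `L^∞(0,T;X)` as `ε → 0⁺`, for a family `f^ε`, `0 < ε ≤ 1`: the functions
`f^ε` and `f` belong to `L^∞(0,T;X)`, and their classes `F ε`, `F₀` satisfy `F ε → F₀` in the weak
topology of the Banach space `L^∞(0,T;X)`. -/
def WeakConvLinfty {X : Type*} [NormedAddCommGroup X] [NormedSpace ℝ X] (T : ℝ)
    (f : ℝ → ℝ → X) (f₀ : ℝ → X) : Prop :=
  ∃ (F : ℝ → Lp X ∞ (volume.restrict (Ioo 0 T))) (F₀ : Lp X ∞ (volume.restrict (Ioo 0 T))),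
    (∀ ε ∈ Ioc (0 : ℝ) 1, F ε =ᵐ[volume.restrict (Ioo 0 T)] f ε) ∧
    F₀ =ᵐ[volume.restrict (Ioo 0 T)] f₀ ∧
    Tendsto (fun ε => toWeakSpace ℝ _ (F ε)) (𝓝[>] (0 : ℝ)) (𝓝 (toWeakSpace ℝ _ F₀))

end

/-! The kernels are continuous and are evaluated only on a bounded set, so as `ε → 0` they converge
uniformly to their values at `ε = 0`. The solution depends continuously on the kernels, so `u^ε` and
`v^ε` converge in `L²`, uniformly for `t ∈ [0,T]`. Weak convergence in `L^∞(0,T;·)` is a corollary,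
and no compactness argument enters.

Let `D` be the Hilbert space of those elements of `H¹(Ω)` that have a trace on `Γ`. The trace
inequality (`HasLipschitzBoundary.hasTraceBound`) makes `D` closed in `H¹(Ω)` and the trace bounded
on it, so density of smooth functions in `H¹(Ω)` is never needed. Let `S` be the operator on `D`
that represents the `L²(Ω)` inner product. The `H¹` inner product is the `L²` one plus the gradient
form, so the weak problem is equivalent to `(S u)' = S u - u - N u + Q v`, `v' = M v + P u`, with
bounded operators only (`IsWeakSolution.exists_isEvolution`, `IsEvolution.isWeakSolution`).

For the difference `(w, z)` of two solutions, the energy `⟪S w, w⟫ + ‖z‖²` obeys a Gronwall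
inequality: the term `-‖w‖²`, in the full norm of `D`, absorbs the boundary terms
(`IsEvolution.sq_norm_sub_le`). Applied to different kernels this gives the convergence, applied to
equal kernels it gives uniqueness.

The limit is constructed by solving the problem with the kernels at `ε = 0`. `S` is symmetric,
nonnegative and injective, so `-S⁻¹` generates a contraction semigroup, obtained as the limit of
`exp (-t (S + κ)⁻¹)` (`exists_semigroup`). The operator `N` is absorbed into the inner product of
`D`, and the unknown `z = u - Q v` turns the system into a bounded perturbation of that semigroup,
solved by a fixed point (`exists_mild_solution`, `exists_isEvolution`). The resulting `u` is
continuous into `H¹(Ω)`.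

At `ε = 0` the kernels no longer see the second variable of `R`. Integration over `R₂` therefore
maps that solution to a solution of the limit problem (`IsEvolution.fiberIntegral`), which is where
the factors `|R₂|` come from. -/

noncomputable section

/-! ### The trace inequality on bounded Lipschitz domains -/

section Trace
variable {E : Type*} [NormedAddCommGroup E] [InnerProductSpace ℝ E] [FiniteDimensional ℝ E]
  [MeasurableSpace E] [BorelSpace E]

/-- The one-dimensional trace inequality. -/
theorem sq_le_integral_sq_add_integral_deriv_sq {φ : ℝ → ℝ} (hφ : ContDiff ℝ 1 φ) {r : ℝ}
    (hr : 0 < r) :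
    φ 0 ^ 2 ≤ ∫ s in (0 : ℝ)..r, ((1 + 1 / r) * φ s ^ 2 + deriv φ s ^ 2) := by
  have hd : ∀ s, HasDerivAt φ (deriv φ s) s := fun s =>
    (hφ.differentiable (by simp) s).hasDerivAt
  have hc : Continuous (deriv φ) := hφ.continuous_deriv (by simp)
  have hφc := hφ.continuous
  -- The weight `1 - s / r` is `1` at `0` and `0` at `r`, so no value at the far end survives.
  have h1 : ∫ s in (0 : ℝ)..r, -(-(1 / r) * φ s ^ 2 + (1 - s / r) * (2 * φ s * deriv φ s))
      = φ 0 ^ 2 := by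
    rw [intervalIntegral.integral_neg,
      intervalIntegral.integral_eq_sub_of_hasDerivAt (f := fun s => (1 - s / r) * φ s ^ 2)]
    · simp [div_self hr.ne']
    · intro s _
      have := (((hasDerivAt_id s).div_const r).const_sub 1).mul ((hd s).pow 2)
      refine this.congr_deriv ?_
      simp only [Pi.pow_apply, id, Nat.cast_ofNat]
      ring
    · exact (by fun_prop : Continuous fun s =>
        -(1 / r) * φ s ^ 2 + (1 - s / r) * (2 * φ s * deriv φ s)).intervalIntegrable _ _
  rw [← h1]
  refine intervalIntegral.integral_mono_on hr.le ?_ ?_ fun s hs => ?_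
  · exact Continuous.intervalIntegrable (by fun_prop) _ _
  · exact Continuous.intervalIntegrable (by fun_prop) _ _
  · have h0 : 0 ≤ s / r := div_nonneg hs.1 hr.le
    have h2 : s / r ≤ 1 := (div_le_one hr).2 hs.2
    -- With `a = 1 - s / r`, the gap between the integrands is `(φ + a φ')² + (1 - a²) φ'²`, and `1
    -- - a² = (s / r) (2 - s / r)`.
    nlinarith [sq_nonneg (φ s + (1 - s / r) * deriv φ s), sq_nonneg (deriv φ s),
      mul_nonneg (mul_nonneg h0 (by linarith : 0 ≤ 2 - s / r)) (sq_nonneg (deriv φ s))]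

omit [MeasurableSpace E] [BorelSpace E] in
-- This is the one-dimensional inequality along `s ↦ x - s • e`; as `e` is a unit vector, the
-- gradient dominates the directional derivative. The ray points along `-e`, the direction that
-- enters the domain from a point of its local graph.
theorem enorm_sq_le_lintegral_ray {f : E → ℝ} (hf : ContDiff ℝ 1 f) (x : E) {e : E}
    (he : ‖e‖ = 1) {r : ℝ} (hr : 0 < r) :
    ‖f x‖ₑ ^ 2 ≤ ENNReal.ofReal (1 + 1 / r) *
      ∫⁻ s in Ioc (0 : ℝ) r, (‖f (x - s • e)‖ₑ ^ 2 + ‖gradient f (x - s • e)‖ₑ ^ 2) := by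
  set φ : ℝ → ℝ := fun s => f (x - s • e) with hφdef
  have hφ : ContDiff ℝ 1 φ := by fun_prop
  have hd : ∀ s, |deriv φ s| ≤ ‖gradient f (x - s • e)‖ := by
    intro s
    have h1 : HasDerivAt φ (fderiv ℝ f (x - s • e) (-e)) s := by
      have := ((hf.differentiable (by simp) (x - s • e)).hasFDerivAt).comp_hasDerivAt s
        (((hasDerivAt_id s).smul_const e).const_sub x)
      rw [one_smul] at this
      exact this
    rw [h1.deriv, map_neg, abs_neg, ← Real.norm_eq_abs]
    refine ((fderiv ℝ f (x - s • e)).le_opNorm e).trans ?_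
    rw [he, mul_one, gradient, LinearIsometryEquiv.norm_map]
  have hgc : Continuous fun s : ℝ => gradient f (x - s • e) := by
    unfold gradient
    exact (LinearIsometryEquiv.continuous _).comp
      ((hf.continuous_fderiv (by simp)).comp (by fun_prop))
  have hφc := hφ.continuous
  have hdc : Continuous (deriv φ) := hφ.continuous_deriv (by simp)
  have hr1 : 1 ≤ 1 + 1 / r := by have := one_div_pos.2 hr; linarith
  have key : φ 0 ^ 2 ≤ ∫ s in Ioc (0 : ℝ) r,
      ((1 + 1 / r) * (‖φ s‖ ^ 2 + ‖gradient f (x - s • e)‖ ^ 2)) := by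
    refine (sq_le_integral_sq_add_integral_deriv_sq hφ hr).trans ?_
    rw [← intervalIntegral.integral_of_le hr.le]
    refine intervalIntegral.integral_mono_on hr.le ?_ ?_ fun s hs => ?_
    · exact Continuous.intervalIntegrable (by fun_prop) _ _
    · exact Continuous.intervalIntegrable (by fun_prop) _ _
    · have h2 : deriv φ s ^ 2 ≤ ‖gradient f (x - s • e)‖ ^ 2 := by
        rw [← sq_abs (deriv φ s)]
        exact pow_le_pow_left₀ (abs_nonneg _) (hd s) 2
      rw [Real.norm_eq_abs, sq_abs, mul_add]
      have := le_mul_of_one_le_left (sq_nonneg ‖gradient f (x - s • e)‖) hr1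
      linarith
  have hint : Integrable (fun s => (1 + 1 / r) * (‖φ s‖ ^ 2 + ‖gradient f (x - s • e)‖ ^ 2))
      (volume.restrict (Ioc (0 : ℝ) r)) :=
    (intervalIntegrable_iff_integrableOn_Ioc_of_le hr.le).1
      (Continuous.intervalIntegrable (by fun_prop) _ _)
  have h3 := ENNReal.ofReal_le_ofReal key
  rw [ofReal_integral_eq_lintegral_ofReal hint (ae_of_all _ fun s => by positivity)] at h3
  have e1 : ENNReal.ofReal (φ 0 ^ 2) = ‖f x‖ₑ ^ 2 := by
    rw [← sq_abs, ENNReal.ofReal_pow (abs_nonneg _), ← Real.norm_eq_abs, ofReal_norm]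
    simp [hφdef]
  rw [e1] at h3
  refine h3.trans_eq ?_
  rw [← lintegral_const_mul' _ _ ENNReal.ofReal_ne_top]
  refine lintegral_congr fun s => ?_
  rw [ENNReal.ofReal_mul (by positivity), ENNReal.ofReal_add (sq_nonneg ‖φ s‖) (by positivity),
    ENNReal.ofReal_pow (norm_nonneg _), ENNReal.ofReal_pow (norm_nonneg _), ofReal_norm,
    ofReal_norm]

/-- Integration along the lines parallel to a unit vector. -/
theorem exists_lintegral_lines_eq {e : E} (he : ‖e‖ = 1) :
    ∃ c : ℝ≥0∞, c ≠ ⊤ ∧ ∀ h : E → ℝ≥0∞, Measurable h →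
      ∫⁻ y : (ℝ ∙ e)ᗮ, ∫⁻ s : ℝ, h (y + s • e) = c * ∫⁻ x, h x := by
  have hee : inner ℝ e e = 1 := by rw [real_inner_self_eq_norm_sq, he]; norm_num
  have hperp : ∀ y : (ℝ ∙ e)ᗮ, inner ℝ e (y : E) = 0 := fun y =>
    Submodule.mem_orthogonal_singleton_iff_inner_right.1 y.2
  let l : ((ℝ ∙ e)ᗮ × ℝ) →ₗ[ℝ] E :=
    ((ℝ ∙ e)ᗮ.subtype).coprod (LinearMap.toSpanSingleton ℝ E e)
  have hl : ∀ p, l p = p.1 + p.2 • e := fun p => by simp [l]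
  have hinj : Function.Injective l := by
    rw [← LinearMap.ker_eq_bot, LinearMap.ker_eq_bot']
    rintro ⟨y, s⟩ h
    rw [hl] at h
    have h1 := congrArg (inner ℝ e) h
    simp only [inner_add_right, hperp, inner_smul_right, hee, inner_zero_right] at h1
    have hs : s = 0 := by simpa using h1
    subst hs
    simpa using h
  have hsurj : Function.Surjective l := by
    intro x
    refine ⟨(⟨x - inner ℝ e x • e, ?_⟩, inner ℝ e x), ?_⟩
    · rw [Submodule.mem_orthogonal_singleton_iff_inner_right, inner_sub_right, inner_smul_right,
        hee]; ring
    · rw [hl]; simp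
  let L := (LinearEquiv.ofBijective l ⟨hinj, hsurj⟩).toContinuousLinearEquiv
  have hL : ∀ p, L p = p.1 + p.2 • e := hl
  -- Uniqueness of Haar measure makes the image of the product measure a multiple of Lebesgue
  -- measure; only the finiteness of the factor will matter.
  have : (Measure.map L ((volume : Measure (ℝ ∙ e)ᗮ).prod (volume : Measure ℝ))).IsAddHaarMeasure :=
    L.isAddHaarMeasure_map _
  have hmap := Measure.isAddLeftInvariant_eq_smul
    (Measure.map L ((volume : Measure (ℝ ∙ e)ᗮ).prod (volume : Measure ℝ))) (volume : Measure E)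
  refine ⟨_, ENNReal.coe_ne_top (r := Measure.addHaarScalarFactor
    (Measure.map L ((volume : Measure (ℝ ∙ e)ᗮ).prod (volume : Measure ℝ))) volume), fun h hh => ?_⟩
  have := congrArg (fun μ => ∫⁻ x, h x ∂μ) hmap
  rw [lintegral_smul_measure, ENNReal.smul_def, smul_eq_mul] at this
  rw [← this, lintegral_map hh L.continuous.measurable, lintegral_prod]
  · simp only [hL]
  · exact (hh.comp L.continuous.measurable).aemeasurable

/-- On the graph of a Lipschitz function over the hyperplane `e⊥`, surface measure is controlled
by Lebesgue measure on the hyperplane. -/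
theorem exists_lintegral_graph_le {e : E} {K : ℝ≥0} {γ : E → ℝ} (he : ‖e‖ = 1)
    (hγ : LipschitzWith K γ) :
    ∃ c : ℝ≥0∞, c ≠ ⊤ ∧ ∀ (A : Set E), MeasurableSet A →
      (∀ x ∈ A, inner ℝ x e = γ (x - inner ℝ x e • e)) → ∀ h : E → ℝ≥0∞, Measurable h →
      ∫⁻ x in A, h x ∂(Measure.euclideanHausdorffMeasure (Module.finrank ℝ E - 1)) ≤
        c * ∫⁻ y in {y : (ℝ ∙ e)ᗮ | (y : E) + γ y • e ∈ A}, h (y + γ y • e) := by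
  set d := Module.finrank ℝ E - 1 with hd
  have hfin : Module.finrank ℝ (ℝ ∙ e)ᗮ = d := by
    have h1 := (ℝ ∙ e).finrank_add_finrank_orthogonal
    rw [finrank_span_singleton (by rintro rfl; simp at he)] at h1
    omega
  set Φ : (ℝ ∙ e)ᗮ → E := fun y => y + γ y • e with hΦ
  have hΦL : LipschitzWith (1 + K) Φ := by
    refine LipschitzWith.add (LipschitzWith.subtype_val _) ?_
    refine LipschitzWith.of_dist_le_mul fun y z => ?_
    rw [dist_eq_norm, ← sub_smul, norm_smul, he, mul_one, ← dist_eq_norm]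
    exact hγ.dist_le_mul y z
  have hΦm : Measurable Φ := hΦL.continuous.measurable
  -- The `d`-dimensional measures on `E` and on `e⊥` carry the same normalization, so the Lipschitz
  -- estimate for Hausdorff measure transfers, and on `e⊥` the measure is Lebesgue measure.
  have hle : ∀ s : Set (ℝ ∙ e)ᗮ, (Measure.euclideanHausdorffMeasure d : Measure E) (Φ '' s) ≤
      ((1 + K : ℝ≥0) : ℝ≥0∞) ^ (d : ℝ) * volume s := by
    intro s
    rw [← InnerProductSpace.euclideanHausdorffMeasure_eq_volume, hfin]
    simp only [Measure.euclideanHausdorffMeasure_def, Measure.smul_apply, ENNReal.smul_def,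
      smul_eq_mul]
    rw [mul_left_comm]
    gcongr
    exact hΦL.hausdorffMeasure_image_le (Nat.cast_nonneg d) s
  refine ⟨((1 + K : ℝ≥0) : ℝ≥0∞) ^ (d : ℝ), by simp, fun A hA hAg h hh => ?_⟩
  have himg : ∀ x ∈ A, ∃ y : (ℝ ∙ e)ᗮ, Φ y = x := by
    intro x hx
    refine ⟨⟨x - inner ℝ x e • e, ?_⟩, ?_⟩
    · rw [Submodule.mem_orthogonal_singleton_iff_inner_left, inner_sub_left,
        real_inner_smul_left, real_inner_self_eq_norm_sq, he]
      ring
    · simp only [hΦ, ← hAg x hx, sub_add_cancel]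
  -- Each point of `A` is the image under `Φ` of its projection to `e⊥`, so the set estimate becomes
  -- domination by a pushforward measure.
  have hmeas : (Measure.euclideanHausdorffMeasure d : Measure E).restrict A ≤
      (((1 + K : ℝ≥0) : ℝ≥0∞) ^ (d : ℝ)) • Measure.map Φ (volume.restrict (Φ ⁻¹' A)) := by
    refine Measure.le_iff.2 fun s hs => ?_
    rw [Measure.restrict_apply hs, Measure.smul_apply, Measure.map_apply hΦm hs,
      Measure.restrict_apply (hΦm hs), ← preimage_inter, smul_eq_mul]
    refine le_trans (measure_mono ?_) (hle _)
    rintro x ⟨hxs, hxA⟩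
    obtain ⟨y, rfl⟩ := himg x hxA
    exact ⟨y, ⟨hxs, hxA⟩, rfl⟩
  refine (lintegral_mono' hmeas le_rfl).trans ?_
  rw [lintegral_smul_measure, lintegral_map hh hΦm, smul_eq_mul]
  exact le_rfl

/-- A set on which the trace of smooth functions is controlled by their `H¹(Ω)` norm. -/
def HasTraceBound (Ω Γ : Set E) : Prop :=
  ∃ c : ℝ≥0∞, c ≠ ⊤ ∧ ∀ f : E → ℝ, ContDiff ℝ 1 f →
    ∫⁻ x, ‖f x‖ₑ ^ 2 ∂(surfaceMeasure Γ) ≤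
      c * ((∫⁻ x in Ω, ‖f x‖ₑ ^ 2) + ∫⁻ x in Ω, ‖gradient f x‖ₑ ^ 2)

omit [MeasurableSpace E] [BorelSpace E] in
theorem continuous_gradient {f : E → ℝ} (hf : ContDiff ℝ 1 f) : Continuous (gradient f) :=
  (LinearIsometryEquiv.continuous _).comp (hf.continuous_fderiv (by simp))

/-- The surface integral is moved to the base hyperplane, the value of `f` at each graph point is
bounded by an integral over the segment just below it, which lies in `Ω`, and the segments are
gathered into a volume integral over `Ω`. -/
theorem HasLipschitzBoundary.exists_hasTraceBound_ball {Ω : Set E} (hΩo : IsOpen Ω)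
    (hΩ : HasLipschitzBoundary Ω) {p : E} (hp : p ∈ frontier Ω) :
    ∃ r > 0, HasTraceBound Ω (frontier Ω ∩ Metric.ball p r) := by
  obtain ⟨e, K, γ, δ, he, hγ, hδ, hloc⟩ := hΩ p hp
  have hee : inner ℝ e e = 1 := by rw [real_inner_self_eq_norm_sq, he]; norm_num
  set G : E → ℝ := fun x => γ (x - inner ℝ x e • e) - inner ℝ x e with hG
  have hGc : Continuous G := by
    have := hγ.continuous
    fun_prop
  -- A point strictly below the graph lies in the open set `Ω`, and a point strictly above it has a
  -- neighbourhood that misses `Ω`; neither is a boundary point.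
  have hgraph : ∀ x ∈ frontier Ω ∩ Metric.ball p δ, inner ℝ x e = γ (x - inner ℝ x e • e) := by
    rintro x ⟨hx, hxb⟩
    rcases lt_trichotomy (inner ℝ x e) (γ (x - inner ℝ x e • e)) with h | h | h
    · exact absurd ((hloc x hxb).2 h) (hΩo.frontier_eq ▸ hx).2
    · exact h
    · have hopen : IsOpen ({z | G z < 0} ∩ Metric.ball p δ) :=
        (isOpen_lt hGc continuous_const).inter Metric.isOpen_ball
      obtain ⟨z, hz, hzΩ⟩ := mem_closure_iff.1 (frontier_subset_closure hx) _ hopen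
        ⟨by simpa [hG] using h, hxb⟩
      have h1 := (hloc z hz.2).1 hzΩ
      have h2 : G z < 0 := hz.1
      simp only [hG] at h2
      linarith
  obtain ⟨c₁, hc₁, hgr⟩ := exists_lintegral_graph_le he hγ
  obtain ⟨c₂, hc₂, hln⟩ := exists_lintegral_lines_eq he
  -- Half the radius: a graph point within `δ / 2` of `p`, moved down by at most `δ / 2`, stays in
  -- the ball where `Ω` is a subgraph.
  set r := δ / 2 with hr
  have hr0 : 0 < r := half_pos hδ
  have hA : MeasurableSet (frontier Ω ∩ Metric.ball p r) :=
    isClosed_frontier.measurableSet.inter Metric.isOpen_ball.measurableSet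
  refine ⟨r, hr0, c₁ * (ENNReal.ofReal (1 + 1 / r) * c₂),
    ENNReal.mul_ne_top hc₁ (ENNReal.mul_ne_top ENNReal.ofReal_ne_top hc₂), fun f hf => ?_⟩
  have hgc := continuous_gradient hf
  have hfc := hf.continuous
  set H : E → ℝ≥0∞ := fun x => ‖f x‖ₑ ^ 2 + ‖gradient f x‖ₑ ^ 2 with hH
  have hHm : Measurable H := by
    have h1 := hfc.measurable
    have h2 := hgc.measurable
    fun_prop
  have hHm' : Measurable (Ω.indicator H) := hHm.indicator hΩo.measurableSet
  unfold surfaceMeasure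
  refine (hgr _ hA (fun x hx => hgraph x ⟨hx.1, Metric.ball_subset_ball (by linarith) hx.2⟩)
    _ (by have h1 := hfc.measurable; fun_prop)).trans ?_
  rw [mul_assoc]
  gcongr
  have hray : ∀ y ∈ {y : (ℝ ∙ e)ᗮ | (y : E) + γ y • e ∈ frontier Ω ∩ Metric.ball p r},
      ‖f (y + γ y • e)‖ₑ ^ 2 ≤
        ENNReal.ofReal (1 + 1 / r) * ∫⁻ s : ℝ, Ω.indicator H (y + s • e) := by
    intro y hy
    have hye : inner ℝ (y : E) e = 0 := Submodule.mem_orthogonal_singleton_iff_inner_left.1 y.2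
    refine (enorm_sq_le_lintegral_ray hf _ he hr0).trans (mul_le_mul' le_rfl ?_)
    -- The reflection `s ↦ γ y - s` turns the line through `y` into the ray that descends from the
    -- graph point.
    rw [← lintegral_sub_left_eq_self (fun s => Ω.indicator H ((y : E) + s • e)) (γ y)]
    refine le_trans ?_ (setLIntegral_le_lintegral (Ioc 0 r) _)
    refine setLIntegral_mono ?_ fun s hs => ?_
    · exact hHm'.comp (by fun_prop : Continuous fun s : ℝ => (y : E) + (γ y - s) • e).measurable
    · have hpt : (y : E) + γ y • e - s • e = y + (γ y - s) • e := by module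
      have hin : inner ℝ ((y : E) + (γ y - s) • e) e = γ y - s := by
        rw [inner_add_left, real_inner_smul_left, hye, hee]; ring
      have hmem : (y : E) + (γ y - s) • e ∈ Ω := by
        refine (hloc _ ?_).2 ?_
        · rw [← hpt, Metric.mem_ball]
          calc dist ((y : E) + γ y • e - s • e) p
              ≤ dist ((y : E) + γ y • e - s • e) ((y : E) + γ y • e) +
                dist ((y : E) + γ y • e) p := dist_triangle _ _ _
            _ < r + r := by
                refine add_lt_add_of_le_of_lt ?_ hy.2
                rw [dist_eq_norm, sub_sub_cancel_left, norm_neg, norm_smul, he, mul_one,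
                  Real.norm_eq_abs, abs_of_pos hs.1]
                exact hs.2
            _ = δ := by rw [hr]; ring
        · rw [hin, add_sub_cancel_right]
          linarith [hs.1]
      rw [hpt, indicator_of_mem hmem]
  have hAm : MeasurableSet {y : (ℝ ∙ e)ᗮ | (y : E) + γ y • e ∈ frontier Ω ∩ Metric.ball p r} := by
    have := hγ.continuous
    exact (by fun_prop : Continuous fun y : (ℝ ∙ e)ᗮ => (y : E) + γ y • e).measurable hA
  refine (setLIntegral_mono' hAm hray).trans ((setLIntegral_le_lintegral _ _).trans ?_)
  rw [lintegral_const_mul' _ _ ENNReal.ofReal_ne_top, hln _ hHm',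
    lintegral_indicator hΩo.measurableSet, mul_assoc, lintegral_add_left
    (by have h1 := hfc.measurable; fun_prop)]

theorem HasTraceBound.mono {Ω Γ Γ' : Set E} (h : HasTraceBound Ω Γ') (hsub : Γ ⊆ Γ') :
    HasTraceBound Ω Γ := by
  obtain ⟨c, hc, hb⟩ := h
  exact ⟨c, hc, fun f hf => (lintegral_mono' (Measure.restrict_mono hsub le_rfl) le_rfl).trans
    (hb f hf)⟩

theorem HasTraceBound.union {Ω Γ Γ' : Set E} (h : HasTraceBound Ω Γ) (h' : HasTraceBound Ω Γ') :
    HasTraceBound Ω (Γ ∪ Γ') := by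
  obtain ⟨c, hc, hb⟩ := h
  obtain ⟨c', hc', hb'⟩ := h'
  refine ⟨c + c', by simp [hc, hc'], fun f hf => ?_⟩
  rw [add_mul]
  refine (lintegral_mono' (Measure.restrict_union_le Γ Γ') le_rfl).trans ?_
  rw [lintegral_add_measure]
  exact add_le_add (hb f hf) (hb' f hf)

/-- The trace inequality on the boundary of a bounded Lipschitz domain. -/
theorem HasLipschitzBoundary.hasTraceBound {Ω Γ : Set E} (hΩo : IsOpen Ω)
    (hΩb : Bornology.IsBounded Ω) (hΩ : HasLipschitzBoundary Ω) (hΓ : Γ ⊆ frontier Ω) :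
    HasTraceBound Ω Γ := by
  have hcomp : IsCompact (frontier Ω) :=
    hΩb.isCompact_closure.of_isClosed_subset isClosed_frontier frontier_subset_closure
  refine HasTraceBound.mono (hcomp.induction_on (p := fun s => HasTraceBound Ω s) ?_
    (fun s t hst ht => ht.mono hst) (fun s t hs ht => hs.union ht) fun p hp => ?_) hΓ
  · exact ⟨0, by simp, fun f _ => by simp [surfaceMeasure]⟩
  · obtain ⟨r, hr, hb⟩ := hΩ.exists_hasTraceBound_ball hΩo hp
    exact ⟨_, inter_mem self_mem_nhdsWithin (mem_nhdsWithin_of_mem_nhds (Metric.ball_mem_nhds p hr)),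
      hb⟩

/-- The constant function `1` in the trace inequality bounds the area of `Γ` by the volume of `Ω`.
-/
theorem HasTraceBound.isFiniteMeasure {Ω Γ : Set E} (h : HasTraceBound Ω Γ)
    (hΩb : Bornology.IsBounded Ω) : IsFiniteMeasure (surfaceMeasure Γ) := by
  obtain ⟨c, hc, hb⟩ := h
  refine ⟨?_⟩
  have h1 := hb (fun _ => 1) contDiff_const
  have h2 : gradient (fun _ : E => (1 : ℝ)) = 0 := by
    funext x
    simp [gradient]
  simp only [h2, enorm_one, one_pow, lintegral_const, one_mul, Pi.zero_apply, enorm_zero,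
    Measure.restrict_apply_univ, ne_eq, OfNat.ofNat_ne_zero, not_false_eq_true, zero_pow,
    zero_mul, add_zero] at h1
  exact h1.trans_lt (ENNReal.mul_lt_top hc.lt_top hΩb.measure_lt_top)

end Trace

/-! ### Completeness of `H¹(Ω)` and the trace operator -/

section SobolevSpace
variable {E : Type*} [NormedAddCommGroup E] [InnerProductSpace ℝ E] [FiniteDimensional ℝ E]
  [MeasurableSpace E] [BorelSpace E]

theorem inner_H1 {Ω : Set E} (u w : H1 Ω) :
    inner ℝ u w = inner ℝ (fnH1 u) (fnH1 w) + inner ℝ (gradH1 u) (gradH1 w) := by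
  rw [Submodule.coe_inner, WithLp.prod_inner_apply]
  rfl

/-- The embedding of `H¹(Ω)` into `L²(Ω)`. -/
def fnL (Ω : Set E) : H1 Ω →L[ℝ] Lp ℝ 2 (volume.restrict Ω) :=
  (WithLp.fstL 2 ℝ _ _).comp (H1 Ω).subtypeL

/-- The weak gradient as an operator on `H¹(Ω)`. -/
def gradL (Ω : Set E) : H1 Ω →L[ℝ] Lp E 2 (volume.restrict Ω) :=
  (WithLp.sndL 2 ℝ _ _).comp (H1 Ω).subtypeL

theorem fnL_apply {Ω : Set E} (u : H1 Ω) : fnL Ω u = fnH1 u := rfl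

theorem norm_sq_H1 {Ω : Set E} (u : H1 Ω) : ‖u‖ ^ 2 = ‖fnH1 u‖ ^ 2 + ‖gradH1 u‖ ^ 2 := by
  rw [← real_inner_self_eq_norm_sq, inner_H1, real_inner_self_eq_norm_sq,
    real_inner_self_eq_norm_sq]

theorem norm_fnH1_le {Ω : Set E} (u : H1 Ω) : ‖fnH1 u‖ ≤ ‖u‖ :=
  le_of_sq_le_sq (by rw [norm_sq_H1]; nlinarith [sq_nonneg ‖gradH1 u‖]) (norm_nonneg _)

theorem norm_gradH1_le {Ω : Set E} (u : H1 Ω) : ‖gradH1 u‖ ≤ ‖u‖ :=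
  le_of_sq_le_sq (by rw [norm_sq_H1]; nlinarith [sq_nonneg ‖fnH1 u‖]) (norm_nonneg _)

/-- For each test function and direction the defining identity equates two `L²` pairings with fixed
functions, hence is a closed condition. -/
theorem isClosed_H1 (Ω : Set E) : IsClosed (H1 Ω : Set
    (WithLp 2 (Lp ℝ 2 (volume.restrict Ω) × Lp E 2 (volume.restrict Ω)))) := by
  have : (H1 Ω : Set (WithLp 2 (Lp ℝ 2 (volume.restrict Ω) × Lp E 2 (volume.restrict Ω)))) =
      ⋂ (φ : E → ℝ) (_ : ContDiff ℝ ∞ φ) (_ : HasCompactSupport φ) (_ : tsupport φ ⊆ Ω) (e : E),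
        {p | ∫ x in Ω, p.fst x * fderiv ℝ φ x e = - ∫ x in Ω, inner ℝ (p.snd x) e * φ x} := by
    ext p
    simp only [mem_iInter]
    rfl
  rw [this]
  refine isClosed_iInter fun φ => isClosed_iInter fun h1 => isClosed_iInter fun h2 =>
    isClosed_iInter fun _ => isClosed_iInter fun e => ?_
  have m1 : MemLp (fun x => fderiv ℝ φ x e) 2 (volume.restrict Ω) :=
    (continuous_fderiv_test h1 e).memLp_of_hasCompactSupport (hasCompactSupport_fderiv_test h2 e)
  have m2 : MemLp (fun x => φ x • e) 2 (volume.restrict Ω) :=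
    (by have := h1.continuous; fun_prop : Continuous fun x => φ x • e).memLp_of_hasCompactSupport
      (h2.smul_right)
  have e1 : ∀ p : WithLp 2 (Lp ℝ 2 (volume.restrict Ω) × Lp E 2 (volume.restrict Ω)),
      ∫ x in Ω, p.fst x * fderiv ℝ φ x e = inner ℝ p.fst (m1.toLp _) := by
    intro p
    rw [L2.inner_def]
    refine integral_congr_ae ?_
    filter_upwards [m1.coeFn_toLp] with x hx
    rw [hx]
    simp [mul_comm]
  have e2 : ∀ p : WithLp 2 (Lp ℝ 2 (volume.restrict Ω) × Lp E 2 (volume.restrict Ω)),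
      ∫ x in Ω, inner ℝ (p.snd x) e * φ x = inner ℝ p.snd (m2.toLp _) := by
    intro p
    rw [L2.inner_def]
    refine integral_congr_ae ?_
    filter_upwards [m2.coeFn_toLp] with x hx
    rw [hx, real_inner_smul_right, mul_comm]
  simp only [e1, e2]
  have c1 : Continuous fun p : WithLp 2 (Lp ℝ 2 (volume.restrict Ω) × Lp E 2 (volume.restrict Ω)) =>
    p.fst := (WithLp.fstL 2 ℝ _ _).continuous
  have c2 : Continuous fun p : WithLp 2 (Lp ℝ 2 (volume.restrict Ω) × Lp E 2 (volume.restrict Ω)) =>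
    p.snd := (WithLp.sndL 2 ℝ _ _).continuous
  exact isClosed_eq (c1.inner continuous_const) (c2.inner continuous_const).neg

instance completeSpace_H1 (Ω : Set E) : CompleteSpace (H1 Ω) :=
  (isClosed_H1 Ω).completeSpace_coe

/-- If the function vanishes, its weak gradient integrates to zero against every test function, and
the fundamental lemma of the calculus of variations applies on the open set `Ω`. This yields the
injectivity of the operator `S`. -/
theorem fnH1_injective {Ω : Set E} (hΩ : IsOpen Ω) : Function.Injective (fnH1 (Ω := Ω)) := by
  refine (injective_iff_map_eq_zero (fnL Ω)).2 fun u hu => ?_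
  rw [fnL_apply] at hu
  have hg : gradH1 u = 0 := by
    refine (Lp.eq_zero_iff_ae_eq_zero).2 ?_
    have hloc : LocallyIntegrableOn (gradH1 u : E → E) Ω volume :=
      locallyIntegrableOn_of_locallyIntegrable_restrict
        ((Lp.memLp (gradH1 u)).locallyIntegrable (by norm_num))
    rw [Filter.EventuallyEq, ae_restrict_iff' hΩ.measurableSet]
    refine hΩ.ae_eq_zero_of_integral_contDiff_smul_eq_zero hloc fun φ h1 h2 h3 => ?_
    have hφ0 : ∀ x, x ∉ Ω → φ x • (gradH1 u : E → E) x = 0 := fun x hx => by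
      rw [image_eq_zero_of_notMem_tsupport fun h => hx (h3 h), zero_smul]
    rw [← setIntegral_eq_integral_of_forall_compl_eq_zero hφ0]
    have hint : Integrable (fun x => φ x • (gradH1 u : E → E) x) (volume.restrict Ω) :=
      memLp_one_iff_integrable.1 ((Lp.memLp (gradH1 u)).smul (p := 2) (q := 2) (r := 1)
        (h1.continuous.memLp_of_hasCompactSupport h2))
    refine ext_inner_left ℝ fun e => ?_
    rw [← integral_inner hint, inner_zero_right]
    have h4 := u.2 φ h1 h2 h3 e
    have h5 : ∫ x in Ω, fnH1 u x * fderiv ℝ φ x e = 0 := by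
      refine integral_eq_zero_of_ae ?_
      rw [hu]
      filter_upwards [Lp.coeFn_zero ℝ 2 (volume.restrict Ω)] with x hx
      rw [hx, Pi.zero_apply, zero_mul]
    have h6 := neg_eq_zero.1 (h4.symm.trans h5)
    rw [← h6]
    refine integral_congr_ae (ae_of_all _ fun x => ?_)
    simp only [real_inner_smul_right]
    rw [real_inner_comm, mul_comm]
    rfl
  have : ‖u‖ ^ 2 = 0 := by rw [norm_sq_H1, hu, hg]; simp
  simpa using this

theorem eLpNorm_sub_le_add {F : Type*} [NormedAddCommGroup F] {X : Type*} [MeasurableSpace X]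
    {μ : Measure X} {f : X → F} (hf : AEStronglyMeasurable f μ) (a b : Lp F 2 μ) :
    eLpNorm (fun x => f x - b x) 2 μ ≤ eLpNorm (fun x => f x - a x) 2 μ + ‖a - b‖ₑ := by
  have h : (fun x => f x - b x) =ᵐ[μ] (fun x => f x - a x) + ⇑(a - b) := by
    filter_upwards [Lp.coeFn_sub a b] with x hx
    rw [Pi.add_apply, hx, Pi.sub_apply]
    abel
  rw [eLpNorm_congr_ae h, Lp.enorm_def]
  exact eLpNorm_add_le (hf.sub (Lp.aestronglyMeasurable a)) (Lp.aestronglyMeasurable _)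
    (by norm_num)

theorem eLpNorm_add_sub_add_le {F : Type*} [NormedAddCommGroup F] {X : Type*} [MeasurableSpace X]
    {μ : Measure X} {f g : X → F} (hf : AEStronglyMeasurable f μ) (hg : AEStronglyMeasurable g μ)
    (a b : Lp F 2 μ) :
    eLpNorm (fun x => f x + g x - (a + b : Lp F 2 μ) x) 2 μ ≤
      eLpNorm (fun x => f x - a x) 2 μ + eLpNorm (fun x => g x - b x) 2 μ := by
  have h : (fun x => f x + g x - (a + b : Lp F 2 μ) x) =ᵐ[μ]
      (fun x => f x - a x) + fun x => g x - b x := by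
    filter_upwards [Lp.coeFn_add a b] with x hx
    simp only [hx, Pi.add_apply]
    abel
  rw [eLpNorm_congr_ae h]
  exact eLpNorm_add_le (hf.sub (Lp.aestronglyMeasurable a)) (hg.sub (Lp.aestronglyMeasurable b))
    (by norm_num)

theorem eLpNorm_smul_sub_smul {F : Type*} [NormedAddCommGroup F] [NormedSpace ℝ F] {X : Type*}
    [MeasurableSpace X] {μ : Measure X} (c : ℝ) (f : X → F) (a : Lp F 2 μ) :
    eLpNorm (fun x => c • f x - (c • a : Lp F 2 μ) x) 2 μ =
      ‖c‖ₑ * eLpNorm (fun x => f x - a x) 2 μ := by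
  have h : (fun x => c • f x - (c • a : Lp F 2 μ) x) =ᵐ[μ] c • fun x => f x - a x := by
    filter_upwards [Lp.coeFn_smul c a] with x hx
    simp only [hx, Pi.smul_apply, smul_sub]
  rw [eLpNorm_congr_ae h, eLpNorm_const_smul]

/-- One approximant per tolerance replaces the sequence, so that limits of traces need no diagonal
argument. -/
theorem hasTrace_iff {Ω Γ : Set E} {u : H1 Ω} {w : Lp ℝ 2 (surfaceMeasure Γ)} :
    HasTrace Ω Γ u w ↔ ∀ δ : ℝ≥0∞, 0 < δ → ∃ f : E → ℝ, ContDiff ℝ ∞ f ∧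
      eLpNorm (fun x => f x - fnH1 u x) 2 (volume.restrict Ω) ≤ δ ∧
      eLpNorm (fun x => gradient f x - gradH1 u x) 2 (volume.restrict Ω) ≤ δ ∧
      eLpNorm (fun x => f x - w x) 2 (surfaceMeasure Γ) ≤ δ := by
  constructor
  · rintro ⟨f, hf, h1, h2, h3⟩ δ hδ
    obtain ⟨n, ⟨hn1, hn2⟩, hn3⟩ := (((ENNReal.tendsto_nhds_zero.1 h1 δ hδ).and
      (ENNReal.tendsto_nhds_zero.1 h2 δ hδ)).and (ENNReal.tendsto_nhds_zero.1 h3 δ hδ)).exists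
    exact ⟨f n, hf n, hn1, hn2, hn3⟩
  · intro h
    -- At `n = 0` the tolerance is `0⁻¹ = ⊤`, which is harmless.
    have hpos : ∀ n : ℕ, 0 < ((n : ℝ≥0∞)⁻¹) := fun n =>
      ENNReal.inv_pos.2 (ENNReal.natCast_ne_top n)
    choose f hf h1 h2 h3 using fun n : ℕ => h _ (hpos n)
    have h0 := ENNReal.tendsto_inv_nat_nhds_zero
    exact ⟨f, hf,
      tendsto_of_tendsto_of_tendsto_of_le_of_le tendsto_const_nhds h0 (fun _ => bot_le) h1,
      tendsto_of_tendsto_of_tendsto_of_le_of_le tendsto_const_nhds h0 (fun _ => bot_le) h2,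
      tendsto_of_tendsto_of_tendsto_of_le_of_le tendsto_const_nhds h0 (fun _ => bot_le) h3⟩

omit [MeasurableSpace E] [BorelSpace E] in
theorem gradient_add_apply {f g : E → ℝ} (hf : ContDiff ℝ ∞ f) (hg : ContDiff ℝ ∞ g) (x : E) :
    gradient (fun y => f y + g y) x = gradient f x + gradient g x := by
  unfold gradient
  rw [fderiv_fun_add (hf.differentiable (by simp) x) (hg.differentiable (by simp) x), map_add]

omit [MeasurableSpace E] [BorelSpace E] in
theorem gradient_smul_apply {f : E → ℝ} (hf : ContDiff ℝ ∞ f) (c : ℝ) (x : E) :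
    gradient (fun y => c • f y) x = c • gradient f x := by
  unfold gradient
  rw [fderiv_fun_const_smul (hf.differentiable (by simp) x), map_smul]

omit [MeasurableSpace E] [BorelSpace E] in
theorem continuous_gradient_of_smooth {f : E → ℝ} (hf : ContDiff ℝ ∞ f) :
    Continuous (gradient f) :=
  continuous_gradient (hf.of_le (by simp))

theorem HasTrace.add {Ω Γ : Set E} {u u' : H1 Ω} {w w' : Lp ℝ 2 (surfaceMeasure Γ)}
    (h : HasTrace Ω Γ u w) (h' : HasTrace Ω Γ u' w') : HasTrace Ω Γ (u + u') (w + w') := by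
  rw [hasTrace_iff] at h h' ⊢
  intro δ hδ
  obtain ⟨f, hf, a1, a2, a3⟩ := h (δ / 2) (ENNReal.half_pos hδ.ne')
  obtain ⟨g, hg, b1, b2, b3⟩ := h' (δ / 2) (ENNReal.half_pos hδ.ne')
  refine ⟨fun x => f x + g x, hf.add hg, ?_, ?_, ?_⟩
  · exact (eLpNorm_add_sub_add_le hf.continuous.aestronglyMeasurable
      hg.continuous.aestronglyMeasurable (fnH1 u) (fnH1 u')).trans
        ((add_le_add a1 b1).trans_eq (ENNReal.add_halves δ))
  · simp only [gradient_add_apply hf hg]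
    exact (eLpNorm_add_sub_add_le (continuous_gradient_of_smooth hf).aestronglyMeasurable
      (continuous_gradient_of_smooth hg).aestronglyMeasurable (gradH1 u) (gradH1 u')).trans
        ((add_le_add a2 b2).trans_eq (ENNReal.add_halves δ))
  · exact (eLpNorm_add_sub_add_le hf.continuous.aestronglyMeasurable
      hg.continuous.aestronglyMeasurable w w').trans
        ((add_le_add a3 b3).trans_eq (ENNReal.add_halves δ))

theorem HasTrace.smul {Ω Γ : Set E} {u : H1 Ω} {w : Lp ℝ 2 (surfaceMeasure Γ)} (c : ℝ)
    (h : HasTrace Ω Γ u w) : HasTrace Ω Γ (c • u) (c • w) := by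
  obtain ⟨f, hf, h1, h2, h3⟩ := h
  have lim : ∀ {a : ℕ → ℝ≥0∞}, Tendsto a atTop (𝓝 0) →
      Tendsto (fun n => ‖c‖ₑ * a n) atTop (𝓝 0) := fun ha => by
    simpa using ENNReal.Tendsto.const_mul ha (Or.inr (by simp : ‖c‖ₑ ≠ ⊤))
  refine ⟨fun n x => c • f n x, fun n => (hf n).const_smul c, ?_, ?_, ?_⟩
  · refine (lim h1).congr fun n => (eLpNorm_smul_sub_smul c (f n) (fnH1 u)).symm
  · simp only [gradient_smul_apply (hf _)]
    refine (lim h2).congr fun n => (eLpNorm_smul_sub_smul c (gradient (f n)) (gradH1 u)).symm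
  · refine (lim h3).congr fun n => (eLpNorm_smul_sub_smul c (f n) w).symm

theorem eLpNorm_le_sub_add {F : Type*} [NormedAddCommGroup F] {X : Type*} [MeasurableSpace X]
    {μ : Measure X} {f : X → F} (hf : AEStronglyMeasurable f μ) (a : Lp F 2 μ) :
    eLpNorm f 2 μ ≤ eLpNorm (fun x => f x - a x) 2 μ + ‖a‖ₑ := by
  rw [Lp.enorm_def]
  refine le_trans (le_of_eq ?_) (eLpNorm_add_le (hf.sub (Lp.aestronglyMeasurable a))
    (Lp.aestronglyMeasurable a) (by norm_num))
  congr 1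
  funext x
  exact (sub_add_cancel (f x) (a x)).symm

theorem enorm_le_sub_add {F : Type*} [NormedAddCommGroup F] {X : Type*} [MeasurableSpace X]
    {μ : Measure X} {f : X → F} (hf : AEStronglyMeasurable f μ) (a : Lp F 2 μ) :
    ‖a‖ₑ ≤ eLpNorm (fun x => f x - a x) 2 μ + eLpNorm f 2 μ := by
  have h : eLpNorm (fun x => f x - a x) 2 μ = eLpNorm (⇑a - f) 2 μ :=
    eLpNorm_sub_comm f a 2 μ
  rw [Lp.enorm_def, h]
  refine le_trans (le_of_eq ?_) (eLpNorm_add_le ((Lp.aestronglyMeasurable a).sub hf)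
    hf (by norm_num))
  rw [sub_add_cancel]

theorem eLpNorm_zero_sub_zero {F : Type*} [NormedAddCommGroup F] {X : Type*} [MeasurableSpace X]
    (μ : Measure X) : eLpNorm (fun x => (0 : F) - (0 : Lp F 2 μ) x) 2 μ = 0 := by
  rw [eLpNorm_congr_ae (g := 0), eLpNorm_zero]
  filter_upwards [Lp.coeFn_zero F 2 μ] with x hx
  rw [hx, Pi.zero_apply, sub_zero]

theorem hasTrace_zero (Ω Γ : Set E) : HasTrace Ω Γ 0 0 := by
  refine hasTrace_iff.2 fun δ _ => ⟨fun _ => 0, contDiff_const, ?_, ?_, ?_⟩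
  · exact (eLpNorm_zero_sub_zero _).le.trans bot_le
  · have : gradient (fun _ : E => (0 : ℝ)) = fun _ => 0 := by
      funext x
      simp [gradient]
    rw [this]
    exact (eLpNorm_zero_sub_zero _).le.trans bot_le
  · exact (eLpNorm_zero_sub_zero _).le.trans bot_le

theorem enorm_fnH1_le {Ω : Set E} (u : H1 Ω) : ‖fnH1 u‖ₑ ≤ ‖u‖ₑ :=
  enorm_le_iff_norm_le.2 (norm_fnH1_le u)

theorem enorm_gradH1_le {Ω : Set E} (u : H1 Ω) : ‖gradH1 u‖ₑ ≤ ‖u‖ₑ :=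
  enorm_le_iff_norm_le.2 (norm_gradH1_le u)

/-- The graph of the trace operator is closed. -/
theorem HasTrace.of_tendsto {Ω Γ : Set E} {u : ℕ → H1 Ω} {w : ℕ → Lp ℝ 2 (surfaceMeasure Γ)}
    {u' : H1 Ω} {w' : Lp ℝ 2 (surfaceMeasure Γ)} (h : ∀ n, HasTrace Ω Γ (u n) (w n))
    (hu : Tendsto u atTop (𝓝 u')) (hw : Tendsto w atTop (𝓝 w')) : HasTrace Ω Γ u' w' := by
  rw [hasTrace_iff]
  intro δ hδ
  have hu1 := tendsto_iff_edist_tendsto_0.1 hu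
  have hw1 := tendsto_iff_edist_tendsto_0.1 hw
  simp only [edist_eq_enorm_sub] at hu1 hw1
  have hδ2 := ENNReal.half_pos hδ.ne'
  obtain ⟨n, hn1, hn2⟩ := ((ENNReal.tendsto_nhds_zero.1 hu1 _ hδ2).and
    (ENNReal.tendsto_nhds_zero.1 hw1 _ hδ2)).exists
  obtain ⟨f, hf, a1, a2, a3⟩ := hasTrace_iff.1 (h n) (δ / 2) hδ2
  refine ⟨f, hf, ?_, ?_, ?_⟩
  · exact (eLpNorm_sub_le_add hf.continuous.aestronglyMeasurable (fnH1 (u n)) (fnH1 u')).trans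
      ((add_le_add a1 ((enorm_fnH1_le (u n - u')).trans hn1)).trans_eq (ENNReal.add_halves δ))
  · exact (eLpNorm_sub_le_add (continuous_gradient_of_smooth hf).aestronglyMeasurable
      (gradH1 (u n)) (gradH1 u')).trans
      ((add_le_add a2 ((enorm_gradH1_le (u n - u')).trans hn1)).trans_eq (ENNReal.add_halves δ))
  · exact (eLpNorm_sub_le_add hf.continuous.aestronglyMeasurable (w n) w').trans
      ((add_le_add a3 hn2).trans_eq (ENNReal.add_halves δ))

theorem eLpNorm_two_sq {F : Type*} [NormedAddCommGroup F] {X : Type*} [MeasurableSpace X]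
    (μ : Measure X) (f : X → F) : eLpNorm f 2 μ ^ 2 = ∫⁻ x, ‖f x‖ₑ ^ 2 ∂μ := by
  have := eLpNorm_nnreal_pow_eq_lintegral (f := f) (μ := μ) (p := 2) (by simp)
  simpa using this

theorem HasTraceBound.exists_eLpNorm_le {Ω Γ : Set E} (h : HasTraceBound Ω Γ) :
    ∃ C : ℝ≥0, ∀ f : E → ℝ, ContDiff ℝ 1 f → eLpNorm f 2 (surfaceMeasure Γ) ≤
      C * (eLpNorm f 2 (volume.restrict Ω) + eLpNorm (gradient f) 2 (volume.restrict Ω)) := by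
  obtain ⟨c, hc, hb⟩ := h
  lift c to ℝ≥0 using hc
  refine ⟨NNReal.sqrt c, fun f hf => ?_⟩
  have h1 := hb f hf
  rw [← eLpNorm_two_sq, ← eLpNorm_two_sq, ← eLpNorm_two_sq] at h1
  refine (ENNReal.pow_le_pow_left_iff (n := 2) (by norm_num)).1 (h1.trans ?_)
  rw [mul_pow, ← ENNReal.coe_pow, NNReal.sq_sqrt]
  gcongr
  rw [add_sq]
  exact add_le_add (le_add_right le_rfl) le_rfl

/-- Traces are bounded in terms of the `H¹` norm. -/
theorem HasTraceBound.exists_norm_le {Ω Γ : Set E} (h : HasTraceBound Ω Γ) :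
    ∃ C : ℝ≥0, ∀ (u : H1 Ω) (w : Lp ℝ 2 (surfaceMeasure Γ)), HasTrace Ω Γ u w →
      ‖w‖ ≤ C * ‖u‖ := by
  obtain ⟨C, hC⟩ := h.exists_eLpNorm_le
  refine ⟨C * 2, fun u w ⟨f, hf, h1, h2, h3⟩ => ?_⟩
  suffices hs : ‖w‖ₑ ≤ C * (‖fnH1 u‖ₑ + ‖gradH1 u‖ₑ) by
    have h4 : ‖w‖ₑ ≤ ENNReal.ofReal (C * 2 * ‖u‖) := by
      refine hs.trans ?_
      rw [ENNReal.ofReal_mul (by positivity), ofReal_norm, ENNReal.ofReal_mul (by positivity),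
        ENNReal.ofReal_coe_nnreal, mul_assoc]
      gcongr
      rw [ENNReal.ofReal_ofNat, two_mul]
      exact add_le_add (enorm_fnH1_le u) (enorm_gradH1_le u)
    rw [← ofReal_norm, ENNReal.ofReal_le_ofReal_iff (by positivity)] at h4
    simpa using h4
  have key : ∀ n, ‖w‖ₑ ≤ eLpNorm (fun x => f n x - w x) 2 (surfaceMeasure Γ) +
      C * ((eLpNorm (fun x => f n x - fnH1 u x) 2 (volume.restrict Ω) + ‖fnH1 u‖ₑ) +
        (eLpNorm (fun x => gradient (f n) x - gradH1 u x) 2 (volume.restrict Ω) +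
          ‖gradH1 u‖ₑ)) := by
    intro n
    have m1 : ∀ μ : Measure E, AEStronglyMeasurable (f n) μ := fun μ =>
      (hf n).continuous.aestronglyMeasurable
    have m2 : ∀ μ : Measure E, AEStronglyMeasurable (gradient (f n)) μ := fun μ =>
      (continuous_gradient_of_smooth (hf n)).aestronglyMeasurable
    have a2 := eLpNorm_le_sub_add (m1 (volume.restrict Ω)) (fnH1 u)
    have a3 := eLpNorm_le_sub_add (m2 (volume.restrict Ω)) (gradH1 u)
    refine (enorm_le_sub_add (m1 _) w).trans (add_le_add le_rfl ((hC (f n) ((hf n).of_le (by simp))).trans ?_))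
    gcongr
  refine ge_of_tendsto' (x := atTop) ?_ key
  have hlim := h3.add (ENNReal.Tendsto.const_mul (a := (C : ℝ≥0∞))
    ((h1.add (tendsto_const_nhds (x := ‖fnH1 u‖ₑ))).add
      (h2.add (tendsto_const_nhds (x := ‖gradH1 u‖ₑ)))) (Or.inr ENNReal.coe_ne_top))
  simpa using hlim

/-- The elements of `H¹(Ω)` that have a trace on `Γ`. -/
def traceSpace (Ω Γ : Set E) : Submodule ℝ (H1 Ω) where
  carrier := {u | ∃ w, HasTrace Ω Γ u w}
  zero_mem' := ⟨0, hasTrace_zero Ω Γ⟩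
  add_mem' := fun ⟨w, hw⟩ ⟨w', hw'⟩ => ⟨w + w', hw.add hw'⟩
  smul_mem' := fun c _ ⟨w, hw⟩ => ⟨c • w, hw.smul c⟩

theorem HasTrace.sub {Ω Γ : Set E} {u u' : H1 Ω} {w w' : Lp ℝ 2 (surfaceMeasure Γ)}
    (h : HasTrace Ω Γ u w) (h' : HasTrace Ω Γ u' w') : HasTrace Ω Γ (u - u') (w - w') := by
  have := h.add (h'.smul (-1))
  simpa [sub_eq_add_neg] using this

/-- The difference of the two is a trace of `0`, and the norm bound for traces makes it vanish. -/
theorem HasTraceBound.eq_of_hasTrace {Ω Γ : Set E} (h : HasTraceBound Ω Γ) {u : H1 Ω}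
    {w w' : Lp ℝ 2 (surfaceMeasure Γ)} (hw : HasTrace Ω Γ u w) (hw' : HasTrace Ω Γ u w') :
    w = w' := by
  obtain ⟨C, hC⟩ := h.exists_norm_le
  have := hC _ _ (hw.sub hw')
  rw [sub_self, norm_zero, mul_zero] at this
  exact sub_eq_zero.1 (norm_le_zero_iff.1 this)

/-- Along a convergent sequence the norm bound makes the traces Cauchy, and the closed graph
identifies their limit as a trace. The subspace is thus a Hilbert space in its own right, whether or
not it is all of `H¹(Ω)`. -/
theorem HasTraceBound.isClosed_traceSpace {Ω Γ : Set E} (h : HasTraceBound Ω Γ) :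
    IsClosed (traceSpace Ω Γ : Set (H1 Ω)) := by
  obtain ⟨C, hC⟩ := h.exists_norm_le
  refine IsSeqClosed.isClosed fun u u' hu hlim => ?_
  choose w hw using hu
  have hcau : CauchySeq w := by
    have hL : ∀ m n, dist (w m) (w n) ≤ C * dist (u m) (u n) := fun m n => by
      rw [dist_eq_norm, dist_eq_norm]
      exact hC _ _ ((hw m).sub (hw n))
    refine Metric.cauchySeq_iff'.2 fun ε hε => ?_
    obtain ⟨N, hN⟩ := Metric.cauchySeq_iff'.1 hlim.cauchySeq (ε / (C + 1)) (by positivity)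
    refine ⟨N, fun n hn => (hL n N).trans_lt ?_⟩
    have h1 := hN n hn
    rw [lt_div_iff₀ (by positivity)] at h1
    nlinarith [dist_nonneg (x := u n) (y := u N)]
  obtain ⟨w', hw'⟩ := cauchySeq_tendsto_of_complete hcau
  exact ⟨w', HasTrace.of_tendsto hw hlim hw'⟩

theorem mem_traceSpace {Ω Γ : Set E} {u : H1 Ω} :
    u ∈ traceSpace Ω Γ ↔ ∃ w, HasTrace Ω Γ u w := Iff.rfl

theorem exists_trace {Ω Γ : Set E} (u : traceSpace Ω Γ) :
    ∃ w, HasTrace Ω Γ (u : H1 Ω) w := mem_traceSpace.1 u.2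

/-- The trace operator as a linear map. -/
def HasTraceBound.traceLM {Ω Γ : Set E} (h : HasTraceBound Ω Γ) :
    traceSpace Ω Γ →ₗ[ℝ] Lp ℝ 2 (surfaceMeasure Γ) where
  toFun u := (exists_trace u).choose
  map_add' u u' := by
    refine h.eq_of_hasTrace (exists_trace (u + u')).choose_spec ?_
    rw [Submodule.coe_add]
    exact (exists_trace u).choose_spec.add (exists_trace u').choose_spec
  map_smul' c u := by
    refine h.eq_of_hasTrace (exists_trace (c • u)).choose_spec ?_
    rw [Submodule.coe_smul]
    exact (exists_trace u).choose_spec.smul c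

theorem HasTraceBound.hasTrace_traceLM {Ω Γ : Set E} (h : HasTraceBound Ω Γ)
    (u : traceSpace Ω Γ) : HasTrace Ω Γ (u : H1 Ω) (h.traceLM u) :=
  (exists_trace u).choose_spec

theorem HasTraceBound.exists_norm_traceLM_le {Ω Γ : Set E} (h : HasTraceBound Ω Γ) :
    ∃ C : ℝ, ∀ u, ‖h.traceLM u‖ ≤ C * ‖u‖ := by
  obtain ⟨C, hC⟩ := h.exists_norm_le
  exact ⟨C, fun u => hC _ _ (h.hasTrace_traceLM u)⟩

/-- The trace operator. -/
def HasTraceBound.traceL {Ω Γ : Set E} (h : HasTraceBound Ω Γ) :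
    traceSpace Ω Γ →L[ℝ] Lp ℝ 2 (surfaceMeasure Γ) :=
  h.traceLM.mkContinuousOfExistsBound h.exists_norm_traceLM_le

theorem HasTraceBound.hasTrace_traceL {Ω Γ : Set E} (h : HasTraceBound Ω Γ)
    (u : traceSpace Ω Γ) : HasTrace Ω Γ (u : H1 Ω) (h.traceL u) :=
  h.hasTrace_traceLM u

theorem HasTraceBound.eq_traceL {Ω Γ : Set E} (h : HasTraceBound Ω Γ)
    (u : traceSpace Ω Γ) {w : Lp ℝ 2 (surfaceMeasure Γ)} (hw : HasTrace Ω Γ (u : H1 Ω) w) :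
    w = h.traceL u :=
  h.eq_of_hasTrace hw (h.hasTrace_traceL u)

end SobolevSpace

/-! ### The contraction semigroup generated by `-S⁻¹` -/

section Yosida
variable {D : Type*} [NormedAddCommGroup D] [InnerProductSpace ℝ D] [CompleteSpace D]

/-- The regularized inverse `(S + κ)⁻¹`. -/
def regInv (S : D →L[ℝ] D) (κ : ℝ) : D →L[ℝ] D := Ring.inverse (S + κ • 1)

/-- Coercivity, `⟪(S + κ) x, x⟫ ≥ κ ‖x‖²`, in the manner of Lax–Milgram. -/
theorem isUnit_add_smul_one {S : D →L[ℝ] D} (hpos : ∀ x, 0 ≤ inner ℝ (S x) x) {κ : ℝ}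
    (hκ : 0 < κ) : IsUnit (S + κ • (1 : D →L[ℝ] D)) := by
  refine ContinuousLinearMap.isUnit_of_forall_le_norm_inner_map _ (c := ⟨κ, hκ.le⟩) hκ fun x => ?_
  refine le_trans ?_ (le_abs_self _)
  simp only [add_apply, smul_apply,
    one_apply_eq_self, inner_add_left, real_inner_smul_left,
    real_inner_self_eq_norm_sq]
  have := hpos x
  change ‖x‖ ^ 2 * κ ≤ _
  linarith

theorem apply_regInv {S : D →L[ℝ] D} (hpos : ∀ x, 0 ≤ inner ℝ (S x) x) {κ : ℝ}
    (hκ : 0 < κ) (x : D) : S (regInv S κ x) + κ • regInv S κ x = x :=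
  congrArg (fun T : D →L[ℝ] D => T x)
    (Ring.mul_inverse_cancel _ (isUnit_add_smul_one hpos hκ))

theorem regInv_apply {S : D →L[ℝ] D} (hpos : ∀ x, 0 ≤ inner ℝ (S x) x) {κ : ℝ}
    (hκ : 0 < κ) (x : D) : regInv S κ (S x) + κ • regInv S κ x = x := by
  have := congrArg (fun T : D →L[ℝ] D => T x)
    (Ring.inverse_mul_cancel _ (isUnit_add_smul_one hpos hκ))
  simpa [regInv] using this

/-- With `y = (S + κ)⁻¹ x` the pairing is `⟪S y, y⟫ + κ ‖y‖²`. This is the dissipativity of the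
regularized generator. -/
theorem inner_regInv_nonneg {S : D →L[ℝ] D} (hpos : ∀ x, 0 ≤ inner ℝ (S x) x) {κ : ℝ}
    (hκ : 0 < κ) (x : D) : 0 ≤ inner ℝ (regInv S κ x) x := by
  have h : inner ℝ (regInv S κ x) x =
      inner ℝ (S (regInv S κ x)) (regInv S κ x) + κ * ‖regInv S κ x‖ ^ 2 := by
    nth_rewrite 2 [← apply_regInv hpos hκ x]
    rw [inner_add_right, real_inner_smul_right, real_inner_self_eq_norm_sq, real_inner_comm]
  rw [h]
  have := hpos (regInv S κ x)
  positivity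

/-- `S` commutes with `(S + κ)⁻¹`, so with `y = (S + κ)⁻¹ x` the claim is `‖S y‖ ≤ ‖S y + κ y‖`,
where the cross term is nonnegative. -/
theorem norm_regInv_apply_le {S : D →L[ℝ] D} (hpos : ∀ x, 0 ≤ inner ℝ (S x) x) {κ : ℝ}
    (hκ : 0 < κ) (x : D) : ‖regInv S κ (S x)‖ ≤ ‖x‖ := by
  set y := regInv S κ x with hy
  have h1 : regInv S κ (S x) = S y := by
    have h2 := apply_regInv hpos hκ x
    have h3 := regInv_apply hpos hκ x
    exact add_right_cancel (h3.trans h2.symm)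
  rw [h1]
  refine le_of_sq_le_sq ?_ (norm_nonneg _)
  rw [← apply_regInv hpos hκ x, ← hy, norm_add_sq_real, real_inner_smul_right]
  have := hpos y
  have := sq_nonneg ‖κ • y‖
  nlinarith [mul_nonneg hκ.le (hpos y)]

omit [CompleteSpace D] in
theorem commute_regInv (S : D →L[ℝ] D) (κ μ : ℝ) : Commute (regInv S κ) (regInv S μ) := by
  refine Commute.ringInverse_ringInverse ?_
  have h1 : Commute S (μ • (1 : D →L[ℝ] D)) := (Commute.one_right S).smul_right μ
  have h2 : Commute (κ • (1 : D →L[ℝ] D)) (S + μ • (1 : D →L[ℝ] D)) :=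
    (Commute.one_left _).smul_left κ
  exact ((Commute.refl S).add_right h1).add_left h2

theorem regInv_sub_regInv {S : D →L[ℝ] D} (hpos : ∀ x, 0 ≤ inner ℝ (S x) x) {κ μ : ℝ}
    (hκ : 0 < κ) (hμ : 0 < μ) (x : D) :
    regInv S μ x - regInv S κ x = (κ - μ) • regInv S κ (regInv S μ x) := by
  have h1 := regInv_apply hpos hκ (regInv S μ x)
  have h2 := congrArg (regInv S κ) (apply_regInv hpos hμ x)
  rw [map_add, map_smul] at h2
  rw [sub_smul, ← h2]
  nth_rewrite 1 [← h1]
  abel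

/-- The regularized semigroup `exp (-t (S + κ)⁻¹)`. -/
def regExp (S : D →L[ℝ] D) (κ t : ℝ) : D →L[ℝ] D := NormedSpace.exp (t • (-regInv S κ))

theorem hasDerivAt_regExp (S : D →L[ℝ] D) (κ t : ℝ) :
    HasDerivAt (regExp S κ) (regExp S κ t * (-regInv S κ)) t :=
  hasDerivAt_exp_smul_const (-regInv S κ) t

omit [CompleteSpace D] in
theorem commute_regExp_regInv (S : D →L[ℝ] D) (κ μ t : ℝ) :
    Commute (regExp S κ t) (regInv S μ) := by
  have h : Commute (t • (-regInv S κ)) (regInv S μ) :=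
    ((commute_regInv S κ μ).neg_left).smul_left t
  exact h.exp_left

theorem hasDerivAt_regExp_apply (S : D →L[ℝ] D) (κ t : ℝ) (x : D) :
    HasDerivAt (fun t => regExp S κ t x) (-regInv S κ (regExp S κ t x)) t := by
  have h := (hasDerivAt_regExp S κ t).clm_apply (hasDerivAt_const t x)
  refine h.congr_deriv ?_
  have := congrArg (fun T : D →L[ℝ] D => T x) (commute_regExp_regInv S κ κ t).eq
  simp only [mul_apply_eq_comp] at this
  simp [this]

omit [CompleteSpace D] in
theorem regExp_zero (S : D →L[ℝ] D) (κ : ℝ) : regExp S κ 0 = 1 := by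
  simp [regExp]

/-- The squared norm of an orbit has derivative `-2 ⟪(S + κ)⁻¹ y, y⟫ ≤ 0` at the point `y` of the
orbit. -/
theorem norm_regExp_apply_le {S : D →L[ℝ] D} (hpos : ∀ x, 0 ≤ inner ℝ (S x) x) {κ : ℝ}
    (hκ : 0 < κ) {t : ℝ} (ht : 0 ≤ t) (x : D) : ‖regExp S κ t x‖ ≤ ‖x‖ := by
  have hd : ∀ t, HasDerivAt (fun t => ‖regExp S κ t x‖ ^ 2)
      (2 * inner ℝ (regExp S κ t x) (-regInv S κ (regExp S κ t x))) t := fun t =>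
    (hasDerivAt_regExp_apply S κ t x).norm_sq
  have hanti : Antitone fun t => ‖regExp S κ t x‖ ^ 2 := by
    refine antitone_of_deriv_nonpos (fun t => (hd t).differentiableAt) fun t => ?_
    rw [(hd t).deriv, inner_neg_right, real_inner_comm]
    have := inner_regInv_nonneg hpos hκ (regExp S κ t x)
    linarith
  have := hanti ht
  simp only [regExp_zero, one_apply_eq_self] at this
  exact le_of_sq_le_sq this (norm_nonneg _)

/-- The path `s ↦ e_κ(s) e_μ(t - s) x` joins the two orbits; since everything commutes, its velocity
is a contraction applied to the difference of the generators at `x`. -/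
theorem norm_regExp_sub_le {S : D →L[ℝ] D} (hpos : ∀ x, 0 ≤ inner ℝ (S x) x) {κ μ : ℝ}
    (hκ : 0 < κ) (hμ : 0 < μ) {t : ℝ} (ht : 0 ≤ t) (x : D) :
    ‖regExp S κ t x - regExp S μ t x‖ ≤ t * ‖regInv S μ x - regInv S κ x‖ := by
  set f' : ℝ → D := fun s => regExp S κ s (regExp S μ (t - s) (regInv S μ x - regInv S κ x))
  have hd : ∀ s, HasDerivAt (fun s => regExp S κ s (regExp S μ (t - s) x)) (f' s) s := by
    intro s
    have h1 := (hasDerivAt_regExp_apply S μ (t - s) x).scomp s ((hasDerivAt_id s).const_sub t)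
    have h2 := (hasDerivAt_regExp S κ s).clm_apply h1
    refine h2.congr_deriv ?_
    have c1 := congrArg (fun T : D →L[ℝ] D => T x) (commute_regExp_regInv S μ μ (t - s)).eq
    have c2 := congrArg (fun T : D →L[ℝ] D => T x) (commute_regExp_regInv S μ κ (t - s)).eq
    simp only [mul_apply_eq_comp] at c1 c2
    simp only [f', Function.comp_apply, map_sub, mul_apply_eq_comp,
      neg_apply, map_neg, neg_smul, one_smul, neg_neg, c1, c2]
    abel
  have := norm_image_sub_le_of_norm_deriv_le_segment' (a := 0) (b := t)
    (C := ‖regInv S μ x - regInv S κ x‖) (fun s _ => (hd s).hasDerivWithinAt) (fun s hs => ?_) t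
    ⟨ht, le_rfl⟩
  · simpa [regExp_zero, mul_comm] using this
  · exact (norm_regExp_apply_le hpos hκ hs.1 _).trans
      (norm_regExp_apply_le hpos hμ (by linarith [hs.2]) _)

/-- The resolvent identity produces the factor `κ - μ` and two regularized inverses. Each of them
needs one factor `S` to become a contraction, hence the double `S`. -/
theorem norm_regExp_sub_le_of_range {S : D →L[ℝ] D} (hpos : ∀ x, 0 ≤ inner ℝ (S x) x) {κ μ : ℝ}
    (hκ : 0 < κ) (hμ : 0 < μ) {t : ℝ} (ht : 0 ≤ t) (y : D) :
    ‖regExp S κ t (S (S y)) - regExp S μ t (S (S y))‖ ≤ t * (|κ - μ| * ‖y‖) := by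
  refine (norm_regExp_sub_le hpos hκ hμ ht _).trans ?_
  rw [regInv_sub_regInv hpos hκ hμ, norm_smul, Real.norm_eq_abs]
  gcongr
  have hc : ∀ z, regInv S μ (S z) = S (regInv S μ z) := fun z =>
    add_right_cancel ((regInv_apply hpos hμ z).trans (apply_regInv hpos hμ z).symm)
  rw [hc]
  exact (norm_regInv_apply_le hpos hκ _).trans (norm_regInv_apply_le hpos hμ _)

/-- Applying `S + κ` to the differential equation cancels the inverse. The integrated form involves
only bounded operators and survives the limit `κ → 0`. -/
theorem integral_regExp {S : D →L[ℝ] D} (hpos : ∀ x, 0 ≤ inner ℝ (S x) x) {κ : ℝ}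
    (hκ : 0 < κ) (t : ℝ) (x : D) :
    S (regExp S κ t x) + κ • regExp S κ t x = S x + κ • x - ∫ r in (0 : ℝ)..t, regExp S κ r x := by
  have hc : Continuous fun r => regExp S κ r x :=
    continuous_iff_continuousAt.2 fun r => (hasDerivAt_regExp_apply S κ r x).continuousAt
  have hd : ∀ r, HasDerivAt (fun r => -(S (regExp S κ r x) + κ • regExp S κ r x))
      (regExp S κ r x) r := by
    intro r
    have h1 := hasDerivAt_regExp_apply S κ r x
    have h2 := ((S.hasFDerivAt.comp_hasDerivAt r h1).add (h1.const_smul κ)).neg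
    refine h2.congr_deriv ?_
    rw [map_neg, smul_neg, ← neg_add, neg_neg, apply_regInv hpos hκ]
  rw [intervalIntegral.integral_eq_sub_of_hasDerivAt (fun r _ => hd r)
    (hc.intervalIntegrable _ _), regExp_zero]
  simp only [one_apply_eq_self]
  abel

/-- By symmetry, the orthogonal complement of the range is the kernel. -/
theorem denseRange_of_symmetric_injective {S : D →L[ℝ] D}
    (hsymm : ∀ x y, inner ℝ (S x) y = inner ℝ x (S y)) (hinj : ∀ x, S x = 0 → x = 0) :
    DenseRange S := by
  have h : (LinearMap.range (S : D →ₗ[ℝ] D)).topologicalClosure = ⊤ := by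
    rw [Submodule.topologicalClosure_eq_top_iff, Submodule.eq_bot_iff]
    intro x hx
    refine hinj x (ext_inner_left ℝ fun y => ?_)
    rw [← hsymm, inner_zero_right]
    exact hx (S y) ⟨y, rfl⟩
  have h2 := (Submodule.dense_iff_topologicalClosure_eq_top).2 h
  exact h2

/-- The strongly continuous contraction semigroup generated by `-S⁻¹`. -/
theorem exists_semigroup {S : D →L[ℝ] D}
    (hsymm : ∀ x y, inner ℝ (S x) y = inner ℝ x (S y)) (hpos : ∀ x, 0 ≤ inner ℝ (S x) x)
    (hinj : ∀ x, S x = 0 → x = 0) :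
    ∃ F : ℝ → D → D, (∀ x, Continuous fun t => F t x) ∧
      (∀ t x y, ‖F t x - F t y‖ ≤ ‖x - y‖) ∧ (∀ t, F t 0 = 0) ∧ (∀ x, F 0 x = x) ∧
      ∀ x t, 0 ≤ t → S (F t x) = S x - ∫ r in (0 : ℝ)..t, F r x := by
  set κ : ℕ → ℝ := fun n => 1 / ((n : ℝ) + 1) with hκdef
  have hκ : ∀ n, 0 < κ n := fun n => by positivity
  have hκ0 : Tendsto κ atTop (𝓝 0) := tendsto_one_div_add_atTop_nhds_zero_nat
  -- Freezing the orbit at negative times makes it a bounded continuous function on all of `ℝ`.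
  set e : ℕ → D → ℝ → D := fun n x t => regExp S (κ n) (max t 0) x with he
  have hec : ∀ n x, Continuous (e n x) := fun n x =>
    (continuous_iff_continuousAt.2 fun r =>
      (hasDerivAt_regExp_apply S (κ n) r x).continuousAt).comp (by fun_prop)
  have hen : ∀ n x t, ‖e n x t‖ ≤ ‖x‖ := fun n x t =>
    norm_regExp_apply_le hpos (hκ n) (le_max_right _ _) x
  have hdense : DenseRange (S ∘ S) :=
    (denseRange_of_symmetric_injective hsymm hinj).comp
      (denseRange_of_symmetric_injective hsymm hinj) S.continuous
  have hcau : ∀ x T, UniformCauchySeqOn (fun n => e n x) atTop (Iic T) := by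
    intro x T
    rw [Metric.uniformCauchySeqOn_iff]
    intro ε hε
    -- A three-term estimate: contractivity handles the replacement of `x` by `S (S y)` uniformly in
    -- `n`, and on the range of `S²` the orbits are Cauchy uniformly for `t ≤ T`.
    obtain ⟨y, hy⟩ := hdense.exists_dist_lt x (show (0 : ℝ) < ε / 3 by positivity)
    have hy' : ‖x - S (S y)‖ < ε / 3 := by rwa [dist_eq_norm] at hy
    obtain ⟨N, hN⟩ := Metric.cauchySeq_iff.1 hκ0.cauchySeq
      (ε / 3 / ((max T 0 + 1) * (‖y‖ + 1))) (by positivity)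
    refine ⟨N, fun m hm n hn t ht => ?_⟩
    have h1 : ‖e m (S (S y)) t - e n (S (S y)) t‖ ≤ ε / 3 := by
      refine (norm_regExp_sub_le_of_range hpos (hκ m) (hκ n) (le_max_right _ _) y).trans ?_
      have h2 := hN m hm n hn
      rw [Real.dist_eq, lt_div_iff₀ (by positivity)] at h2
      have h3 : max t 0 ≤ max T 0 := max_le_max_right 0 ht
      calc max t 0 * (|κ m - κ n| * ‖y‖)
          ≤ (max T 0 + 1) * (|κ m - κ n| * (‖y‖ + 1)) := by gcongr <;> linarith
        _ = |κ m - κ n| * ((max T 0 + 1) * (‖y‖ + 1)) := by ring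
        _ ≤ ε / 3 := h2.le
    have h4 : ∀ k, ‖e k x t - e k (S (S y)) t‖ < ε / 3 := fun k => by
      simp only [he]
      rw [← map_sub]
      exact (hen k (x - S (S y)) t).trans_lt hy'
    rw [dist_eq_norm]
    calc ‖e m x t - e n x t‖ = ‖(e m x t - e m (S (S y)) t) +
          (e m (S (S y)) t - e n (S (S y)) t) - (e n x t - e n (S (S y)) t)‖ := by congr 1; abel
      _ ≤ ‖e m x t - e m (S (S y)) t‖ + ‖e m (S (S y)) t - e n (S (S y)) t‖ +
          ‖e n x t - e n (S (S y)) t‖ := (norm_sub_le _ _).trans (by gcongr; exact norm_add_le _ _)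
      _ < ε := by linarith [h4 m, h4 n]
  have hlim : ∀ t x, ∃ z, Tendsto (fun n => e n x t) atTop (𝓝 z) := fun t x =>
    cauchySeq_tendsto_of_complete ((hcau x t).cauchySeq (mem_Iic.2 le_rfl))
  choose F hF using hlim
  have hFc : ∀ x, Continuous fun t => F t x := by
    intro x
    have hu : ∀ T, TendstoUniformlyOn (fun n => e n x) (fun t => F t x) atTop (Iic T) := fun T =>
      (hcau x T).tendstoUniformlyOn_of_tendsto fun t _ => hF t x
    refine continuous_iff_continuousAt.2 fun t => ?_
    have := (hu (t + 1)).continuousOn (Frequently.of_forall fun n => (hec n x).continuousOn)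
    exact this.continuousAt (Iic_mem_nhds (by linarith))
  refine ⟨F, hFc, fun t x y => ?_, fun t => ?_, fun x => ?_, fun x t ht => ?_⟩
  · refine le_of_tendsto ((hF t x).sub (hF t y)).norm (Eventually.of_forall fun n => ?_)
    simp only [he]
    rw [← map_sub]
    exact hen n (x - y) t
  · refine tendsto_nhds_unique (hF t 0) (tendsto_const_nhds.congr fun n => ?_)
    simp [he]
  · refine tendsto_nhds_unique (hF 0 x) (tendsto_const_nhds.congr fun n => ?_)
    simp [he, regExp_zero]
  -- The generator identity is the limit of the regularized ones; the terms with `κ n` vanish and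
  -- `‖x‖` dominates the integrand.
  · have h1 : ∀ n, S (e n x t) + κ n • e n x t = S x + κ n • x - ∫ r in (0 : ℝ)..t, e n x r := by
      intro n
      have h2 := integral_regExp hpos (hκ n) t x
      simp only [he, max_eq_left ht]
      rw [h2]
      congr 1
      refine intervalIntegral.integral_congr fun r hr => ?_
      rw [uIcc_of_le ht] at hr
      simp only [max_eq_left hr.1]
    have h3 : Tendsto (fun n => ∫ r in (0 : ℝ)..t, e n x r) atTop
        (𝓝 (∫ r in (0 : ℝ)..t, F r x)) :=
      intervalIntegral.tendsto_integral_filter_of_dominated_convergence (fun _ => ‖x‖)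
        (Eventually.of_forall fun n => (hec n x).aestronglyMeasurable)
        (Eventually.of_forall fun n => ae_of_all _ fun r _ => hen n x r)
        intervalIntegrable_const (ae_of_all _ fun r _ => hF r x)
    have h4 := ((S.continuous.tendsto _).comp (hF t x)).add (hκ0.smul (hF t x))
    have h5 := ((tendsto_const_nhds (x := S x)).add (hκ0.smul_const x)).sub h3
    have h6 := tendsto_nhds_unique (h4.congr h1) h5
    simpa using h6

end Yosida

/-! ### Mild solutions of a bounded perturbation -/

section Mild
open scoped BoundedContinuousFunction
variable {X : Type*} [NormedAddCommGroup X] [NormedSpace ℝ X] [CompleteSpace X]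

/-- The left side is `(1 - exp (-(l t))) / l`. In an exponentially weighted norm, time integration
therefore gains `1 / l`, uniformly in `t`. -/
theorem exp_mul_integral_exp_le {l t : ℝ} (hl : 0 < l) :
    Real.exp (-(l * t)) * ∫ s in (0 : ℝ)..t, Real.exp (l * s) ≤ 1 / l := by
  have h : ∫ s in (0 : ℝ)..t, Real.exp (l * s) = (Real.exp (l * t) - 1) / l := by
    rw [intervalIntegral.integral_comp_mul_left _ hl.ne', integral_exp]
    simp [div_eq_inv_mul]
  rw [h, ← mul_div_assoc, mul_sub, ← Real.exp_add]
  simp only [neg_add_cancel, Real.exp_zero, mul_one]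
  have := Real.exp_pos (-(l * t))
  gcongr
  linarith

omit [NormedSpace ℝ X] [CompleteSpace X] in
theorem continuous_uncurry_of_lipschitz {F : ℝ → X → X} (hFc : ∀ x, Continuous fun t => F t x)
    (hFL : ∀ t x y, ‖F t x - F t y‖ ≤ ‖x - y‖) : Continuous fun p : ℝ × X => F p.1 p.2 := by
  exact continuous_prod_of_continuous_lipschitzWith' _ 1
    (fun t => LipschitzWith.of_dist_le_mul fun x y => by simpa [dist_eq_norm] using hFL t x y) hFc

/-- Existence of a global mild solution for a bounded perturbation of a contraction semigroup. -/
theorem exists_mild_solution {F : ℝ → X → X} (hFc : ∀ x, Continuous fun t => F t x)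
    (hFL : ∀ t x y, ‖F t x - F t y‖ ≤ ‖x - y‖) (hF0 : ∀ t, F t 0 = 0) (K : X →L[ℝ] X) (W₀ : X) :
    ∃ W : ℝ → X, Continuous W ∧
      ∀ t, 0 ≤ t → W t = F t W₀ + ∫ s in (0 : ℝ)..t, F (t - s) (K (W s)) := by
  have hF := continuous_uncurry_of_lipschitz hFc hFL
  have hFn : ∀ t x, ‖F t x‖ ≤ ‖x‖ := fun t x => by simpa [hF0] using hFL t x 0
  -- Any rate above `‖K‖` makes the contraction factor `‖K‖ / l` less than `1`, so one fixed point
  -- covers all times.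
  set l : ℝ := ‖K‖ + 1 with hl
  have hl0 : 0 < l := by positivity
  set G : (ℝ →ᵇ X) → ℝ → ℝ → X := fun f t s => F (max t 0 - s) (K (Real.exp (l * s) • f s)) with hG
  have hGc : ∀ f, Continuous fun p : ℝ × ℝ => G f p.1 p.2 := fun f => by
    have hf := f.continuous
    refine hF.comp (f := fun p : ℝ × ℝ => (max p.1 0 - p.2, K (Real.exp (l * p.2) • f p.2))) ?_
    fun_prop
  have hGi : ∀ f t a b, IntervalIntegrable (G f t) volume a b := fun f t a b =>
    ((hGc f).comp (by fun_prop : Continuous fun s : ℝ => (t, s))).intervalIntegrable a b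
  -- The unknown is `f t = exp (-l t) • W t`, which is bounded, so the fixed point is sought among
  -- bounded continuous functions; `max t 0` extends it constantly to negative times.
  set Φ : (ℝ →ᵇ X) → ℝ → X := fun f t =>
    Real.exp (-(l * max t 0)) • (F (max t 0) W₀ + ∫ s in (0 : ℝ)..max t 0, G f t s) with hΦ
  have hΦc : ∀ f, Continuous (Φ f) := fun f => by
    have h1 : Continuous fun t : ℝ => F (max t 0) W₀ := (hFc W₀).comp (by fun_prop)
    have h2 : Continuous fun t : ℝ => ∫ s in (0 : ℝ)..max t 0, G f t s :=
      intervalIntegral.continuous_parametric_intervalIntegral_of_continuous (hGc f) (by fun_prop)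
    simp only [hΦ]
    fun_prop
  have hint : ∀ (C : ℝ) (H : ℝ → X) (t : ℝ), 0 ≤ t → 0 ≤ C →
      (∀ s, ‖H s‖ ≤ C * Real.exp (l * s)) →
      Real.exp (-(l * t)) * ‖∫ s in (0 : ℝ)..t, H s‖ ≤ C / l := by
    intro C H t ht hC hH
    have h1 : ‖∫ s in (0 : ℝ)..t, H s‖ ≤ ∫ s in (0 : ℝ)..t, C * Real.exp (l * s) :=
      intervalIntegral.norm_integral_le_of_norm_le ht (ae_of_all _ fun s _ => hH s)
        (Continuous.intervalIntegrable (by fun_prop) _ _)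
    rw [intervalIntegral.integral_const_mul] at h1
    calc Real.exp (-(l * t)) * ‖∫ s in (0 : ℝ)..t, H s‖
        ≤ Real.exp (-(l * t)) * (C * ∫ s in (0 : ℝ)..t, Real.exp (l * s)) := by gcongr
      _ = C * (Real.exp (-(l * t)) * ∫ s in (0 : ℝ)..t, Real.exp (l * s)) := by ring
      _ ≤ C * (1 / l) := by gcongr; exact exp_mul_integral_exp_le hl0
      _ = C / l := by ring
  have hexp : ∀ t : ℝ, Real.exp (-(l * max t 0)) ≤ 1 := fun t =>
    Real.exp_le_one_iff.2 (by have := le_max_right t 0; nlinarith)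
  have hΦb : ∀ f t, ‖Φ f t‖ ≤ ‖W₀‖ + ‖K‖ * ‖f‖ / l := by
    intro f t
    simp only [hΦ]
    rw [smul_add]
    refine (norm_add_le _ _).trans (add_le_add ?_ ?_)
    · rw [norm_smul, Real.norm_eq_abs, Real.abs_exp]
      exact (mul_le_mul (hexp t) (hFn _ _) (norm_nonneg _) zero_le_one).trans_eq (one_mul _)
    · rw [norm_smul, Real.norm_eq_abs, Real.abs_exp]
      refine hint _ _ _ (le_max_right _ _) (by positivity) fun s => ?_
      refine (hFn _ _).trans ((K.le_opNorm _).trans ?_)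
      rw [norm_smul, Real.norm_eq_abs, Real.abs_exp, mul_assoc, mul_comm (Real.exp _)]
      gcongr
      exact f.norm_coe_le_norm s
  let Ψ : (ℝ →ᵇ X) → (ℝ →ᵇ X) := fun f =>
    BoundedContinuousFunction.ofNormedAddCommGroup (Φ f) (hΦc f) _ (hΦb f)
  have hcontr : ContractingWith (Real.toNNReal (‖K‖ / l)) Ψ := by
    refine ⟨?_, LipschitzWith.of_dist_le_mul fun f g => ?_⟩
    · rw [Real.toNNReal_lt_one, div_lt_one hl0, hl]
      linarith
    · rw [Real.coe_toNNReal _ (by positivity)]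
      refine (BoundedContinuousFunction.dist_le (by positivity)).2 fun t => ?_
      change dist (Φ f t) (Φ g t) ≤ ‖K‖ / l * dist f g
      rw [dist_eq_norm, dist_eq_norm]
      simp only [hΦ]
      rw [← smul_sub, add_sub_add_left_eq_sub,
        ← intervalIntegral.integral_sub (hGi f t _ _) (hGi g t _ _), norm_smul, Real.norm_eq_abs,
        Real.abs_exp]
      refine (hint (‖K‖ * ‖f - g‖) _ _ (le_max_right _ _) (by positivity) fun s => ?_).trans_eq
        (by ring)
      refine (hFL _ _ _).trans ?_
      rw [← map_sub, ← smul_sub]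
      refine (K.le_opNorm _).trans ?_
      rw [norm_smul, Real.norm_eq_abs, Real.abs_exp, mul_assoc, mul_comm (Real.exp _)]
      gcongr
      exact (f - g).norm_coe_le_norm s
  set f := hcontr.fixedPoint Ψ with hf
  have hfix : ∀ t, Φ f t = f t := fun t =>
    congrArg (fun g : ℝ →ᵇ X => g t) hcontr.fixedPoint_isFixedPt
  refine ⟨fun t => Real.exp (l * t) • f t, by have := f.continuous; fun_prop, fun t ht => ?_⟩
  simp only
  rw [← hfix t]
  simp only [hΦ, hG, max_eq_left ht]
  rw [smul_smul, ← Real.exp_add, add_neg_cancel, Real.exp_zero, one_smul]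

omit [CompleteSpace X] in
-- Fubini on the triangle `s < τ`: both sides integrate over the square the same function, cut off
-- by the indicator of the triangle.
theorem integral_triangle_swap {h : ℝ → ℝ → X} (hh : Continuous fun p : ℝ × ℝ => h p.1 p.2)
    {t : ℝ} (ht : 0 ≤ t) :
    ∫ s in (0 : ℝ)..t, ∫ τ in s..t, h s τ = ∫ τ in (0 : ℝ)..t, ∫ s in (0 : ℝ)..τ, h s τ := by
  set μ := (volume : Measure ℝ).restrict (Ioc 0 t) with hμ
  set k : ℝ → ℝ → X := fun s τ => {p : ℝ × ℝ | p.1 < p.2}.indicator (fun p => h p.1 p.2) (s, τ)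
    with hk
  have hmeas : MeasurableSet {p : ℝ × ℝ | p.1 < p.2} :=
    measurableSet_lt measurable_fst measurable_snd
  have hki : Integrable (Function.uncurry k) (μ.prod μ) := by
    have h1 : Integrable (fun p : ℝ × ℝ => h p.1 p.2) (μ.prod μ) := by
      rw [hμ, Measure.prod_restrict, ← Measure.volume_eq_prod]
      exact (hh.continuousOn.integrableOn_compact (isCompact_Icc.prod isCompact_Icc)).mono_set
        (prod_mono Ioc_subset_Icc_self Ioc_subset_Icc_self)
    exact h1.indicator hmeas
  have h1 : ∫ s in (0 : ℝ)..t, ∫ τ in s..t, h s τ = ∫ s, ∫ τ, k s τ ∂μ ∂μ := by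
    rw [intervalIntegral.integral_of_le ht]
    refine setIntegral_congr_fun measurableSet_Ioc fun s hs => ?_
    have h2 : (fun τ => k s τ) = (Ioi s).indicator (h s) := by
      funext τ
      simp [hk, Set.indicator]
    rw [h2, integral_indicator measurableSet_Ioi, hμ, Measure.restrict_restrict measurableSet_Ioi,
      intervalIntegral.integral_of_le hs.2]
    congr 2
    ext τ
    simp only [mem_Ioc, mem_inter_iff, mem_Ioi]
    exact ⟨fun hh => ⟨hh.1, hs.1.trans hh.1, hh.2⟩, fun hh => ⟨hh.1, hh.2.2⟩⟩
  have h3 : ∫ τ in (0 : ℝ)..t, ∫ s in (0 : ℝ)..τ, h s τ = ∫ τ, ∫ s, k s τ ∂μ ∂μ := by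
    rw [intervalIntegral.integral_of_le ht]
    refine setIntegral_congr_fun measurableSet_Ioc fun τ hτ => ?_
    have h2 : (fun s => k s τ) = (Iio τ).indicator (fun s => h s τ) := by
      funext s
      simp [hk, Set.indicator]
    rw [h2, integral_indicator measurableSet_Iio, hμ, Measure.restrict_restrict measurableSet_Iio,
      intervalIntegral.integral_of_le hτ.1.le, integral_Ioc_eq_integral_Ioo]
    congr 2
    ext s
    simp only [mem_Ioo, mem_inter_iff, mem_Iio, mem_Ioc]
    exact ⟨fun hh => ⟨hh.2, hh.1, (hh.2.trans_le hτ.2).le⟩, fun hh => ⟨hh.2.1, hh.1⟩⟩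
  rw [h1, h3, integral_integral_swap hki]

/-- Mild solutions solve the integrated equation. -/
theorem apply_mild_solution {S : X →L[ℝ] X} {F : ℝ → X → X} (hFc : ∀ x, Continuous fun t => F t x)
    (hFL : ∀ t x y, ‖F t x - F t y‖ ≤ ‖x - y‖)
    (hS : ∀ x t, 0 ≤ t → S (F t x) = S x - ∫ r in (0 : ℝ)..t, F r x) {k z : ℝ → X}
    (hk : Continuous k) {z₀ : X}
    (hz : ∀ t, 0 ≤ t → z t = F t z₀ + ∫ s in (0 : ℝ)..t, F (t - s) (k s)) {t : ℝ} (ht : 0 ≤ t) :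
    S (z t) = S z₀ - (∫ s in (0 : ℝ)..t, z s) + ∫ s in (0 : ℝ)..t, S (k s) := by
  have hF := continuous_uncurry_of_lipschitz hFc hFL
  have hFk : Continuous fun p : ℝ × ℝ => F (p.2 - p.1) (k p.1) :=
    hF.comp (f := fun p : ℝ × ℝ => (p.2 - p.1, k p.1)) (by fun_prop)
  have hc1 : Continuous fun s => F (t - s) (k s) :=
    hFk.comp (by fun_prop : Continuous fun s : ℝ => (s, t))
  have hc2 : Continuous fun τ => ∫ s in (0 : ℝ)..τ, F (τ - s) (k s) :=
    intervalIntegral.continuous_parametric_intervalIntegral_of_continuous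
      (f := fun τ s => F (τ - s) (k s))
      (hFk.comp (by fun_prop : Continuous fun p : ℝ × ℝ => (p.2, p.1))) continuous_id
  have hc3 : Continuous fun s => ∫ τ in s..t, F (τ - s) (k s) := by
    simp only [intervalIntegral.integral_symm t]
    exact (intervalIntegral.continuous_parametric_intervalIntegral_of_continuous
      (f := fun s τ => F (τ - s) (k s)) hFk continuous_id).neg
  -- The generator identity is used under the Duhamel integral; its double integral cancels against
  -- the one hidden in `∫ z`, computed next with the order of integration exchanged.
  have e1 : S (∫ s in (0 : ℝ)..t, F (t - s) (k s)) =
      (∫ s in (0 : ℝ)..t, S (k s)) - ∫ s in (0 : ℝ)..t, ∫ τ in s..t, F (τ - s) (k s) := by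
    rw [← S.intervalIntegral_comp_comm (hc1.intervalIntegrable _ _),
      ← intervalIntegral.integral_sub ((by fun_prop : Continuous fun s => S (k s)).intervalIntegrable
        _ _) (hc3.intervalIntegrable _ _)]
    refine intervalIntegral.integral_congr fun s hs => ?_
    rw [uIcc_of_le ht] at hs
    rw [hS _ _ (sub_nonneg.2 hs.2),
      intervalIntegral.integral_comp_sub_right (fun r => F r (k s)) s, sub_self]
  have e2 : ∫ s in (0 : ℝ)..t, z s = (∫ s in (0 : ℝ)..t, F s z₀) +
      ∫ s in (0 : ℝ)..t, ∫ τ in s..t, F (τ - s) (k s) := by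
    rw [integral_triangle_swap hFk ht,
      ← intervalIntegral.integral_add ((hFc z₀).intervalIntegrable _ _)
        (hc2.intervalIntegrable _ _)]
    refine intervalIntegral.integral_congr fun s hs => ?_
    rw [uIcc_of_le ht] at hs
    exact hz s hs.1
  rw [hz t ht, map_add, hS z₀ t ht, e1, e2]
  abel

end Mild

/-! ### Existence for the abstract evolution problem -/

section Evolution
variable {D Y : Type*} [NormedAddCommGroup D] [InnerProductSpace ℝ D] [CompleteSpace D]
  [NormedAddCommGroup Y] [NormedSpace ℝ Y] [CompleteSpace Y]

/-- The abstract evolution problem `(S u)' = S u - u - N u + Q v`, `v' = M v + P u`, in integrated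
form. -/
structure IsEvolution {D Y : Type*} [NormedAddCommGroup D] [NormedSpace ℝ D]
    [NormedAddCommGroup Y] [NormedSpace ℝ Y] (S N : D →L[ℝ] D) (Q : Y →L[ℝ] D) (M : Y →L[ℝ] Y)
    (P : D →L[ℝ] Y) (u₀ : D) (v₀ : Y) (u : ℝ → D) (v : ℝ → Y) : Prop where
  continuousOn_u : ContinuousOn u (Ici 0)
  continuousOn_v : ContinuousOn v (Ici 0)
  initial_u : u 0 = u₀
  eq_u : ∀ t, 0 ≤ t → S (u t) = S u₀ + ∫ s in (0 : ℝ)..t, (S (u s) - u s - N (u s) + Q (v s))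
  eq_v : ∀ t, 0 ≤ t → v t = v₀ + ∫ s in (0 : ℝ)..t, (M (v s) + P (u s))

/-- The term `Q v` cannot be inverted by `S`, but `z = u - Q v` satisfies `(S z)' = -z + S k` with
`k = u - Q (M v + P u)`. Thus `(z, v)` solves `z' = -S⁻¹ z + k`, `v' = M v + P u`, a bounded linear
perturbation of a contraction semigroup. -/
theorem exists_isEvolution_zero {S : D →L[ℝ] D}
    (hsymm : ∀ x y, inner ℝ (S x) y = inner ℝ x (S y)) (hpos : ∀ x, 0 ≤ inner ℝ (S x) x)
    (hinj : ∀ x, S x = 0 → x = 0) (Q : Y →L[ℝ] D) (M : Y →L[ℝ] Y) (P : D →L[ℝ] Y) (u₀ : D)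
    (v₀ : Y) :
    ∃ u v, IsEvolution S 0 Q M P u₀ v₀ u v := by
  obtain ⟨F, hFc, hFL, hF0, hFi, hFS⟩ := exists_semigroup hsymm hpos hinj
  set pu : D × Y →L[ℝ] D := ContinuousLinearMap.fst ℝ D Y + Q.comp (ContinuousLinearMap.snd ℝ D Y)
    with hpu
  set kv : D × Y →L[ℝ] Y := M.comp (ContinuousLinearMap.snd ℝ D Y) + P.comp pu with hkv
  set K : D × Y →L[ℝ] D × Y := (pu - Q.comp kv).prod kv with hK
  -- The semigroup acts on `z` and trivially on `v`; all coupling sits in `K`.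
  obtain ⟨W, hWc, hW⟩ := exists_mild_solution (F := fun t (x : D × Y) => (F t x.1, x.2))
    (fun x => by have := hFc x.1; fun_prop)
    (fun t x y => by
      rw [Prod.mk_sub_mk]
      exact max_le_max_right _ (hFL t x.1 y.1))
    (fun t => by simp [hF0]) K (u₀ - Q v₀, v₀)
  set z : ℝ → D := fun t => (W t).1
  set v : ℝ → Y := fun t => (W t).2
  set u : ℝ → D := fun t => z t + Q (v t) with hu
  have hzc : Continuous z := by fun_prop
  have hvc : Continuous v := by fun_prop
  have huc : Continuous u := by fun_prop
  set k : ℝ → D := fun t => u t - Q (M (v t) + P (u t)) with hk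
  have hkc : Continuous k := by fun_prop
  have hKW : ∀ s, K (W s) = (k s, M (v s) + P (u s)) := fun s => by
    simp [hK, hk, hkv, hpu, hu, z, v]
  have hint : ∀ t, Continuous fun s => ((F (t - s) (k s), M (v s) + P (u s)) : D × Y) := fun t => by
    have h1 := (continuous_uncurry_of_lipschitz hFc hFL).comp
      (f := fun s : ℝ => (t - s, k s)) (by fun_prop)
    exact h1.prodMk (by fun_prop)
  have hz : ∀ t, 0 ≤ t → z t = F t (u₀ - Q v₀) + ∫ s in (0 : ℝ)..t, F (t - s) (k s) := by
    intro t ht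
    have h1 := congrArg (ContinuousLinearMap.fst ℝ D Y) (hW t ht)
    rw [map_add, ← ContinuousLinearMap.intervalIntegral_comp_comm] at h1
    · simpa only [hKW, ContinuousLinearMap.coe_fst'] using h1
    · simp only [hKW]
      exact (hint t).intervalIntegrable _ _
  have hv : ∀ t, 0 ≤ t → v t = v₀ + ∫ s in (0 : ℝ)..t, (M (v s) + P (u s)) := by
    intro t ht
    have h1 := congrArg (ContinuousLinearMap.snd ℝ D Y) (hW t ht)
    rw [map_add, ← ContinuousLinearMap.intervalIntegral_comp_comm] at h1
    · simpa only [hKW, ContinuousLinearMap.coe_snd'] using h1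
    · simp only [hKW]
      exact (hint t).intervalIntegrable _ _
  refine ⟨u, v, huc.continuousOn, hvc.continuousOn, ?_, fun t ht => ?_, hv⟩
  · have h1 := hz 0 le_rfl
    have h2 := hv 0 le_rfl
    rw [intervalIntegral.integral_same, add_zero] at h1 h2
    simp only [hu]
    rw [h1, h2, hFi]
    abel
  · have h1 := apply_mild_solution hFc hFL hFS hkc hz ht
    -- Returning from `z` to `u = z + Q v` adds `S Q v`, whose evolution is read off from the
    -- equation for `v`.
    have e1 : S (Q (v t)) = S (Q v₀) + ∫ s in (0 : ℝ)..t, S (Q (M (v s) + P (u s))) := by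
      conv_lhs => rw [hv t ht, map_add, map_add]
      have := (S.comp Q).intervalIntegral_comp_comm (μ := volume) (a := 0) (b := t)
        ((by fun_prop : Continuous fun s => M (v s) + P (u s)).intervalIntegrable _ _)
      rw [ContinuousLinearMap.comp_apply] at this
      rw [← this]
      rfl
    have e2 : ∫ s in (0 : ℝ)..t, (S (u s) - u s - (0 : D →L[ℝ] D) (u s) + Q (v s)) =
        -(∫ s in (0 : ℝ)..t, z s) + (∫ s in (0 : ℝ)..t, S (k s)) +
          ∫ s in (0 : ℝ)..t, S (Q (M (v s) + P (u s))) := by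
      rw [← intervalIntegral.integral_neg, ← intervalIntegral.integral_add,
        ← intervalIntegral.integral_add]
      · refine intervalIntegral.integral_congr fun s _ => ?_
        simp only [hk, map_sub, zero_apply, sub_zero]
        simp only [hu]
        abel
      all_goals exact Continuous.intervalIntegrable (by fun_prop) _ _
    rw [e2]
    simp only [hu] at e1 ⊢
    rw [map_add, h1, e1, map_sub]
    abel

/-- Existence for the abstract evolution problem; the nonnegative symmetric operator `N = τ†τ` is
absorbed into the inner product by passing to the graph of `τ`. -/
theorem exists_isEvolution {Z : Type*} [NormedAddCommGroup Z] [InnerProductSpace ℝ Z]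
    [CompleteSpace Z] {S : D →L[ℝ] D}
    (hsymm : ∀ x y, inner ℝ (S x) y = inner ℝ x (S y)) (hpos : ∀ x, 0 ≤ inner ℝ (S x) x)
    (hinj : ∀ x, S x = 0 → x = 0) (N : D →L[ℝ] D) (τ : D →L[ℝ] Z)
    (hN : ∀ x y, inner ℝ (N x) y = inner ℝ (τ x) (τ y)) (Q : Y →L[ℝ] D) (M : Y →L[ℝ] Y)
    (P : D →L[ℝ] Y) (u₀ : D) (v₀ : Y) :
    ∃ u v, IsEvolution S N Q M P u₀ v₀ u v := by
  let fs : WithLp 2 (D × Z) →L[ℝ] D := WithLp.fstL 2 ℝ D Z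
  let sn : WithLp 2 (D × Z) →L[ℝ] Z := WithLp.sndL 2 ℝ D Z
  let g : D →L[ℝ] WithLp 2 (D × Z) :=
    ((WithLp.prodContinuousLinearEquiv 2 ℝ D Z).symm : D × Z →L[ℝ] WithLp 2 (D × Z)).comp
      ((ContinuousLinearMap.id ℝ D).prod τ)
  -- On the graph of `τ` the inner product is `⟪x, y⟫ + ⟪τ x, τ y⟫ = ⟪(1 + N) x, y⟫`, so the
  -- identity of `𝒢` plays the role of `1 + N`.
  let 𝒢 : Submodule ℝ (WithLp 2 (D × Z)) := LinearMap.ker (sn - τ.comp fs : _ →ₗ[ℝ] Z)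
  have h𝒢 : ∀ p, p ∈ 𝒢 ↔ p.snd = τ p.fst := fun p => by
    rw [LinearMap.mem_ker]
    exact sub_eq_zero
  have hclosed : IsClosed (𝒢 : Set (WithLp 2 (D × Z))) := (sn - τ.comp fs).isClosed_ker
  have : CompleteSpace 𝒢 := hclosed.completeSpace_coe
  let e : D →L[ℝ] 𝒢 := g.codRestrict 𝒢 fun x => (h𝒢 _).2 rfl
  let π : 𝒢 →L[ℝ] D := fs.comp 𝒢.subtypeL
  have hπe : ∀ x, π (e x) = x := fun x => rfl
  have heπ : ∀ p, e (π p) = p := fun p => by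
    refine Subtype.ext (WithLp.ofLp_injective 2 (Prod.ext rfl ?_))
    exact ((h𝒢 _).1 p.2).symm
  let πa := ContinuousLinearMap.adjoint π
  let ea := ContinuousLinearMap.adjoint e
  -- The adjoint of `e` translates the equation on `𝒢` back to `D`: it undoes the adjoint of `π`,
  -- while `e† e = 1 + N` restores the absorbed operator.
  have heπa : ∀ x, ea (πa x) = x := fun x => by
    refine ext_inner_right ℝ fun y => ?_
    rw [ContinuousLinearMap.adjoint_inner_left, ContinuousLinearMap.adjoint_inner_left, hπe]
  have hee : ∀ x, ea (e x) = x + N x := fun x => by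
    refine ext_inner_right ℝ fun y => ?_
    rw [ContinuousLinearMap.adjoint_inner_left, inner_add_left, hN]
    exact WithLp.prod_inner_apply _ _
  obtain ⟨U, v, hUv⟩ := exists_isEvolution_zero (S := πa.comp (S.comp π))
    (fun x y => by
      simp only [ContinuousLinearMap.comp_apply, πa, ContinuousLinearMap.adjoint_inner_left,
        ContinuousLinearMap.adjoint_inner_right, hsymm])
    (fun x => by
      simp only [ContinuousLinearMap.comp_apply, πa, ContinuousLinearMap.adjoint_inner_left]
      exact hpos _)
    (fun x hx => by
      have h1 := congrArg ea hx
      rw [ContinuousLinearMap.comp_apply, heπa, map_zero] at h1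
      exact (heπ x).symm.trans ((congrArg e (hinj _ h1)).trans (map_zero e)))
    (πa.comp Q) M (P.comp π) (e u₀) v₀
  refine ⟨fun t => π (U t), v, π.continuous.comp_continuousOn hUv.continuousOn_u,
    hUv.continuousOn_v, ?_, fun t ht => ?_, hUv.eq_v⟩
  · rw [hUv.initial_u, hπe]
  · have h1 := congrArg ea (hUv.eq_u t ht)
    rw [map_add, ← ContinuousLinearMap.intervalIntegral_comp_comm] at h1
    · simp only [ContinuousLinearMap.comp_apply, heπa, hπe] at h1
      rw [h1]
      congr 1
      refine intervalIntegral.integral_congr fun s _ => ?_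
      simp only [map_add, map_sub, heπa, zero_apply, sub_zero]
      nth_rewrite 2 [← heπ (U s)]
      rw [hee]
      abel
    · refine ContinuousOn.intervalIntegrable ?_
      rw [uIcc_of_le ht]
      have hU := hUv.continuousOn_u.mono (fun s hs => hs.1 : Icc 0 t ⊆ Ici 0)
      have hv := hUv.continuousOn_v.mono (fun s hs => hs.1 : Icc 0 t ⊆ Ici 0)
      fun_prop

end Evolution

/-! ### Energy estimate and continuous dependence on the coefficients -/

section Stability

/-- The integrand is continuous only on `[0, ∞)`; precomposition with `max · 0` makes it continuous
on `ℝ` without changing the integrals for `t ≥ 0`. -/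
theorem hasDerivWithinAt_of_eq_integral {X : Type*} [NormedAddCommGroup X] [NormedSpace ℝ X]
    [CompleteSpace X] {a F : ℝ → X} {c : X} (hF : ContinuousOn F (Ici 0))
    (h : ∀ t, 0 ≤ t → a t = c + ∫ s in (0 : ℝ)..t, F s) {t : ℝ} (ht : 0 ≤ t) :
    HasDerivWithinAt a (F t) (Ici 0) t := by
  have hc : Continuous fun s => F (max s 0) :=
    hF.comp_continuous (by fun_prop) fun s => mem_Ici.2 (le_max_right _ _)
  have hd : HasDerivAt (fun t => c + ∫ s in (0 : ℝ)..t, F (max s 0)) (F (max t 0)) t :=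
    (intervalIntegral.integral_hasDerivAt_right (hc.intervalIntegrable _ _)
      hc.stronglyMeasurable.stronglyMeasurableAtFilter hc.continuousAt).const_add c
  rw [max_eq_left ht] at hd
  have hEq : ∀ s ∈ Ici (0 : ℝ), a s = c + ∫ r in (0 : ℝ)..s, F (max r 0) := fun s hs => by
    rw [h s hs]
    congr 1
    refine intervalIntegral.integral_congr fun r hr => ?_
    rw [uIcc_of_le hs] at hr
    simp only [max_eq_left hr.1]
  exact hd.hasDerivWithinAt.congr hEq (hEq t ht)

/-- The energy identity for a symmetric operator `S`. -/
theorem hasDerivWithinAt_inner_self {D : Type*} [NormedAddCommGroup D] [InnerProductSpace ℝ D]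
    {S : D →L[ℝ] D} (hsymm : ∀ x y, inner ℝ (S x) y = inner ℝ x (S y)) {w : ℝ → D}
    {s : Set ℝ} {t : ℝ} {F : D} (hw : ContinuousWithinAt w s t)
    (h : HasDerivWithinAt (fun r => S (w r)) F s t) :
    HasDerivWithinAt (fun r => inner ℝ (S (w r)) (w r)) (2 * inner ℝ F (w t)) s t := by
  -- By symmetry the increment of `⟪S w, w⟫` is `⟪S w(r) - S w(t), w(r) + w(t)⟫`. Hence only `S w`
  -- has to be differentiable, while continuity of `w` suffices.
  rw [hasDerivWithinAt_iff_tendsto_slope] at h ⊢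
  have hw' : Tendsto (fun r => w r + w t) (𝓝[s \ {t}] t) (𝓝 (w t + w t)) :=
    ((hw.mono sdiff_subset).tendsto).add tendsto_const_nhds
  have h1 := Filter.Tendsto.inner (𝕜 := ℝ) h hw'
  rw [inner_add_right, ← two_mul] at h1
  refine h1.congr fun r => ?_
  rw [slope_def_module, slope_def_module, real_inner_smul_left, smul_eq_mul, inner_sub_left,
    inner_add_right, inner_add_right, hsymm (w t) (w r), real_inner_comm (S (w r)) (w t)]
  ring

variable {D Y : Type*} [NormedAddCommGroup D] [InnerProductSpace ℝ D] [CompleteSpace D]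
  [NormedAddCommGroup Y] [InnerProductSpace ℝ Y] [CompleteSpace Y]

/-- Continuous dependence of the solution of the evolution problem on the coefficients. -/
theorem IsEvolution.sq_norm_sub_le {S : D →L[ℝ] D}
    (hsymm : ∀ x y, inner ℝ (S x) y = inner ℝ x (S y)) (hpos : ∀ x, 0 ≤ inner ℝ (S x) x)
    {N₁ N₂ : D →L[ℝ] D} {Q₁ Q₂ : Y →L[ℝ] D} {M₁ M₂ : Y →L[ℝ] Y} {P₁ P₂ : D →L[ℝ] Y} {u₀ : D}
    {v₀ : Y} {u₁ u₂ : ℝ → D} {v₁ v₂ : ℝ → Y} (h₁ : IsEvolution S N₁ Q₁ M₁ P₁ u₀ v₀ u₁ v₁)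
    (h₂ : IsEvolution S N₂ Q₂ M₂ P₂ u₀ v₀ u₂ v₂) (hN : ∀ x, 0 ≤ inner ℝ (N₁ x) x) {α ρ T : ℝ}
    (hα : 0 ≤ α) (hQ : ‖Q₁‖ ≤ α) (hM : ‖M₁‖ ≤ α) (hP : ‖P₁‖ ≤ α)
    (hu : ∀ t ∈ Icc 0 T, ‖(Q₁ - Q₂) (v₂ t) - (N₁ - N₂) (u₂ t)‖ ≤ ρ)
    (hv : ∀ t ∈ Icc 0 T, ‖(M₁ - M₂) (v₂ t) + (P₁ - P₂) (u₂ t)‖ ≤ ρ) {t : ℝ} (ht : t ∈ Icc 0 T) :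
    inner ℝ (S (u₁ t - u₂ t)) (u₁ t - u₂ t) + ‖v₁ t - v₂ t‖ ^ 2 ≤
      ρ ^ 2 * Real.exp ((4 * α ^ 2 + 2 * α + 2) * T) := by
  have hu1 := h₁.continuousOn_u
  have hu2 := h₂.continuousOn_u
  have hv1 := h₁.continuousOn_v
  have hv2 := h₂.continuousOn_v
  set w : ℝ → D := fun t => u₁ t - u₂ t with hw
  set z : ℝ → Y := fun t => v₁ t - v₂ t with hz
  have hwc : ContinuousOn w (Ici 0) := hu1.sub hu2
  have hzc : ContinuousOn z (Ici 0) := hv1.sub hv2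
  -- The difference solves the first system, with a residual in which the differences of the
  -- coefficients act on the second solution alone.
  set F : ℝ → D := fun t => S (w t) - w t - N₁ (w t) + Q₁ (z t) +
    ((Q₁ - Q₂) (v₂ t) - (N₁ - N₂) (u₂ t)) with hF
  set H : ℝ → Y := fun t => M₁ (z t) + P₁ (w t) + ((M₁ - M₂) (v₂ t) + (P₁ - P₂) (u₂ t)) with hH
  have hdw : ∀ t, 0 ≤ t → HasDerivWithinAt (fun r => S (w r)) (F t) (Ici 0) t := fun t ht => by
    have d1 := hasDerivWithinAt_of_eq_integral (a := fun t => S (u₁ t)) (by fun_prop) h₁.eq_u ht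
    have d2 := hasDerivWithinAt_of_eq_integral (a := fun t => S (u₂ t)) (by fun_prop) h₂.eq_u ht
    have d3 := d1.sub d2
    simp only [hw, map_sub]
    refine d3.congr_deriv ?_
    simp only [hF, hw, hz, map_sub, sub_apply]
    abel
  have hdz : ∀ t, 0 ≤ t → HasDerivWithinAt z (H t) (Ici 0) t := fun t ht => by
    have d1 := hasDerivWithinAt_of_eq_integral (a := v₁) (by fun_prop) h₁.eq_v ht
    have d2 := hasDerivWithinAt_of_eq_integral (a := v₂) (by fun_prop) h₂.eq_v ht
    refine (d1.sub d2).congr_deriv ?_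
    simp only [hH, hw, hz, map_sub, sub_apply]
    abel
  set q : ℝ → ℝ := fun t => inner ℝ (S (w t)) (w t) + ‖z t‖ ^ 2 with hq
  have hqc : ContinuousOn q (Ici 0) := by simp only [hq]; fun_prop
  have hdq : ∀ t, 0 ≤ t → HasDerivWithinAt q
      (2 * inner ℝ (F t) (w t) + 2 * inner ℝ (z t) (H t)) (Ici 0) t := fun t ht =>
    (hasDerivWithinAt_inner_self hsymm (hwc t ht) (hdw t ht)).add (hdz t ht).norm_sq
  -- The couplings contribute `4 α ‖z‖ ‖w‖ ≤ ‖w‖² + 4 α² ‖z‖²`, the residuals `2 ρ ‖w‖ ≤ ‖w‖² + ρ²`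
  -- and `2 ρ ‖z‖ ≤ ‖z‖² + ρ²`, and `M₁` contributes `2 α ‖z‖²`. The two terms `‖w‖²` are paid by
  -- `-2 ‖w‖²`; `C` covers the rest and is at least `2`, so that the factor `2 ρ² / C` from Gronwall
  -- is at most `ρ²`.
  set C := 4 * α ^ 2 + 2 * α + 2 with hC
  have hC2 : 2 ≤ C := by nlinarith [sq_nonneg α]
  have hbound : ∀ t ∈ Ico 0 T, 2 * inner ℝ (F t) (w t) + 2 * inner ℝ (z t) (H t) ≤
      C * q t + 2 * ρ ^ 2 := by
    intro t ht
    have ht' : t ∈ Icc 0 T := ⟨ht.1, ht.2.le⟩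
    have a1 : inner ℝ (Q₁ (z t)) (w t) ≤ α * ‖z t‖ * ‖w t‖ :=
      (real_inner_le_norm _ _).trans (by gcongr; exact (Q₁.le_opNorm _).trans (by gcongr))
    have a2 : inner ℝ ((Q₁ - Q₂) (v₂ t) - (N₁ - N₂) (u₂ t)) (w t) ≤ ρ * ‖w t‖ :=
      (real_inner_le_norm _ _).trans (by gcongr; exact hu t ht')
    have a3 : inner ℝ (z t) (M₁ (z t)) ≤ ‖z t‖ * (α * ‖z t‖) :=
      (real_inner_le_norm _ _).trans (by gcongr; exact (M₁.le_opNorm _).trans (by gcongr))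
    have a4 : inner ℝ (z t) (P₁ (w t)) ≤ ‖z t‖ * (α * ‖w t‖) :=
      (real_inner_le_norm _ _).trans (by gcongr; exact (P₁.le_opNorm _).trans (by gcongr))
    have a5 : inner ℝ (z t) ((M₁ - M₂) (v₂ t) + (P₁ - P₂) (u₂ t)) ≤ ‖z t‖ * ρ :=
      (real_inner_le_norm _ _).trans (by gcongr; exact hv t ht')
    have a6 := hN (w t)
    have a7 := hpos (w t)
    simp only [hF, hH, hq, inner_add_left (𝕜 := ℝ), inner_add_right (𝕜 := ℝ),
      inner_sub_left (𝕜 := ℝ), real_inner_self_eq_norm_sq] at a2 a5 ⊢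
    nlinarith [sq_nonneg (‖w t‖ - 2 * α * ‖z t‖), sq_nonneg (‖w t‖ - ρ), sq_nonneg (‖z t‖ - ρ),
      mul_nonneg (by positivity : 0 ≤ 4 * α ^ 2 + 2 * α) a7, sq_nonneg (‖z t‖)]
  have hg := le_gronwallBound_of_liminf_deriv_right_le (f := q) (δ := 0) (K := C) (ε := 2 * ρ ^ 2)
    (a := 0) (b := T) (hqc.mono fun s hs => hs.1)
    (fun t ht r hr => ((hdq t ht.1).mono (Ici_subset_Ici.2 ht.1)).liminf_right_slope_le hr)
    (by
      simp only [hq, hw, hz]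
      rw [h₁.initial_u, h₂.initial_u, h₁.eq_v 0 le_rfl, h₂.eq_v 0 le_rfl]
      simp)
    hbound t ht
  refine hg.trans ?_
  rw [gronwallBound_of_K_ne_0 (by linarith), sub_zero]
  simp only [zero_mul, zero_add]
  have hT : 0 ≤ T := ht.1.trans ht.2
  have e1 : Real.exp (C * t) ≤ Real.exp (C * T) := Real.exp_le_exp.2 (by nlinarith [ht.2])
  have e2 : 1 ≤ Real.exp (C * t) := Real.one_le_exp (by nlinarith [ht.1])
  calc 2 * ρ ^ 2 / C * (Real.exp (C * t) - 1) ≤ ρ ^ 2 * Real.exp (C * T) := by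
        refine mul_le_mul ?_ (by linarith) (by linarith) (sq_nonneg _)
        rw [div_le_iff₀ (by linarith)]
        nlinarith [sq_nonneg ρ]

end Stability

/-! ### Integral and multiplication operators with bounded kernels -/

section KernelOperators
variable {Y Z : Type*} [MeasurableSpace Y] [MeasurableSpace Z] {ρ : Measure Y} {ν : Measure Z}
  [IsFiniteMeasure ρ] [IsFiniteMeasure ν]

omit [IsFiniteMeasure ρ] in
theorem ae_mul_le_imp_norm_le {m : Y → ℝ} {C : ℝ} (hC : ∀ᵐ y ∂ρ, |m y| ≤ C) (f : Y → ℝ) :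
    ∀ᵐ y ∂ρ, ‖m y * f y‖ ≤ C * ‖f y‖ := by
  filter_upwards [hC] with y hy
  rw [norm_mul, Real.norm_eq_abs]
  gcongr

omit [IsFiniteMeasure ρ] in
theorem memLp_bounded_mul {m : Y → ℝ} (hm : AEStronglyMeasurable m ρ) {C : ℝ}
    (hC : ∀ᵐ y ∂ρ, |m y| ≤ C) (f : Lp ℝ 2 ρ) : MemLp (fun y => m y * f y) 2 ρ :=
  MemLp.of_le_mul (Lp.memLp f) (hm.mul (Lp.aestronglyMeasurable f)) (ae_mul_le_imp_norm_le hC f)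

/-- Multiplication by a bounded function on `L²`. -/
def mulL (m : Y → ℝ) (hm : AEStronglyMeasurable m ρ) (C : ℝ) (hC : ∀ᵐ y ∂ρ, |m y| ≤ C) :
    Lp ℝ 2 ρ →L[ℝ] Lp ℝ 2 ρ :=
  have hmem := memLp_bounded_mul hm hC
  LinearMap.mkContinuous
    { toFun := fun f => (hmem f).toLp _
      map_add' := fun f g => by
        refine Lp.ext ?_
        filter_upwards [(hmem (f + g)).coeFn_toLp, (hmem f).coeFn_toLp, (hmem g).coeFn_toLp,
          Lp.coeFn_add f g, Lp.coeFn_add ((hmem f).toLp _) ((hmem g).toLp _)] with y h1 h2 h3 h4 h5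
        rw [h1, h5, Pi.add_apply, h2, h3, h4, Pi.add_apply, mul_add]
      map_smul' := fun a f => by
        refine Lp.ext ?_
        filter_upwards [(hmem (a • f)).coeFn_toLp, (hmem f).coeFn_toLp, Lp.coeFn_smul a f,
          Lp.coeFn_smul a ((hmem f).toLp _)] with y h1 h2 h3 h4
        rw [h1, RingHom.id_apply, h4, Pi.smul_apply, h2, h3, Pi.smul_apply, smul_eq_mul,
          smul_eq_mul, mul_left_comm] }
    C (fun f => by
      refine Lp.norm_le_mul_norm_of_ae_le_mul ?_
      filter_upwards [(hmem f).coeFn_toLp, ae_mul_le_imp_norm_le hC f] with y h1 h2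
      exact (congrArg norm h1).trans_le h2)

omit [IsFiniteMeasure ρ] in
theorem coeFn_mulL {m : Y → ℝ} (hm : AEStronglyMeasurable m ρ) {C : ℝ} (hC : ∀ᵐ y ∂ρ, |m y| ≤ C)
    (f : Lp ℝ 2 ρ) : mulL m hm C hC f =ᵐ[ρ] fun y => m y * f y :=
  (memLp_bounded_mul hm hC f).coeFn_toLp

omit [IsFiniteMeasure ρ] in
theorem norm_mulL_apply_le {m : Y → ℝ} (hm : AEStronglyMeasurable m ρ) {C : ℝ}
    (hC : ∀ᵐ y ∂ρ, |m y| ≤ C) (f : Lp ℝ 2 ρ) : ‖mulL m hm C hC f‖ ≤ C * ‖f‖ := by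
  refine Lp.norm_le_mul_norm_of_ae_le_mul ?_
  filter_upwards [coeFn_mulL hm hC f, ae_mul_le_imp_norm_le hC f] with y h1 h2
  exact (congrArg norm h1).trans_le h2

omit [IsFiniteMeasure ρ] in
theorem inner_L2_eq_integral_mul (f g : Lp ℝ 2 ρ) : inner ℝ f g = ∫ y, f y * g y ∂ρ := by
  rw [L2.inner_def]
  refine integral_congr_ae (ae_of_all _ fun y => ?_)
  simp [mul_comm]

omit [IsFiniteMeasure ρ] in
-- `R` is multiplication by `√m`. The factorization is the form in which the existence theorem
-- accepts the boundary operator `N`.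
theorem exists_sqrt_mulL {m : Y → ℝ} (hm : AEStronglyMeasurable m ρ) {C : ℝ}
    (hC : ∀ᵐ y ∂ρ, |m y| ≤ C) (hpos : ∀ᵐ y ∂ρ, 0 ≤ m y) :
    ∃ R : Lp ℝ 2 ρ →L[ℝ] Lp ℝ 2 ρ, ∀ f g, inner ℝ (mulL m hm C hC f) g = inner ℝ (R f) (R g) := by
  have hs : AEStronglyMeasurable (fun y => √(m y)) ρ :=
    Real.continuous_sqrt.comp_aestronglyMeasurable hm
  have hsC : ∀ᵐ y ∂ρ, |√(m y)| ≤ √C := by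
    filter_upwards [hC] with y hy
    rw [abs_of_nonneg (Real.sqrt_nonneg _)]
    exact Real.sqrt_le_sqrt ((le_abs_self _).trans hy)
  refine ⟨mulL _ hs _ hsC, fun f g => ?_⟩
  rw [inner_L2_eq_integral_mul, inner_L2_eq_integral_mul]
  refine integral_congr_ae ?_
  filter_upwards [coeFn_mulL hm hC f, coeFn_mulL hs hsC f, coeFn_mulL hs hsC g, hpos]
    with y h1 h2 h3 h4
  rw [h1, h2, h3]
  nth_rewrite 1 [← Real.mul_self_sqrt h4]
  ring

/-- Integral kernels that are bounded by `C` almost everywhere. -/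
structure IsBddKernel (ρ : Measure Y) (ν : Measure Z) (k : Y → Z → ℝ) (C : ℝ) : Prop where
  aestronglyMeasurable : AEStronglyMeasurable (Function.uncurry k) (ρ.prod ν)
  nonneg : 0 ≤ C
  bound : ∀ᵐ y ∂ρ, ∀ᵐ z ∂ν, |k y z| ≤ C

/-- The square root of the total mass. -/
def sqrtMass (ν : Measure Z) : ℝ := (measureUnivNNReal ν : ℝ) ^ ((2 : ℝ≥0∞).toReal)⁻¹

omit [IsFiniteMeasure ν] in
theorem sqrtMass_nonneg : 0 ≤ sqrtMass ν := by unfold sqrtMass; positivity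

theorem integrable_of_L2 (f : Lp ℝ 2 ν) : Integrable f ν :=
  (Lp.memLp f).integrable (by norm_num)

/-- Cauchy–Schwarz against the constant `1` on a finite measure space. -/
theorem integral_norm_le_sqrtMass (f : Lp ℝ 2 ν) : ∫ z, ‖f z‖ ∂ν ≤ sqrtMass ν * ‖f‖ := by
  have h1 := eLpNorm_le_eLpNorm_mul_rpow_measure_univ (p := 1) (q := 2) (by norm_num)
    (Lp.aestronglyMeasurable f)
  rw [integral_norm_eq_lintegral_enorm (Lp.aestronglyMeasurable f), Lp.norm_def, sqrtMass,
    mul_comm, ← eLpNorm_one_eq_lintegral_enorm]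
  refine (ENNReal.toReal_mono (ENNReal.mul_ne_top (Lp.eLpNorm_ne_top f) ?_) h1).trans_eq ?_
  · exact ENNReal.rpow_ne_top_of_nonneg (by norm_num) (measure_ne_top ν _)
  · rw [ENNReal.toReal_mul, ← ENNReal.toReal_rpow, measureUnivNNReal]
    congr 2
    norm_num

namespace IsBddKernel
variable {k k' : Y → Z → ℝ} {C C' : ℝ}

omit [IsFiniteMeasure ρ] in
theorem ae_integrable_mul (h : IsBddKernel ρ ν k C) (f : Lp ℝ 2 ν) :
    ∀ᵐ y ∂ρ, Integrable (fun z => k y z * f z) ν := by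
  filter_upwards [h.bound, h.aestronglyMeasurable.prodMk_left] with y hy hm
  exact (integrable_of_L2 f).bdd_mul hm hy

omit [IsFiniteMeasure ρ] in
theorem ae_integrable (h : IsBddKernel ρ ν k C) :
    ∀ᵐ y ∂ρ, Integrable (fun z => k y z) ν := by
  filter_upwards [h.bound, h.aestronglyMeasurable.prodMk_left] with y hy hm
  exact Integrable.of_bound hm C hy

omit [IsFiniteMeasure ρ] in
theorem ae_norm_integral_mul_le (h : IsBddKernel ρ ν k C) (f : Lp ℝ 2 ν) :
    ∀ᵐ y ∂ρ, ‖∫ z, k y z * f z ∂ν‖ ≤ C * (sqrtMass ν * ‖f‖) := by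
  filter_upwards [h.bound] with y hy
  have h1 : ‖∫ z, k y z * f z ∂ν‖ ≤ ∫ z, C * ‖f z‖ ∂ν := by
    refine norm_integral_le_of_norm_le ((integrable_of_L2 f).norm.const_mul C) ?_
    filter_upwards [hy] with z hz
    rw [norm_mul, Real.norm_eq_abs]
    gcongr
  rw [integral_const_mul] at h1
  exact h1.trans (mul_le_mul_of_nonneg_left (integral_norm_le_sqrtMass f) h.nonneg)

omit [IsFiniteMeasure ρ] in
theorem aestronglyMeasurable_integral_mul (h : IsBddKernel ρ ν k C) (f : Lp ℝ 2 ν) :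
    AEStronglyMeasurable (fun y => ∫ z, k y z * f z ∂ν) ρ :=
  AEStronglyMeasurable.integral_prod_right' (f := fun p : Y × Z => k p.1 p.2 * f p.2)
    (h.aestronglyMeasurable.mul (Lp.aestronglyMeasurable f).comp_snd)

theorem memLp_integral_mul (h : IsBddKernel ρ ν k C) (f : Lp ℝ 2 ν) :
    MemLp (fun y => ∫ z, k y z * f z ∂ν) 2 ρ :=
  MemLp.of_bound (h.aestronglyMeasurable_integral_mul f) _ (h.ae_norm_integral_mul_le f)

/-- The integral operator with a bounded kernel. -/
def intOp (h : IsBddKernel ρ ν k C) : Lp ℝ 2 ν →L[ℝ] Lp ℝ 2 ρ :=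
  LinearMap.mkContinuous
    { toFun := fun f => (h.memLp_integral_mul f).toLp _
      map_add' := fun f g => by
        refine Lp.ext ?_
        filter_upwards [(h.memLp_integral_mul (f + g)).coeFn_toLp,
          (h.memLp_integral_mul f).coeFn_toLp, (h.memLp_integral_mul g).coeFn_toLp,
          Lp.coeFn_add ((h.memLp_integral_mul f).toLp _) ((h.memLp_integral_mul g).toLp _),
          h.ae_integrable_mul f, h.ae_integrable_mul g] with y h1 h2 h3 h4 h5 h6
        rw [h1, h4, Pi.add_apply, h2, h3, ← integral_add h5 h6]
        refine integral_congr_ae ?_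
        filter_upwards [Lp.coeFn_add f g] with z hz
        rw [hz, Pi.add_apply, mul_add]
      map_smul' := fun a f => by
        refine Lp.ext ?_
        filter_upwards [(h.memLp_integral_mul (a • f)).coeFn_toLp,
          (h.memLp_integral_mul f).coeFn_toLp,
          Lp.coeFn_smul a ((h.memLp_integral_mul f).toLp _)] with y h1 h2 h3
        rw [h1, RingHom.id_apply, h3, Pi.smul_apply, h2, smul_eq_mul, ← integral_const_mul]
        refine integral_congr_ae ?_
        filter_upwards [Lp.coeFn_smul a f] with z hz
        rw [hz, Pi.smul_apply, smul_eq_mul, mul_left_comm] }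
    (sqrtMass ρ * (C * sqrtMass ν)) (fun f => by
      refine (Lp.norm_le_of_ae_bound (C := C * (sqrtMass ν * ‖f‖)) ?_ ?_).trans_eq ?_
      · have := h.nonneg
        have := sqrtMass_nonneg (ν := ν)
        positivity
      · filter_upwards [(h.memLp_integral_mul f).coeFn_toLp, h.ae_norm_integral_mul_le f]
          with y h1 h2
        exact (congrArg norm h1).trans_le h2
      · rw [← sqrtMass]
        ring)

theorem coeFn_intOp (h : IsBddKernel ρ ν k C) (f : Lp ℝ 2 ν) :
    h.intOp f =ᵐ[ρ] fun y => ∫ z, k y z * f z ∂ν :=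
  (h.memLp_integral_mul f).coeFn_toLp

theorem norm_intOp_le (h : IsBddKernel ρ ν k C) :
    ‖h.intOp‖ ≤ sqrtMass ρ * (C * sqrtMass ν) :=
  LinearMap.mkContinuous_norm_le _
    (mul_nonneg sqrtMass_nonneg (mul_nonneg h.nonneg sqrtMass_nonneg)) _

omit [IsFiniteMeasure ρ] in
theorem aestronglyMeasurable_integral (h : IsBddKernel ρ ν k C) :
    AEStronglyMeasurable (fun y => ∫ z, k y z ∂ν) ρ :=
  AEStronglyMeasurable.integral_prod_right' (f := fun p : Y × Z => k p.1 p.2)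
    h.aestronglyMeasurable

omit [IsFiniteMeasure ρ] in
theorem ae_abs_integral_le (h : IsBddKernel ρ ν k C) :
    ∀ᵐ y ∂ρ, |∫ z, k y z ∂ν| ≤ C * ν.real univ := by
  filter_upwards [h.bound] with y hy
  exact norm_integral_le_of_norm_le_const (f := fun z => k y z) hy

/-- Multiplication by the mass `∫ k(·, z) dz` of a bounded kernel. -/
def massOp (h : IsBddKernel ρ ν k C) : Lp ℝ 2 ρ →L[ℝ] Lp ℝ 2 ρ :=
  mulL _ h.aestronglyMeasurable_integral _ h.ae_abs_integral_le

omit [IsFiniteMeasure ρ] in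
theorem coeFn_massOp (h : IsBddKernel ρ ν k C) (f : Lp ℝ 2 ρ) :
    h.massOp f =ᵐ[ρ] fun y => (∫ z, k y z ∂ν) * f y :=
  coeFn_mulL _ _ f

omit [IsFiniteMeasure ρ] in
theorem norm_massOp_le (h : IsBddKernel ρ ν k C) : ‖h.massOp‖ ≤ C * ν.real univ :=
  ContinuousLinearMap.opNorm_le_bound _ (mul_nonneg h.nonneg measureReal_nonneg)
    fun f => norm_mulL_apply_le _ _ f

/-- Nonlocal fluxes in terms of integral and multiplication operators. -/
theorem ae_integral_mul_sub (h : IsBddKernel ρ ν k C) (f : Lp ℝ 2 ν) (f' : Lp ℝ 2 ρ) :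
    ∀ᵐ y ∂ρ, ∫ z, k y z * (f z - f' y) ∂ν = (h.intOp f - h.massOp f' : Lp ℝ 2 ρ) y := by
  filter_upwards [h.coeFn_intOp f, h.coeFn_massOp f', Lp.coeFn_sub (h.intOp f) (h.massOp f'),
    h.ae_integrable_mul f, h.ae_integrable] with y h1 h2 h3 h4 h5
  rw [h3, Pi.sub_apply, h1, h2, ← integral_mul_const, ← integral_sub h4 (h5.mul_const _)]
  simp only [mul_sub]

omit [IsFiniteMeasure ρ] [IsFiniteMeasure ν] in
theorem sub {δ : ℝ} (h : IsBddKernel ρ ν k C) (h' : IsBddKernel ρ ν k' C') (hδ : 0 ≤ δ)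
    (hb : ∀ᵐ y ∂ρ, ∀ᵐ z ∂ν, |k y z - k' y z| ≤ δ) :
    IsBddKernel ρ ν (fun y z => k y z - k' y z) δ :=
  ⟨h.aestronglyMeasurable.sub h'.aestronglyMeasurable, hδ, hb⟩

/-- The difference of the operators has the difference of the kernels as its kernel, so uniform
closeness of kernels is closeness in operator norm. -/
theorem norm_intOp_sub_le {δ : ℝ} (h : IsBddKernel ρ ν k C) (h' : IsBddKernel ρ ν k' C')
    (hδ : 0 ≤ δ) (hb : ∀ᵐ y ∂ρ, ∀ᵐ z ∂ν, |k y z - k' y z| ≤ δ) :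
    ‖h.intOp - h'.intOp‖ ≤ sqrtMass ρ * (δ * sqrtMass ν) := by
  have e : h.intOp - h'.intOp = (h.sub h' hδ hb).intOp := by
    refine ContinuousLinearMap.ext fun f => Lp.ext ?_
    filter_upwards [h.coeFn_intOp f, h'.coeFn_intOp f, (h.sub h' hδ hb).coeFn_intOp f,
      Lp.coeFn_sub (h.intOp f) (h'.intOp f), h.ae_integrable_mul f, h'.ae_integrable_mul f]
      with y h1 h2 h3 h4 h5 h6
    rw [sub_apply, h4, Pi.sub_apply, h1, h2, h3, ← integral_sub h5 h6]
    simp only [sub_mul]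
  rw [e]
  exact norm_intOp_le _

omit [IsFiniteMeasure ρ] in
theorem norm_massOp_sub_le {δ : ℝ} (h : IsBddKernel ρ ν k C) (h' : IsBddKernel ρ ν k' C')
    (hδ : 0 ≤ δ) (hb : ∀ᵐ y ∂ρ, ∀ᵐ z ∂ν, |k y z - k' y z| ≤ δ) :
    ‖h.massOp - h'.massOp‖ ≤ δ * ν.real univ := by
  have e : h.massOp - h'.massOp = (h.sub h' hδ hb).massOp := by
    refine ContinuousLinearMap.ext fun f => Lp.ext ?_
    filter_upwards [h.coeFn_massOp f, h'.coeFn_massOp f, (h.sub h' hδ hb).coeFn_massOp f,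
      Lp.coeFn_sub (h.massOp f) (h'.massOp f), h.ae_integrable, h'.ae_integrable]
      with y h1 h2 h3 h4 h5 h6
    rw [sub_apply, h4, Pi.sub_apply, h1, h2, h3, integral_sub h5 h6, sub_mul]
  rw [e]
  exact norm_massOp_le _

omit [IsFiniteMeasure ρ] in
theorem exists_sqrt_massOp (h : IsBddKernel ρ ν k C) (hk : ∀ y z, 0 ≤ k y z) :
    ∃ R : Lp ℝ 2 ρ →L[ℝ] Lp ℝ 2 ρ, ∀ f g, inner ℝ (h.massOp f) g = inner ℝ (R f) (R g) :=
  exists_sqrt_mulL _ _ (ae_of_all _ fun y => integral_nonneg (hk y))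

end IsBddKernel
end KernelOperators

/-! ### Equivalence of the weak formulation and the evolution problem -/

theorem integral_by_parts_inner {X : Type*} [NormedAddCommGroup X] [InnerProductSpace ℝ X]
    [CompleteSpace X] {a F b : ℝ → X} {c : X} (ha : ContinuousOn a (Ici 0))
    (hF : ContinuousOn F (Ici 0)) (h : ∀ t, 0 ≤ t → a t = c + ∫ s in (0 : ℝ)..t, F s)
    (hb : ContDiff ℝ 1 b) {T : ℝ} (hT : 0 ≤ T) :
    inner ℝ (a T) (b T) - ∫ t in (0 : ℝ)..T, inner ℝ (a t) (deriv b t) =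
      inner ℝ c (b 0) + ∫ t in (0 : ℝ)..T, inner ℝ (F t) (b t) := by
  have hbc := hb.continuous
  have hb' : Continuous (deriv b) := hb.continuous_deriv (by simp)
  have hsub : Icc 0 T ⊆ Ici (0 : ℝ) := fun s hs => hs.1
  have i1 : IntervalIntegrable (fun t => inner ℝ (a t) (deriv b t)) volume 0 T := by
    refine ContinuousOn.intervalIntegrable ?_
    rw [uIcc_of_le hT]
    exact (ha.mono hsub).inner hb'.continuousOn
  have i2 : IntervalIntegrable (fun t => inner ℝ (F t) (b t)) volume 0 T := by
    refine ContinuousOn.intervalIntegrable ?_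
    rw [uIcc_of_le hT]
    exact (hF.mono hsub).inner hbc.continuousOn
  -- The integrated equation provides the right derivative of `a`, which is all that the fundamental
  -- theorem of calculus needs here.
  have key := intervalIntegral.integral_eq_sub_of_hasDeriv_right_of_le hT
    (f := fun t => inner ℝ (a t) (b t))
    (f' := fun t => inner ℝ (a t) (deriv b t) + inner ℝ (F t) (b t))
    ((ha.mono hsub).inner hbc.continuousOn)
    (fun t ht => (((hasDerivWithinAt_of_eq_integral hF h ht.1.le).inner ℝ
      ((hb.differentiable (by simp) t).hasDerivAt.hasDerivWithinAt)).mono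
        fun s hs => ht.1.le.trans (le_of_lt hs)))
    (i1.add i2)
  rw [intervalIntegral.integral_add i1 i2] at key
  have h0 : a 0 = c := by simpa using h 0 le_rfl
  rw [h0] at key
  linarith

theorem intervalIntegral_inner_right {X : Type*} [NormedAddCommGroup X] [InnerProductSpace ℝ X]
    [CompleteSpace X] {F : ℝ → X} {T : ℝ} (hT : 0 ≤ T) (hF : ContinuousOn F (Ici 0)) (x : X) :
    ∫ t in (0 : ℝ)..T, inner ℝ x (F t) = inner ℝ x (∫ t in (0 : ℝ)..T, F t) := by
  refine (innerSL ℝ x).intervalIntegral_comp_comm (ContinuousOn.intervalIntegrable ?_)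
  rw [uIcc_of_le hT]
  exact hF.mono fun s hs => hs.1

section WeakForm
variable {E : Type*} [NormedAddCommGroup E] [InnerProductSpace ℝ E] [FiniteDimensional ℝ E]
  [MeasurableSpace E] [BorelSpace E] {Ω Γ : Set E}

/-- The Hilbert space of the elements of `H¹(Ω)` that have a trace on `Γ`. -/
def TraceDom (Ω Γ : Set E) : Type _ := traceSpace Ω Γ

instance (Ω Γ : Set E) : NormedAddCommGroup (TraceDom Ω Γ) :=
  (traceSpace Ω Γ).normedAddCommGroup

instance (Ω Γ : Set E) : InnerProductSpace ℝ (TraceDom Ω Γ) :=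
  (traceSpace Ω Γ).innerProductSpace

theorem HasTraceBound.completeSpace_traceDom (h : HasTraceBound Ω Γ) :
    CompleteSpace (TraceDom Ω Γ) :=
  h.isClosed_traceSpace.completeSpace_coe

/-- The inclusion into `H¹(Ω)`. -/
def traceDomIncl (Ω Γ : Set E) : TraceDom Ω Γ →L[ℝ] H1 Ω := (traceSpace Ω Γ).subtypeL

/-- The embedding of the space of functions with a trace into `L²(Ω)`. -/
def traceDomFn (Ω Γ : Set E) : TraceDom Ω Γ →L[ℝ] Lp ℝ 2 (volume.restrict Ω) :=
  (fnL Ω).comp (traceDomIncl Ω Γ)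

/-- The weak gradient on the space of functions with a trace. -/
def traceDomGrad (Ω Γ : Set E) : TraceDom Ω Γ →L[ℝ] Lp E 2 (volume.restrict Ω) :=
  (gradL Ω).comp (traceDomIncl Ω Γ)

/-- The trace operator on its domain. -/
def HasTraceBound.trace (h : HasTraceBound Ω Γ) :
    TraceDom Ω Γ →L[ℝ] Lp ℝ 2 (surfaceMeasure Γ) :=
  h.traceL

theorem HasTraceBound.hasTrace_trace (h : HasTraceBound Ω Γ) (u : TraceDom Ω Γ) :
    HasTrace Ω Γ (traceDomIncl Ω Γ u) (h.trace u) :=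
  h.hasTrace_traceL u

theorem HasTraceBound.eq_trace (h : HasTraceBound Ω Γ) (u : TraceDom Ω Γ)
    {w : Lp ℝ 2 (surfaceMeasure Γ)} (hw : HasTrace Ω Γ (traceDomIncl Ω Γ u) w) :
    w = h.trace u :=
  h.eq_traceL u hw

theorem traceDomIncl_injective (Ω Γ : Set E) : Function.Injective (traceDomIncl Ω Γ) :=
  Subtype.val_injective

theorem inner_traceDom (u w : TraceDom Ω Γ) :
    inner ℝ u w = inner ℝ (traceDomFn Ω Γ u) (traceDomFn Ω Γ w) +
      inner ℝ (traceDomGrad Ω Γ u) (traceDomGrad Ω Γ w) :=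
  inner_H1 (traceDomIncl Ω Γ u) (traceDomIncl Ω Γ w)

variable [CompleteSpace (TraceDom Ω Γ)]

/-- The operator representing the `L²(Ω)` inner product. -/
def massForm (Ω Γ : Set E) [CompleteSpace (TraceDom Ω Γ)] :
    TraceDom Ω Γ →L[ℝ] TraceDom Ω Γ :=
  (ContinuousLinearMap.adjoint (traceDomFn Ω Γ)).comp (traceDomFn Ω Γ)

theorem inner_massForm (u w : TraceDom Ω Γ) :
    inner ℝ (massForm Ω Γ u) w = inner ℝ (traceDomFn Ω Γ u) (traceDomFn Ω Γ w) := by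
  rw [massForm, ContinuousLinearMap.comp_apply, ContinuousLinearMap.adjoint_inner_left]

theorem massForm_symm (u w : TraceDom Ω Γ) :
    inner ℝ (massForm Ω Γ u) w = inner ℝ u (massForm Ω Γ w) := by
  rw [inner_massForm, real_inner_comm, ← inner_massForm, real_inner_comm]

theorem massForm_self (u : TraceDom Ω Γ) :
    inner ℝ (massForm Ω Γ u) u = ‖fnH1 (traceDomIncl Ω Γ u)‖ ^ 2 := by
  rw [inner_massForm, real_inner_self_eq_norm_sq]
  rfl

theorem massForm_nonneg (u : TraceDom Ω Γ) : 0 ≤ inner ℝ (massForm Ω Γ u) u := by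
  rw [massForm_self]
  positivity

theorem massForm_injective (hΩ : IsOpen Ω) (u : TraceDom Ω Γ) (h : massForm Ω Γ u = 0) :
    u = 0 := by
  have h1 := massForm_self u
  rw [h, inner_zero_left] at h1
  have h2 : fnH1 (traceDomIncl Ω Γ u) = 0 := by simpa using h1.symm
  exact traceDomIncl_injective Ω Γ (fnH1_injective hΩ (h2.trans (map_zero (fnL Ω)).symm))

variable [IsFiniteMeasure (surfaceMeasure Γ)] {Y : Type*} [MeasurableSpace Y] {ρ : Measure Y}
  [IsFiniteMeasure ρ] {j : Y → Y → ℝ} {g : E → Y → ℝ} {h : Y → E → ℝ} {Cj Cg Ch : ℝ}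

/-- The zero-order boundary operator. -/
def boundaryN (hT : HasTraceBound Ω Γ) (c : ℝ) (hg : IsBddKernel (surfaceMeasure Γ) ρ g Cg) :
    TraceDom Ω Γ →L[ℝ] TraceDom Ω Γ :=
  c • (ContinuousLinearMap.adjoint hT.trace).comp (hg.massOp.comp hT.trace)

/-- The boundary source operator. -/
def boundaryQ (hT : HasTraceBound Ω Γ) (hg : IsBddKernel (surfaceMeasure Γ) ρ g Cg) :
    Lp ℝ 2 ρ →L[ℝ] TraceDom Ω Γ :=
  (ContinuousLinearMap.adjoint hT.trace).comp hg.intOp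

/-- The nonlocal diffusion operator. -/
def nonlocalM (Γ : Set E) [IsFiniteMeasure (surfaceMeasure Γ)] (c : ℝ)
    (hj : IsBddKernel ρ ρ j Cj) (hh : IsBddKernel ρ (surfaceMeasure Γ) h Ch) :
    Lp ℝ 2 ρ →L[ℝ] Lp ℝ 2 ρ :=
  c • (hj.intOp - hj.massOp) - hh.massOp

/-- The coupling operator from the trace to the nonlocal domain. -/
def couplingP (hT : HasTraceBound Ω Γ) (c : ℝ)
    (hh : IsBddKernel ρ (surfaceMeasure Γ) h Ch) : TraceDom Ω Γ →L[ℝ] Lp ℝ 2 ρ :=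
  c • hh.intOp.comp hT.trace

omit [FiniteDimensional ℝ E] [CompleteSpace (TraceDom Ω Γ)] in
theorem integral_boundary_flux (c : ℝ) (hg : IsBddKernel (surfaceMeasure Γ) ρ g Cg)
    (v : Lp ℝ 2 ρ) (w τ : Lp ℝ 2 (surfaceMeasure Γ)) :
    ∫ x, (∫ y, g x y * (v y - c * w x) ∂ρ) * τ x ∂(surfaceMeasure Γ) =
      inner ℝ (hg.intOp v - c • hg.massOp w) τ := by
  rw [inner_L2_eq_integral_mul, ← map_smul]
  refine integral_congr_ae ?_
  filter_upwards [hg.ae_integral_mul_sub v (c • w), Lp.coeFn_smul c w] with x h1 h2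
  rw [← h1, h2]
  rfl

omit [FiniteDimensional ℝ E] [CompleteSpace (TraceDom Ω Γ)] in
theorem integral_coupling_flux (c : ℝ) (hh : IsBddKernel ρ (surfaceMeasure Γ) h Ch)
    (v : Lp ℝ 2 ρ) (w : Lp ℝ 2 (surfaceMeasure Γ)) (ψ : Lp ℝ 2 ρ) :
    ∫ y, (∫ x, h y x * (v y - c * w x) ∂(surfaceMeasure Γ)) * ψ y ∂ρ =
      inner ℝ (hh.massOp v - c • hh.intOp w) ψ := by
  rw [inner_L2_eq_integral_mul, ← map_smul, ← neg_sub (hh.intOp (c • w))]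
  refine integral_congr_ae ?_
  filter_upwards [hh.ae_integral_mul_sub (c • w) v,
    Lp.coeFn_neg (hh.intOp (c • w) - hh.massOp v)] with y h1 h2
  rw [h2, Pi.neg_apply, ← h1, ← integral_neg]
  congr 1
  refine integral_congr_ae ?_
  filter_upwards [Lp.coeFn_smul c w] with x hx
  rw [hx, Pi.smul_apply, smul_eq_mul]
  ring

theorem integral_nonlocal_flux (c : ℝ) (hj : IsBddKernel ρ ρ j Cj) (v ψ : Lp ℝ 2 ρ) :
    ∫ y, (c * ∫ z, j y z * (v z - v y) ∂ρ) * ψ y ∂ρ =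
      inner ℝ (c • (hj.intOp v - hj.massOp v)) ψ := by
  rw [inner_L2_eq_integral_mul]
  refine integral_congr_ae ?_
  filter_upwards [hj.ae_integral_mul_sub v v, Lp.coeFn_smul c (hj.intOp v - hj.massOp v)]
    with y h1 h2
  rw [h2, Pi.smul_apply, ← h1, smul_eq_mul]

/-- The inner product of `D` is mass form plus gradient form, so `S u - u` represents `-∫ ∇u · ∇φ`.
The adjoint of the trace turns the remaining operators into pairings on `Γ`. -/
theorem inner_evolution_rhs (hT : HasTraceBound Ω Γ) (c : ℝ)
    (hg : IsBddKernel (surfaceMeasure Γ) ρ g Cg) (u φ : TraceDom Ω Γ) (v : Lp ℝ 2 ρ) :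
    inner ℝ (massForm Ω Γ u - u - boundaryN hT c hg u + boundaryQ hT hg v) φ =
      -inner ℝ (traceDomGrad Ω Γ u) (traceDomGrad Ω Γ φ) +
        inner ℝ (hg.intOp v - c • hg.massOp (hT.trace u)) (hT.trace φ) := by
  simp only [boundaryN, boundaryQ, inner_add_left, inner_sub_left, inner_massForm,
    inner_traceDom u φ, smul_apply, ContinuousLinearMap.comp_apply, real_inner_smul_left,
    ContinuousLinearMap.adjoint_inner_left]
  ring

omit [CompleteSpace (TraceDom Ω Γ)] in
theorem nonlocalM_add_couplingP (hT : HasTraceBound Ω Γ) (c : ℝ) (hj : IsBddKernel ρ ρ j Cj)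
    (hh : IsBddKernel ρ (surfaceMeasure Γ) h Ch) (u : TraceDom Ω Γ) (v : Lp ℝ 2 ρ) :
    nonlocalM Γ c hj hh v + couplingP hT c hh u =
      c • (hj.intOp v - hj.massOp v) - (hh.massOp v - c • hh.intOp (hT.trace u)) := by
  simp only [nonlocalM, couplingP, smul_apply, sub_apply, ContinuousLinearMap.comp_apply]
  abel

/-- A weak solution solves the evolution problem. -/
theorem IsWeakSolution.exists_isEvolution (hT : HasTraceBound Ω Γ) {c : ℝ}
    (hj : IsBddKernel ρ ρ j Cj) (hg : IsBddKernel (surfaceMeasure Γ) ρ g Cg)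
    (hh : IsBddKernel ρ (surfaceMeasure Γ) h Ch) {u₀ : H1 Ω} {v₀ : Lp ℝ 2 ρ} {u : ℝ → H1 Ω}
    {v : ℝ → Lp ℝ 2 ρ} (hs : IsWeakSolution Ω Γ ρ c j g h u₀ v₀ u v) :
    ∃ (U₀ : TraceDom Ω Γ) (U : ℝ → TraceDom Ω Γ), traceDomIncl Ω Γ U₀ = u₀ ∧
      (∀ t, 0 ≤ t → traceDomIncl Ω Γ (U t) = u t) ∧
      IsEvolution (massForm Ω Γ) (boundaryN hT c hg) (boundaryQ hT hg) (nonlocalM Γ c hj hh)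
        (couplingP hT c hh) U₀ v₀ U v := by
  obtain ⟨hu, hv, hu0, hv0, tr, htr, hwu, hwv⟩ := hs
  have hmem : ∀ t, 0 ≤ t → u t ∈ traceSpace Ω Γ := fun t ht => ⟨tr t, htr t ht⟩
  -- A trace is known only for `t ≥ 0`, so negative times take the value at `0`.
  set U : ℝ → TraceDom Ω Γ := fun t =>
    ⟨u (max t 0), hmem _ (le_max_right t 0)⟩ with hU
  have hUu : ∀ t, 0 ≤ t → traceDomIncl Ω Γ (U t) = u t := fun t ht => by
    change u (max t 0) = u t
    rw [max_eq_left ht]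
  have htrU : ∀ t, 0 ≤ t → tr t = hT.trace (U t) := fun t ht =>
    hT.eq_trace (U t) (by rw [hUu t ht]; exact htr t ht)
  have hUc : Continuous U := by
    refine Continuous.subtype_mk ?_ _
    exact hu.comp_continuous (by fun_prop) fun s => mem_Ici.2 (le_max_right _ _)
  have hU0 : traceDomIncl Ω Γ (U 0) = u₀ := by rw [hUu 0 le_rfl, hu0]
  have hi : ∀ {X : Type _} [NormedAddCommGroup X] {f : ℝ → X} {T : ℝ}, 0 ≤ T →
      ContinuousOn f (Ici 0) → IntervalIntegrable f volume 0 T := fun hT0 hf => by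
    refine ContinuousOn.intervalIntegrable ?_
    rw [uIcc_of_le hT0]
    exact hf.mono fun s hs => hs.1
  refine ⟨U 0, U, hU0, hUu, hUc.continuousOn, hv, rfl, fun T hT0 => ?_, fun T hT0 => ?_⟩
  · refine ext_inner_right ℝ fun φ => ?_
    -- Test functions constant in time suffice: they give the integrated equation tested against
    -- every `φ` in `D`.
    have h1 := hwu (fun _ => traceDomIncl Ω Γ φ) (fun _ => hT.trace φ) contDiff_const
      (fun _ _ => hT.hasTrace_trace φ) T hT0
    simp only [← inner_L2_eq_integral_mul, deriv_const, ← L2.inner_def,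
      integral_boundary_flux c hg] at h1
    have e0 : fnH1 (0 : H1 Ω) = 0 := map_zero (fnL Ω)
    simp only [e0, inner_zero_right, intervalIntegral.integral_zero, sub_zero] at h1
    have hc : ContinuousOn (fun s => massForm Ω Γ (U s) - U s - boundaryN hT c hg (U s) +
        boundaryQ hT hg (v s)) (Ici 0) := by
      have := hUc.continuousOn (s := Ici 0)
      fun_prop
    rw [inner_add_left, inner_massForm, inner_massForm, real_inner_comm φ,
      ← intervalIntegral_inner_right hT0 hc]
    have e1 : inner ℝ (traceDomFn Ω Γ (U T)) (traceDomFn Ω Γ φ) =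
        inner ℝ (fnH1 (u T)) (fnH1 (traceDomIncl Ω Γ φ)) := by rw [← hUu T hT0]; rfl
    have e2 : inner ℝ (traceDomFn Ω Γ (U 0)) (traceDomFn Ω Γ φ) =
        inner ℝ (fnH1 u₀) (fnH1 (traceDomIncl Ω Γ φ)) := by rw [← hU0]; rfl
    rw [e1, e2, h1, sub_eq_add_neg, add_assoc, ← intervalIntegral.integral_neg,
      ← intervalIntegral.integral_add]
    · congr 1
      refine intervalIntegral.integral_congr fun s hs => ?_
      rw [uIcc_of_le hT0] at hs
      rw [real_inner_comm _ φ, inner_evolution_rhs, htrU s hs.1, ← hUu s hs.1]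
      rfl
    · refine hi hT0 (ContinuousOn.neg (ContinuousOn.inner ?_ continuousOn_const))
      exact (gradL Ω).continuous.comp_continuousOn hu
    · refine hi hT0 (ContinuousOn.inner ?_ continuousOn_const)
      -- The weak formulation asks no regularity in time of the trace; continuity comes from `tr`
      -- being the bounded trace operator applied to `U`.
      have hc2 : ContinuousOn tr (Ici 0) :=
        (hT.trace.continuous.comp hUc).continuousOn.congr fun s hs => htrU s hs
      fun_prop
  · refine ext_inner_right ℝ fun ψ => ?_
    have h1 := hwv (fun _ => ψ) contDiff_const T hT0
    simp only [← inner_L2_eq_integral_mul, deriv_const, integral_coupling_flux c hh,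
      integral_nonlocal_flux c hj, inner_zero_right, intervalIntegral.integral_zero,
      sub_zero] at h1
    have hUc' := hUc.continuousOn (s := Ici 0)
    have hc : ContinuousOn (fun s => nonlocalM Γ c hj hh (v s) + couplingP hT c hh (U s))
        (Ici 0) := by fun_prop
    rw [inner_add_left, real_inner_comm ψ (∫ s in (0 : ℝ)..T, _),
      ← intervalIntegral_inner_right hT0 hc, h1, add_sub_assoc, ← intervalIntegral.integral_sub]
    · congr 1
      refine intervalIntegral.integral_congr fun s hs => ?_
      rw [uIcc_of_le hT0] at hs
      rw [real_inner_comm _ ψ, htrU s hs.1, ← inner_sub_left, nonlocalM_add_couplingP]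
    · refine hi hT0 (ContinuousOn.inner ?_ continuousOn_const)
      fun_prop
    · refine hi hT0 (ContinuousOn.inner ?_ continuousOn_const)
      have hc2 : ContinuousOn tr (Ici 0) :=
        (hT.trace.continuous.comp hUc).continuousOn.congr fun s hs => htrU s hs
      fun_prop

/-- Orthogonal projection onto the closed subspace. It converts a `C¹` test function with values in
`H¹(Ω)` into a `C¹` function with values in `D`, unchanged at the times where a trace exists. -/
theorem exists_traceDom_retraction (Ω Γ : Set E) [CompleteSpace (TraceDom Ω Γ)] :
    ∃ p : H1 Ω →L[ℝ] TraceDom Ω Γ, ∀ u, p (traceDomIncl Ω Γ u) = u := by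
  have : CompleteSpace (traceSpace Ω Γ) := inferInstanceAs (CompleteSpace (TraceDom Ω Γ))
  exact ⟨(traceSpace Ω Γ).orthogonalProjectionOnto,
    fun u => Submodule.orthogonalProjectionOnto_mem_subspace_eq_self _⟩

/-- A solution of the evolution problem is a weak solution. -/
theorem IsEvolution.isWeakSolution (hT : HasTraceBound Ω Γ) {c : ℝ}
    (hj : IsBddKernel ρ ρ j Cj) (hg : IsBddKernel (surfaceMeasure Γ) ρ g Cg)
    (hh : IsBddKernel ρ (surfaceMeasure Γ) h Ch) {U₀ : TraceDom Ω Γ} {v₀ : Lp ℝ 2 ρ}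
    {U : ℝ → TraceDom Ω Γ} {v : ℝ → Lp ℝ 2 ρ}
    (hs : IsEvolution (massForm Ω Γ) (boundaryN hT c hg) (boundaryQ hT hg) (nonlocalM Γ c hj hh)
      (couplingP hT c hh) U₀ v₀ U v) :
    IsWeakSolution Ω Γ ρ c j g h (traceDomIncl Ω Γ U₀) v₀ (fun t => traceDomIncl Ω Γ (U t)) v := by
  have hUc := hs.continuousOn_u
  have hvc := hs.continuousOn_v
  have hi : ∀ {f : ℝ → ℝ} {T : ℝ}, 0 ≤ T →
      ContinuousOn f (Ici 0) → IntervalIntegrable f volume 0 T := fun hT0 hf => by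
    refine ContinuousOn.intervalIntegrable ?_
    rw [uIcc_of_le hT0]
    exact hf.mono fun s hs => hs.1
  refine ⟨(traceDomIncl Ω Γ).continuous.comp_continuousOn hUc, hvc, congrArg _ hs.initial_u,
    by simpa using hs.eq_v 0 le_rfl, fun t => hT.trace (U t), fun t _ => hT.hasTrace_trace _,
    fun φ τ hφ hτ T hT0 => ?_, fun ψ hψ T hT0 => ?_⟩
  · obtain ⟨p, hp⟩ := exists_traceDom_retraction Ω Γ
    set Φ : ℝ → TraceDom Ω Γ := fun t => p (φ t) with hΦ
    have hΦ1 : ContDiff ℝ 1 Φ := p.contDiff.comp hφ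
    have hΦφ : ∀ t, 0 ≤ t → traceDomIncl Ω Γ (Φ t) = φ t := fun t ht => by
      set w : TraceDom Ω Γ := (⟨φ t, ⟨τ t, hτ t ht⟩⟩ : traceSpace Ω Γ)
      have hw : traceDomIncl Ω Γ w = φ t := rfl
      simp only [hΦ]
      rw [← hw, hp]
    have hτΦ : ∀ t, 0 ≤ t → τ t = hT.trace (Φ t) := fun t ht =>
      hT.eq_trace _ (by rw [hΦφ t ht]; exact hτ t ht)
    -- At `t = 0` the two-sided derivatives may differ, because `φ` need not have traces at negative
    -- times; a single time does not affect the integrals.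
    have hdΦ : ∀ t, 0 < t → deriv φ t = traceDomIncl Ω Γ (deriv Φ t) := fun t ht => by
      have h1 : φ =ᶠ[𝓝 t] fun s => traceDomIncl Ω Γ (Φ s) := by
        filter_upwards [Ioi_mem_nhds ht] with s hs' using (hΦφ s (le_of_lt hs')).symm
      rw [h1.deriv_eq]
      exact ((traceDomIncl Ω Γ).hasFDerivAt.comp_hasDerivAt t
        (hΦ1.differentiable (by simp) t).hasDerivAt).deriv
    have hΦc := hΦ1.continuous
    have key := integral_by_parts_inner (a := fun t => massForm Ω Γ (U t)) (by fun_prop)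
      (F := fun s => massForm Ω Γ (U s) - U s - boundaryN hT c hg (U s) + boundaryQ hT hg (v s))
      (by fun_prop) hs.eq_u hΦ1 hT0
    simp only [inner_massForm, inner_evolution_rhs] at key
    rw [intervalIntegral.integral_add] at key
    · simp only [← inner_L2_eq_integral_mul, ← L2.inner_def, integral_boundary_flux c hg]
      have e1 : ∫ t in (0 : ℝ)..T, inner ℝ (fnH1 (traceDomIncl Ω Γ (U t))) (fnH1 (deriv φ t)) =
          ∫ t in (0 : ℝ)..T, inner ℝ (traceDomFn Ω Γ (U t)) (traceDomFn Ω Γ (deriv Φ t)) := by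
        rw [intervalIntegral.integral_of_le hT0, intervalIntegral.integral_of_le hT0]
        refine setIntegral_congr_fun measurableSet_Ioc fun t ht => ?_
        simp only [hdΦ t ht.1]
        rfl
      have e2 : ∫ t in (0 : ℝ)..T, inner ℝ (gradH1 (traceDomIncl Ω Γ (U t))) (gradH1 (φ t)) =
          ∫ t in (0 : ℝ)..T, inner ℝ (traceDomGrad Ω Γ (U t)) (traceDomGrad Ω Γ (Φ t)) := by
        refine intervalIntegral.integral_congr fun t ht => ?_
        rw [uIcc_of_le hT0] at ht
        simp only [← hΦφ t ht.1]
        rfl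
      have e3 : ∫ t in (0 : ℝ)..T,
            inner ℝ (hg.intOp (v t) - c • hg.massOp (hT.trace (U t))) (τ t) =
          ∫ t in (0 : ℝ)..T,
            inner ℝ (hg.intOp (v t) - c • hg.massOp (hT.trace (U t))) (hT.trace (Φ t)) := by
        refine intervalIntegral.integral_congr fun t ht => ?_
        rw [uIcc_of_le hT0] at ht
        simp only [hτΦ t ht.1]
      rw [intervalIntegral.integral_neg, ← add_assoc, ← sub_eq_add_neg] at key
      rw [e1, e2, e3, ← hΦφ T hT0, ← hΦφ 0 le_rfl]
      exact key
    · refine hi hT0 (ContinuousOn.neg (ContinuousOn.inner ?_ ?_))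
      · fun_prop
      · exact (by fun_prop : Continuous fun t => traceDomGrad Ω Γ (Φ t)).continuousOn
    · refine hi hT0 (ContinuousOn.inner ?_ ?_)
      · fun_prop
      · exact (by fun_prop : Continuous fun t => hT.trace (Φ t)).continuousOn
  · have hψc := hψ.continuous
    have key := integral_by_parts_inner hvc
      (F := fun s => nonlocalM Γ c hj hh (v s) + couplingP hT c hh (U s))
      (by fun_prop) hs.eq_v hψ hT0
    simp only [nonlocalM_add_couplingP, inner_sub_left (c • _)] at key
    rw [intervalIntegral.integral_sub] at key
    · simp only [← inner_L2_eq_integral_mul, integral_coupling_flux c hh,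
        integral_nonlocal_flux c hj]
      rw [add_sub_assoc]
      exact key
    · exact hi hT0 (ContinuousOn.inner (by fun_prop) hψc.continuousOn)
    · exact hi hT0 (ContinuousOn.inner (by fun_prop) hψc.continuousOn)

end WeakForm

/-! ### Integration over the fibers and the reduced problem -/

section FiberIntegral
variable {X₁ X₂ Z : Type*} [MeasurableSpace X₁] [MeasurableSpace X₂] [MeasurableSpace Z]
  {μ : Measure X₁} {ν : Measure X₂} {ζ : Measure Z} [IsFiniteMeasure μ] [IsFiniteMeasure ν]
  [IsFiniteMeasure ζ]

omit [IsFiniteMeasure ν] in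
theorem enorm_integral_sq_le (f : X₂ → ℝ) (hf : AEStronglyMeasurable f ν) :
    ‖∫ y, f y ∂ν‖ₑ ^ 2 ≤ ν univ * ∫⁻ y, ‖f y‖ₑ ^ 2 ∂ν := by
  have h1 := eLpNorm_le_eLpNorm_mul_rpow_measure_univ (p := 1) (q := 2) (by norm_num) hf
  have h2 : ‖∫ y, f y ∂ν‖ₑ ≤ eLpNorm f 2 ν * ν univ ^ ((2 : ℝ)⁻¹) := by
    refine (enorm_integral_le_lintegral_enorm f).trans ?_
    rw [← eLpNorm_one_eq_lintegral_enorm]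
    refine h1.trans_eq ?_
    congr 2
    norm_num
  calc ‖∫ y, f y ∂ν‖ₑ ^ 2 ≤ (eLpNorm f 2 ν * ν univ ^ ((2 : ℝ)⁻¹)) ^ 2 := by gcongr
    _ = ν univ * ∫⁻ y, ‖f y‖ₑ ^ 2 ∂ν := by
      rw [mul_pow, eLpNorm_two_sq, ← ENNReal.rpow_natCast, ← ENNReal.rpow_mul, mul_comm]
      norm_num

omit [IsFiniteMeasure μ] in
theorem aestronglyMeasurable_fiberIntegral [SFinite μ] (v : Lp ℝ 2 (μ.prod ν)) :
    AEStronglyMeasurable (fun x => ∫ y, v (x, y) ∂ν) μ :=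
  (Lp.aestronglyMeasurable v).integral_prod_right'

omit [IsFiniteMeasure μ] in
-- Cauchy–Schwarz on each fiber costs the factor `ν univ`, and Tonelli reassembles the fibers.
theorem eLpNorm_fiberIntegral_le [SFinite μ] (v : Lp ℝ 2 (μ.prod ν)) :
    eLpNorm (fun x => ∫ y, v (x, y) ∂ν) 2 μ ≤ ENNReal.ofReal (√(ν.real univ) * ‖v‖) := by
  refine (ENNReal.pow_le_pow_left_iff (n := 2) (by norm_num)).1 ?_
  have hm := Lp.aestronglyMeasurable v
  have h1 : eLpNorm (fun x => ∫ y, v (x, y) ∂ν) 2 μ ^ 2 ≤ ν univ * ‖v‖ₑ ^ 2 := by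
    rw [eLpNorm_two_sq, Lp.enorm_def, eLpNorm_two_sq,
      lintegral_prod _ (hm.enorm.pow_const 2), ← lintegral_const_mul'' _
        (hm.enorm.pow_const 2).lintegral_prod_right']
    refine lintegral_mono_ae ?_
    filter_upwards [hm.prodMk_left] with x hx
    exact enorm_integral_sq_le _ hx
  refine h1.trans_eq ?_
  rw [ENNReal.ofReal_mul (Real.sqrt_nonneg _), mul_pow, ofReal_norm, ← ENNReal.ofReal_pow
    (Real.sqrt_nonneg _), Real.sq_sqrt measureReal_nonneg, ofReal_measureReal]

theorem memLp_fiberIntegral (v : Lp ℝ 2 (μ.prod ν)) :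
    MemLp (fun x => ∫ y, v (x, y) ∂ν) 2 μ :=
  ⟨aestronglyMeasurable_fiberIntegral v,
    (eLpNorm_fiberIntegral_le v).trans_lt ENNReal.ofReal_lt_top⟩

theorem ae_integrable_fiber (v : Lp ℝ 2 (μ.prod ν)) :
    ∀ᵐ x ∂μ, Integrable (fun y => v (x, y)) ν :=
  (integrable_of_L2 v).prod_right_ae

/-- Integration over the fibers of a product, as an operator on `L²`. -/
def fiberL (μ : Measure X₁) (ν : Measure X₂) [IsFiniteMeasure μ] [IsFiniteMeasure ν] :
    Lp ℝ 2 (μ.prod ν) →L[ℝ] Lp ℝ 2 μ :=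
  LinearMap.mkContinuous
    { toFun := fun v => (memLp_fiberIntegral v).toLp _
      map_add' := fun v w => by
        refine Lp.ext ?_
        filter_upwards [(memLp_fiberIntegral (v + w)).coeFn_toLp,
          (memLp_fiberIntegral v).coeFn_toLp, (memLp_fiberIntegral w).coeFn_toLp,
          Lp.coeFn_add ((memLp_fiberIntegral v).toLp _) ((memLp_fiberIntegral w).toLp _),
          ae_integrable_fiber v, ae_integrable_fiber w,
          Measure.ae_ae_of_ae_prod (Lp.coeFn_add v w)] with x h1 h2 h3 h4 h5 h6 h7
        rw [h1, h4, Pi.add_apply, h2, h3, ← integral_add h5 h6]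
        exact integral_congr_ae h7
      map_smul' := fun c v => by
        refine Lp.ext ?_
        filter_upwards [(memLp_fiberIntegral (c • v)).coeFn_toLp,
          (memLp_fiberIntegral v).coeFn_toLp,
          Lp.coeFn_smul c ((memLp_fiberIntegral v).toLp _),
          Measure.ae_ae_of_ae_prod (Lp.coeFn_smul c v)] with x h1 h2 h3 h4
        rw [h1, RingHom.id_apply, h3, Pi.smul_apply, h2, smul_eq_mul, ← integral_const_mul]
        exact integral_congr_ae h4 }
    (√(ν.real univ))
    fun v => by
      change ‖(memLp_fiberIntegral v).toLp _‖ ≤ _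
      rw [Lp.norm_toLp]
      exact ENNReal.toReal_le_of_le_ofReal (by positivity) (eLpNorm_fiberIntegral_le v)

theorem coeFn_fiberL (v : Lp ℝ 2 (μ.prod ν)) :
    fiberL μ ν v =ᵐ[μ] fun x => ∫ y, v (x, y) ∂ν :=
  (memLp_fiberIntegral v).coeFn_toLp

namespace IsBddKernel
variable {C C₀ : ℝ}

theorem intOp_comp_fst_right {k : Z → X₁ → ℝ} (h : IsBddKernel ζ μ k C)
    (h₀ : IsBddKernel ζ (μ.prod ν) (fun z y => k z y.1) C₀) (v : Lp ℝ 2 (μ.prod ν)) :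
    h₀.intOp v = h.intOp (fiberL μ ν v) := by
  refine Lp.ext ?_
  filter_upwards [h₀.coeFn_intOp v, h.coeFn_intOp (fiberL μ ν v), h₀.ae_integrable_mul v]
    with z h1 h2 h3
  rw [h1, h2, integral_prod _ h3]
  refine integral_congr_ae ?_
  filter_upwards [coeFn_fiberL v] with x hx
  rw [hx, integral_const_mul]

omit [IsFiniteMeasure ζ] in
-- Integrating out a variable that the kernel ignores contributes the mass of `ν`. This is the
-- factor `|R₂|` in front of `u*` in the limiting boundary flux.
theorem massOp_comp_fst_right {k : Z → X₁ → ℝ} (h : IsBddKernel ζ μ k C)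
    (h₀ : IsBddKernel ζ (μ.prod ν) (fun z y => k z y.1) C₀) (w : Lp ℝ 2 ζ) :
    h₀.massOp w = ν.real univ • h.massOp w := by
  refine Lp.ext ?_
  filter_upwards [h₀.coeFn_massOp w, h.coeFn_massOp w, h₀.ae_integrable,
    Lp.coeFn_smul (ν.real univ) (h.massOp w)] with z h1 h2 h3 h4
  rw [h1, h4, Pi.smul_apply, h2, integral_prod _ h3]
  simp only [integral_const, smul_eq_mul]
  rw [integral_const_mul, mul_assoc]

/-- The output is constant along the fibers, so integrating it multiplies by the mass of `ν`. On the
nonlocal side this is the factor `|R₂|` of the coupling with `u*`. -/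
theorem fiberL_intOp_comp_fst_left {k : X₁ → Z → ℝ} (h : IsBddKernel μ ζ k C)
    (h₀ : IsBddKernel (μ.prod ν) ζ (fun x z => k x.1 z) C₀) (w : Lp ℝ 2 ζ) :
    fiberL μ ν (h₀.intOp w) = ν.real univ • h.intOp w := by
  refine Lp.ext ?_
  filter_upwards [coeFn_fiberL (h₀.intOp w), Measure.ae_ae_of_ae_prod (h₀.coeFn_intOp w),
    h.coeFn_intOp w, Lp.coeFn_smul (ν.real univ) (h.intOp w)] with x h1 h2 h3 h4
  rw [h1, h4, Pi.smul_apply, h3, integral_congr_ae h2, integral_const]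

theorem fiberL_massOp_comp_fst_left {k : X₁ → Z → ℝ} (h : IsBddKernel μ ζ k C)
    (h₀ : IsBddKernel (μ.prod ν) ζ (fun x z => k x.1 z) C₀) (v : Lp ℝ 2 (μ.prod ν)) :
    fiberL μ ν (h₀.massOp v) = h.massOp (fiberL μ ν v) := by
  refine Lp.ext ?_
  filter_upwards [coeFn_fiberL (h₀.massOp v), Measure.ae_ae_of_ae_prod (h₀.coeFn_massOp v),
    h.coeFn_massOp (fiberL μ ν v), coeFn_fiberL v] with x h1 h2 h3 h4
  rw [h1, h3, h4, integral_congr_ae h2, integral_const_mul]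

end IsBddKernel

variable {E : Type*} [NormedAddCommGroup E] [InnerProductSpace ℝ E] [FiniteDimensional ℝ E]
  [MeasurableSpace E] [BorelSpace E] {Ω Γ : Set E} [CompleteSpace (TraceDom Ω Γ)]
  [IsFiniteMeasure (surfaceMeasure Γ)]

/-- If the kernels do not depend on the second variable of the product, integration over the
fibers maps solutions to solutions of the reduced problem. -/
theorem IsEvolution.fiberIntegral (hT : HasTraceBound Ω Γ) {j : X₁ → X₁ → ℝ} {g : E → X₁ → ℝ}
    {h : X₁ → E → ℝ} {Cj Cm Cg Ch Dj Dg Dh : ℝ} (hj : IsBddKernel μ μ j Cj)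
    (hg : IsBddKernel (surfaceMeasure Γ) μ g Cg) (hh : IsBddKernel μ (surfaceMeasure Γ) h Ch)
    (hjm : IsBddKernel μ (μ.prod ν) (fun x y => j x y.1) Cm)
    (hj₀ : IsBddKernel (μ.prod ν) (μ.prod ν) (fun x y => j x.1 y.1) Dj)
    (hg₀ : IsBddKernel (surfaceMeasure Γ) (μ.prod ν) (fun x y => g x y.1) Dg)
    (hh₀ : IsBddKernel (μ.prod ν) (surfaceMeasure Γ) (fun x y => h x.1 y) Dh)
    {U₀ : TraceDom Ω Γ} {v₀ : Lp ℝ 2 (μ.prod ν)} {U : ℝ → TraceDom Ω Γ}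
    {v : ℝ → Lp ℝ 2 (μ.prod ν)}
    (hs : IsEvolution (massForm Ω Γ) (boundaryN hT 1 hg₀) (boundaryQ hT hg₀)
      (nonlocalM Γ 1 hj₀ hh₀) (couplingP hT 1 hh₀) U₀ v₀ U v) :
    IsEvolution (massForm Ω Γ) (boundaryN hT (ν.real univ) hg) (boundaryQ hT hg)
      (nonlocalM Γ (ν.real univ) hj hh) (couplingP hT (ν.real univ) hh) U₀ (fiberL μ ν v₀) U
      (fun t => fiberL μ ν (v t)) := by
  have hUc := hs.continuousOn_u
  have hvc := hs.continuousOn_v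
  refine ⟨hUc, by fun_prop, hs.initial_u, fun t ht => ?_, fun t ht => ?_⟩
  · rw [hs.eq_u t ht]
    congr 1
    refine intervalIntegral.integral_congr fun s _ => ?_
    simp only [boundaryN, boundaryQ, smul_apply, ContinuousLinearMap.comp_apply,
      hg.intOp_comp_fst_right hg₀, hg.massOp_comp_fst_right hg₀, map_smul, one_smul]
  · have hi : IntervalIntegrable
        (fun s => nonlocalM Γ 1 hj₀ hh₀ (v s) + couplingP hT 1 hh₀ (U s)) volume 0 t := by
      refine ContinuousOn.intervalIntegrable ?_
      rw [uIcc_of_le ht]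
      exact (by fun_prop : ContinuousOn (fun s => nonlocalM Γ 1 hj₀ hh₀ (v s) +
        couplingP hT 1 hh₀ (U s)) (Ici 0)).mono fun s hs => hs.1
    rw [hs.eq_v t ht, map_add, ← (fiberL μ ν).intervalIntegral_comp_comm hi]
    congr 1
    refine intervalIntegral.integral_congr fun s _ => ?_
    -- The kernel `j` is reduced in two stages, with the mixed kernel of `hjm` in between: one for
    -- the variable of the equation and one for the variable of integration.
    simp only [nonlocalM_add_couplingP, map_sub, one_smul,
      hjm.fiberL_intOp_comp_fst_left hj₀, hjm.fiberL_massOp_comp_fst_left hj₀,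
      hj.intOp_comp_fst_right hjm, hj.massOp_comp_fst_right hjm,
      hh.fiberL_intOp_comp_fst_left hh₀, hh.fiberL_massOp_comp_fst_left hh₀, smul_sub]

end FiberIntegral

/-! ### Well-posedness and dependence on the kernels -/

section Stability
variable {E : Type*} [NormedAddCommGroup E] [InnerProductSpace ℝ E] [FiniteDimensional ℝ E]
  [MeasurableSpace E] [BorelSpace E] {Ω Γ : Set E} [CompleteSpace (TraceDom Ω Γ)]
  [IsFiniteMeasure (surfaceMeasure Γ)] {Y : Type*} [MeasurableSpace Y] {ρ : Measure Y}
  [IsFiniteMeasure ρ] {c C : ℝ} {j j' : Y → Y → ℝ} {g g' : E → Y → ℝ} {h h' : Y → E → ℝ}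
  {Cj Cg Ch Cj' Cg' Ch' : ℝ}

omit [IsFiniteMeasure (surfaceMeasure Γ)] in
-- Since `c` and `g` are nonnegative, `R` can be the trace followed by multiplication by `√(c ∫ g)`.
-- This serves both existence and the sign of `N` in the energy estimate.
theorem exists_sqrt_boundaryN (hT : HasTraceBound Ω Γ) (hc : 0 ≤ c)
    (hg : IsBddKernel (surfaceMeasure Γ) ρ g Cg) (hg0 : ∀ x y, 0 ≤ g x y) :
    ∃ R : TraceDom Ω Γ →L[ℝ] Lp ℝ 2 (surfaceMeasure Γ),
      ∀ u w, inner ℝ (boundaryN hT c hg u) w = inner ℝ (R u) (R w) := by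
  obtain ⟨R, hR⟩ := hg.exists_sqrt_massOp hg0
  refine ⟨√c • R.comp hT.trace, fun u w => ?_⟩
  simp only [boundaryN, smul_apply, ContinuousLinearMap.comp_apply, real_inner_smul_left,
    real_inner_smul_right, ContinuousLinearMap.adjoint_inner_left, hR]
  rw [← mul_assoc, Real.mul_self_sqrt hc]

omit [IsFiniteMeasure (surfaceMeasure Γ)] in
theorem inner_boundaryN_nonneg (hT : HasTraceBound Ω Γ) (hc : 0 ≤ c)
    (hg : IsBddKernel (surfaceMeasure Γ) ρ g Cg) (hg0 : ∀ x y, 0 ≤ g x y) (u : TraceDom Ω Γ) :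
    0 ≤ inner ℝ (boundaryN hT c hg u) u := by
  obtain ⟨R, hR⟩ := exists_sqrt_boundaryN hT hc hg hg0
  rw [hR]
  exact real_inner_self_nonneg

/-- Existence for the coupled problem. -/
theorem exists_isEvolution_coupled (hΩ : IsOpen Ω) (hT : HasTraceBound Ω Γ) (hc : 0 ≤ c)
    (hj : IsBddKernel ρ ρ j Cj) (hg : IsBddKernel (surfaceMeasure Γ) ρ g Cg)
    (hh : IsBddKernel ρ (surfaceMeasure Γ) h Ch) (hg0 : ∀ x y, 0 ≤ g x y) (U₀ : TraceDom Ω Γ)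
    (v₀ : Lp ℝ 2 ρ) :
    ∃ U v, IsEvolution (massForm Ω Γ) (boundaryN hT c hg) (boundaryQ hT hg) (nonlocalM Γ c hj hh)
      (couplingP hT c hh) U₀ v₀ U v := by
  obtain ⟨R, hR⟩ := exists_sqrt_boundaryN hT hc hg hg0
  exact exists_isEvolution massForm_symm massForm_nonneg (massForm_injective hΩ) _ R hR _ _ _ _ _

/-- Uniqueness for the coupled problem. -/
theorem IsEvolution.eq_of_coupled (hΩ : IsOpen Ω) (hT : HasTraceBound Ω Γ) (hc : 0 ≤ c)
    (hj : IsBddKernel ρ ρ j Cj) (hg : IsBddKernel (surfaceMeasure Γ) ρ g Cg)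
    (hh : IsBddKernel ρ (surfaceMeasure Γ) h Ch) (hg0 : ∀ x y, 0 ≤ g x y) {U₀ : TraceDom Ω Γ}
    {v₀ : Lp ℝ 2 ρ} {U U' : ℝ → TraceDom Ω Γ} {v v' : ℝ → Lp ℝ 2 ρ}
    (hs : IsEvolution (massForm Ω Γ) (boundaryN hT c hg) (boundaryQ hT hg) (nonlocalM Γ c hj hh)
      (couplingP hT c hh) U₀ v₀ U v)
    (hs' : IsEvolution (massForm Ω Γ) (boundaryN hT c hg) (boundaryQ hT hg)
      (nonlocalM Γ c hj hh) (couplingP hT c hh) U₀ v₀ U' v') {t : ℝ} (ht : 0 ≤ t) :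
    U t = U' t ∧ v t = v' t := by
  set α := max ‖boundaryQ hT hg‖ (max ‖nonlocalM Γ c hj hh‖ ‖couplingP hT c hh‖) with hα
  -- Equal coefficients leave no residual, so `ρ = 0` and the energy of the difference vanishes; `S`
  -- being injective, this determines `U` as well.
  have key := IsEvolution.sq_norm_sub_le massForm_symm massForm_nonneg hs hs'
    (inner_boundaryN_nonneg hT hc hg hg0) (α := α) (ρ := 0) (T := t)
    ((norm_nonneg _).trans (le_max_left _ _)) (le_max_left _ _)
    ((le_max_left _ _).trans (le_max_right _ _)) ((le_max_right _ _).trans (le_max_right _ _))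
    (fun s _ => by simp) (fun s _ => by simp) ⟨ht, le_rfl⟩
  have h1 := massForm_nonneg (U t - U' t)
  have h2 := sq_nonneg ‖v t - v' t‖
  rw [zero_pow two_ne_zero, zero_mul] at key
  have h3 : ‖v t - v' t‖ = 0 := eq_zero_of_pow_eq_zero (n := 2) (by linarith)
  have h4 : inner ℝ (massForm Ω Γ (U t - U' t)) (U t - U' t) = 0 := by linarith
  rw [massForm_self] at h4
  have h5 : fnH1 (traceDomIncl Ω Γ (U t - U' t)) = 0 := by simpa using h4
  refine ⟨sub_eq_zero.1 ?_, sub_eq_zero.1 (norm_eq_zero.1 h3)⟩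
  exact traceDomIncl_injective Ω Γ (fnH1_injective hΩ (h5.trans (map_zero (fnL Ω)).symm))

theorem norm_boundaryQ_le (hT : HasTraceBound Ω Γ)
    (hg : IsBddKernel (surfaceMeasure Γ) ρ g Cg) :
    ‖boundaryQ hT hg‖ ≤ ‖hT.trace‖ * (sqrtMass (surfaceMeasure Γ) * (Cg * sqrtMass ρ)) := by
  refine (ContinuousLinearMap.opNorm_comp_le _ _).trans ?_
  rw [LinearIsometryEquiv.norm_map]
  exact mul_le_mul_of_nonneg_left hg.norm_intOp_le (norm_nonneg _)

omit [FiniteDimensional ℝ E] [CompleteSpace (TraceDom Ω Γ)] in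
theorem norm_nonlocalM_le (hj : IsBddKernel ρ ρ j Cj)
    (hh : IsBddKernel ρ (surfaceMeasure Γ) h Ch) :
    ‖nonlocalM Γ 1 hj hh‖ ≤ sqrtMass ρ * (Cj * sqrtMass ρ) + Cj * ρ.real univ +
      Ch * (surfaceMeasure Γ).real univ := by
  rw [nonlocalM, one_smul]
  refine (norm_sub_le _ _).trans (add_le_add ((norm_sub_le _ _).trans ?_) hh.norm_massOp_le)
  exact add_le_add hj.norm_intOp_le hj.norm_massOp_le

omit [CompleteSpace (TraceDom Ω Γ)] in
theorem norm_couplingP_le (hT : HasTraceBound Ω Γ)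
    (hh : IsBddKernel ρ (surfaceMeasure Γ) h Ch) :
    ‖couplingP hT 1 hh‖ ≤
      sqrtMass ρ * (Ch * sqrtMass (surfaceMeasure Γ)) * ‖hT.trace‖ := by
  rw [couplingP, one_smul]
  refine (ContinuousLinearMap.opNorm_comp_le _ _).trans ?_
  exact mul_le_mul_of_nonneg_right hh.norm_intOp_le (norm_nonneg _)

theorem norm_boundary_sub_le (hT : HasTraceBound Ω Γ) {δ : ℝ}
    (hg : IsBddKernel (surfaceMeasure Γ) ρ g Cg) (hg' : IsBddKernel (surfaceMeasure Γ) ρ g' Cg')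
    (hδ : 0 ≤ δ) (hd : ∀ᵐ x ∂surfaceMeasure Γ, ∀ᵐ y ∂ρ, |g x y - g' x y| ≤ δ)
    (u : TraceDom Ω Γ) (v : Lp ℝ 2 ρ) :
    ‖(boundaryQ hT hg - boundaryQ hT hg') v - (boundaryN hT 1 hg - boundaryN hT 1 hg') u‖ ≤
      ‖hT.trace‖ * (sqrtMass (surfaceMeasure Γ) * sqrtMass ρ * ‖v‖ +
        ρ.real univ * (‖hT.trace‖ * ‖u‖)) * δ := by
  have e : (boundaryQ hT hg - boundaryQ hT hg') v - (boundaryN hT 1 hg - boundaryN hT 1 hg') u =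
      ContinuousLinearMap.adjoint hT.trace
        ((hg.intOp - hg'.intOp) v - (hg.massOp - hg'.massOp) (hT.trace u)) := by
    simp only [boundaryQ, boundaryN, one_smul, sub_apply, ContinuousLinearMap.comp_apply, map_sub]
  rw [e]
  refine (ContinuousLinearMap.le_opNorm _ _).trans ?_
  rw [LinearIsometryEquiv.norm_map, mul_assoc]
  refine mul_le_mul_of_nonneg_left ((norm_sub_le _ _).trans ?_) (norm_nonneg _)
  rw [add_mul]
  refine add_le_add ?_ ?_
  · refine ((ContinuousLinearMap.le_opNorm _ _).trans (mul_le_mul_of_nonneg_right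
      (hg.norm_intOp_sub_le hg' hδ hd) (norm_nonneg _))).trans_eq ?_
    ring
  · refine ((ContinuousLinearMap.le_opNorm _ _).trans (mul_le_mul
      (hg.norm_massOp_sub_le hg' hδ hd) (hT.trace.le_opNorm u) (norm_nonneg _)
        (mul_nonneg hδ measureReal_nonneg))).trans_eq ?_
    ring

omit [CompleteSpace (TraceDom Ω Γ)] in
theorem norm_nonlocal_sub_le (hT : HasTraceBound Ω Γ) {δ : ℝ} (hj : IsBddKernel ρ ρ j Cj)
    (hj' : IsBddKernel ρ ρ j' Cj') (hh : IsBddKernel ρ (surfaceMeasure Γ) h Ch)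
    (hh' : IsBddKernel ρ (surfaceMeasure Γ) h' Ch') (hδ : 0 ≤ δ)
    (hdj : ∀ᵐ x ∂ρ, ∀ᵐ y ∂ρ, |j x y - j' x y| ≤ δ)
    (hdh : ∀ᵐ x ∂ρ, ∀ᵐ y ∂surfaceMeasure Γ, |h x y - h' x y| ≤ δ)
    (u : TraceDom Ω Γ) (v : Lp ℝ 2 ρ) :
    ‖(nonlocalM Γ 1 hj hh - nonlocalM Γ 1 hj' hh') v + (couplingP hT 1 hh - couplingP hT 1 hh') u‖ ≤
      ((sqrtMass ρ * sqrtMass ρ + ρ.real univ + (surfaceMeasure Γ).real univ) * ‖v‖ +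
        sqrtMass ρ * sqrtMass (surfaceMeasure Γ) * (‖hT.trace‖ * ‖u‖)) * δ := by
  have e : (nonlocalM Γ 1 hj hh - nonlocalM Γ 1 hj' hh') v +
        (couplingP hT 1 hh - couplingP hT 1 hh') u =
      ((hj.intOp - hj'.intOp) v - (hj.massOp - hj'.massOp) v - (hh.massOp - hh'.massOp) v) +
        (hh.intOp - hh'.intOp) (hT.trace u) := by
    simp only [nonlocalM, couplingP, one_smul, sub_apply, ContinuousLinearMap.comp_apply]
    abel
  have n1 := (ContinuousLinearMap.le_opNorm _ v).trans (mul_le_mul_of_nonneg_right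
    (hj.norm_intOp_sub_le hj' hδ hdj) (norm_nonneg v))
  have n2 := (ContinuousLinearMap.le_opNorm _ v).trans (mul_le_mul_of_nonneg_right
    (hj.norm_massOp_sub_le hj' hδ hdj) (norm_nonneg v))
  have n3 := (ContinuousLinearMap.le_opNorm _ v).trans (mul_le_mul_of_nonneg_right
    (hh.norm_massOp_sub_le hh' hδ hdh) (norm_nonneg v))
  have n4 := (ContinuousLinearMap.le_opNorm _ (hT.trace u)).trans (mul_le_mul
    (hh.norm_intOp_sub_le hh' hδ hdh) (hT.trace.le_opNorm u) (norm_nonneg _)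
      (mul_nonneg sqrtMass_nonneg (mul_nonneg hδ sqrtMass_nonneg)))
  rw [e]
  refine (norm_add_le _ _).trans ((add_le_add ((norm_sub_le _ _).trans
    (add_le_add ((norm_sub_le _ _).trans (add_le_add n1 n2)) n3)) n4).trans_eq ?_)
  ring

/-- Solutions depend Lipschitz continuously on the kernels, uniformly on bounded time intervals. -/
theorem IsEvolution.exists_norm_sub_le (hT : HasTraceBound Ω Γ)
    (hj' : IsBddKernel ρ ρ j' Cj') (hg' : IsBddKernel (surfaceMeasure Γ) ρ g' Cg')
    (hh' : IsBddKernel ρ (surfaceMeasure Γ) h' Ch') {U₀ : TraceDom Ω Γ} {v₀ : Lp ℝ 2 ρ}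
    {U' : ℝ → TraceDom Ω Γ} {v' : ℝ → Lp ℝ 2 ρ}
    (hs' : IsEvolution (massForm Ω Γ) (boundaryN hT 1 hg') (boundaryQ hT hg')
      (nonlocalM Γ 1 hj' hh') (couplingP hT 1 hh') U₀ v₀ U' v') (C T : ℝ) :
    ∃ K, 0 ≤ K ∧ ∀ {j : Y → Y → ℝ} {g : E → Y → ℝ} {h : Y → E → ℝ} (hj : IsBddKernel ρ ρ j C)
      (hg : IsBddKernel (surfaceMeasure Γ) ρ g C) (hh : IsBddKernel ρ (surfaceMeasure Γ) h C)
      {U : ℝ → TraceDom Ω Γ} {v : ℝ → Lp ℝ 2 ρ} {δ : ℝ}, (∀ x y, 0 ≤ g x y) →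
      IsEvolution (massForm Ω Γ) (boundaryN hT 1 hg) (boundaryQ hT hg)
        (nonlocalM Γ 1 hj hh) (couplingP hT 1 hh) U₀ v₀ U v → 0 ≤ δ →
      (∀ᵐ x ∂ρ, ∀ᵐ y ∂ρ, |j x y - j' x y| ≤ δ) →
      (∀ᵐ x ∂surfaceMeasure Γ, ∀ᵐ y ∂ρ, |g x y - g' x y| ≤ δ) →
      (∀ᵐ x ∂ρ, ∀ᵐ y ∂surfaceMeasure Γ, |h x y - h' x y| ≤ δ) → ∀ t ∈ Icc 0 T,
      ‖fnH1 (traceDomIncl Ω Γ (U t)) - fnH1 (traceDomIncl Ω Γ (U' t))‖ ≤ K * δ ∧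
        ‖v t - v' t‖ ≤ K * δ := by
  -- The residual involves only the reference solution `(U', v')`, so bounds for it on `[0, T]`
  -- suffice and no a priori estimate of `(U, v)` is needed.
  obtain ⟨Bu, hBu⟩ := isCompact_Icc.exists_bound_of_continuousOn
    (hs'.continuousOn_u.mono fun s (hs : s ∈ Icc 0 T) => hs.1)
  obtain ⟨Bv, hBv⟩ := isCompact_Icc.exists_bound_of_continuousOn
    (hs'.continuousOn_v.mono fun s (hs : s ∈ Icc 0 T) => hs.1)
  -- `α` bounds the operators of every system with kernels bounded by `C`; `A * δ` will bound the
  -- residuals.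
  set α : ℝ := max (‖hT.trace‖ * (sqrtMass (surfaceMeasure Γ) * (C * sqrtMass ρ)))
    (max (sqrtMass ρ * (C * sqrtMass ρ) + C * ρ.real univ + C * (surfaceMeasure Γ).real univ)
      (sqrtMass ρ * (C * sqrtMass (surfaceMeasure Γ)) * ‖hT.trace‖)) with hα
  set A : ℝ := max 0 (max (‖hT.trace‖ * (sqrtMass (surfaceMeasure Γ) * sqrtMass ρ * Bv +
        ρ.real univ * (‖hT.trace‖ * Bu)))
    ((sqrtMass ρ * sqrtMass ρ + ρ.real univ + (surfaceMeasure Γ).real univ) * Bv +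
        sqrtMass ρ * sqrtMass (surfaceMeasure Γ) * (‖hT.trace‖ * Bu))) with hA
  have hA0 : 0 ≤ A := le_max_left _ _
  have s1 : 0 ≤ sqrtMass ρ := sqrtMass_nonneg
  have s2 : 0 ≤ sqrtMass (surfaceMeasure Γ) := sqrtMass_nonneg
  set B : ℝ := Real.exp ((4 * α ^ 2 + 2 * α + 2) * T) with hB
  refine ⟨A * √B, by positivity, fun {j g h} hj hg hh {U v δ} hg0 hs hδ hdj hdg hdh t ht => ?_⟩
  have hα0 : 0 ≤ α := (norm_nonneg _).trans ((norm_boundaryQ_le hT hg).trans (le_max_left _ _))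
  have key := IsEvolution.sq_norm_sub_le massForm_symm massForm_nonneg hs hs'
    (inner_boundaryN_nonneg hT zero_le_one hg hg0) (α := α) (ρ := A * δ) (T := T) hα0
    ((norm_boundaryQ_le hT hg).trans (le_max_left _ _))
    ((norm_nonlocalM_le hj hh).trans ((le_max_left _ _).trans (le_max_right _ _)))
    ((norm_couplingP_le hT hh).trans ((le_max_right _ _).trans (le_max_right _ _)))
    (fun s hs => by
      refine (norm_boundary_sub_le hT hg hg' hδ hdg (U' s) (v' s)).trans ?_
      refine mul_le_mul_of_nonneg_right ?_ hδ
      refine le_trans ?_ ((le_max_left _ _).trans (le_max_right _ _))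
      have := hBu s hs
      have := hBv s hs
      gcongr)
    (fun s hs => by
      refine (norm_nonlocal_sub_le hT hj hj' hh hh' hδ hdj hdh (U' s) (v' s)).trans ?_
      refine mul_le_mul_of_nonneg_right ?_ hδ
      refine le_trans ?_ ((le_max_right _ _).trans (le_max_right _ _))
      have := hBu s hs
      have := hBv s hs
      gcongr) ht
  rw [massForm_self] at key
  have h0 : (A * δ) ^ 2 * B = (A * √B * δ) ^ 2 := by
    rw [mul_right_comm, mul_pow _ (√B), Real.sq_sqrt (Real.exp_pos _).le]
  rw [← hB, h0] at key
  have hnn : 0 ≤ A * √B * δ := by positivity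
  constructor
  · refine abs_le_of_sq_le_sq' ?_ hnn |>.2
    refine le_trans ?_ (le_of_add_le_of_nonneg_left key (sq_nonneg _))
    rw [map_sub]
    exact le_rfl
  · exact abs_le_of_sq_le_sq' (le_of_add_le_of_nonneg_right key (sq_nonneg _)) hnn |>.2

end Stability

/-- Uniform convergence on bounded time intervals implies weak convergence in `L^∞(0,T;X)`. -/
theorem WeakConvLinfty.of_uniform {X : Type*} [NormedAddCommGroup X] [NormedSpace ℝ X] {T : ℝ}
    {f : ℝ → ℝ → X} {f₀ : ℝ → X} (hf : ∀ ε ∈ Ioc (0 : ℝ) 1, ContinuousOn (f ε) (Ici 0))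
    (hf₀ : ContinuousOn f₀ (Ici 0))
    (h : ∀ δ > 0, ∀ᶠ ε in 𝓝[>] (0 : ℝ), ∀ t ∈ Icc 0 T, ‖f ε t - f₀ t‖ ≤ δ) :
    WeakConvLinfty T f f₀ := by
  have hmem : ∀ {a : ℝ → X}, ContinuousOn a (Ici 0) →
      MemLp a ⊤ (volume.restrict (Ioo 0 T)) := fun ha => by
    obtain ⟨C, hC⟩ := isCompact_Icc.exists_bound_of_continuousOn
      (ha.mono fun s (hs : s ∈ Icc 0 T) => hs.1)
    refine memLp_top_of_bound ((ha.mono fun s (hs : s ∈ Ioo 0 T) => hs.1.le).aestronglyMeasurable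
      measurableSet_Ioo) C ?_
    filter_upwards [ae_restrict_mem measurableSet_Ioo] with s hs
    exact hC s (Ioo_subset_Icc_self hs)
  classical
  -- Outside `(0, 1]` nothing is known about `f ε`; the value `0` chosen there is not seen by the
  -- limit `ε → 0⁺`.
  refine ⟨fun ε => if hε : ε ∈ Ioc (0 : ℝ) 1 then (hmem (hf ε hε)).toLp else 0,
    (hmem hf₀).toLp, fun ε hε => ?_, (hmem hf₀).coeFn_toLp, ?_⟩
  · simp only [dif_pos hε]
    exact (hmem (hf ε hε)).coeFn_toLp
  · refine ((toWeakSpaceCLM ℝ _).continuous.tendsto _).comp ?_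
    rw [Metric.tendsto_nhds]
    intro δ hδ
    have h1 : Ioc (0 : ℝ) 1 ∈ 𝓝[>] (0 : ℝ) := Ioc_mem_nhdsGT one_pos
    filter_upwards [h (δ / 2) (half_pos hδ), h1] with ε hε hε1
    rw [dist_eq_norm, dif_pos hε1, ← MemLp.toLp_sub, Lp.norm_toLp]
    refine lt_of_le_of_lt (ENNReal.toReal_le_of_le_ofReal (half_pos hδ).le ?_) (half_lt_self hδ)
    refine eLpNormEssSup_le_of_ae_bound ?_
    filter_upwards [ae_restrict_mem measurableSet_Ioo] with s hs
    exact hε s (Ioo_subset_Icc_self hs)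

/-! ### Uniqueness and passage to the limit for weak solutions -/

section Limit
variable {E : Type*} [NormedAddCommGroup E] [InnerProductSpace ℝ E] [FiniteDimensional ℝ E]
  [MeasurableSpace E] [BorelSpace E] {Ω Γ : Set E} [CompleteSpace (TraceDom Ω Γ)]
  [IsFiniteMeasure (surfaceMeasure Γ)]

/-- Uniqueness of weak solutions. -/
theorem IsWeakSolution.unique {Y : Type*} [MeasurableSpace Y] {ρ : Measure Y} [IsFiniteMeasure ρ]
    {c : ℝ} {j : Y → Y → ℝ} {g : E → Y → ℝ} {h : Y → E → ℝ} {Cj Cg Ch : ℝ} (hΩ : IsOpen Ω)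
    (hT : HasTraceBound Ω Γ) (hc : 0 ≤ c) (hj : IsBddKernel ρ ρ j Cj)
    (hg : IsBddKernel (surfaceMeasure Γ) ρ g Cg) (hh : IsBddKernel ρ (surfaceMeasure Γ) h Ch)
    (hg0 : ∀ x y, 0 ≤ g x y) {u₀ : H1 Ω} {v₀ : Lp ℝ 2 ρ} {u u' : ℝ → H1 Ω}
    {v v' : ℝ → Lp ℝ 2 ρ} (hs : IsWeakSolution Ω Γ ρ c j g h u₀ v₀ u v)
    (hs' : IsWeakSolution Ω Γ ρ c j g h u₀ v₀ u' v') {t : ℝ} (ht : 0 ≤ t) :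
    u t = u' t ∧ v t = v' t := by
  obtain ⟨U₀, U, hU₀, hU, he⟩ := hs.exists_isEvolution hT hj hg hh
  obtain ⟨U₀', U', hU₀', hU', he'⟩ := hs'.exists_isEvolution hT hj hg hh
  rw [traceDomIncl_injective Ω Γ (hU₀'.trans hU₀.symm)] at he'
  have := he.eq_of_coupled hΩ hT hc hj hg hh hg0 he' ht
  rw [← hU t ht, ← hU' t ht]
  exact ⟨congrArg _ this.1, this.2⟩

variable {X₁ X₂ : Type*} [MeasurableSpace X₁] [MeasurableSpace X₂]
  {μ : Measure X₁} {ν : Measure X₂} [IsFiniteMeasure μ] [IsFiniteMeasure ν]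

/-- If the kernels converge uniformly to kernels that do not depend on the second variable of the
product, then weak solutions converge uniformly on bounded time intervals, and the fiber integral
of the limit solves the reduced problem. -/
theorem exists_limit_of_kernels (hΩ : IsOpen Ω) (hT : HasTraceBound Ω Γ)
    {j : ℝ → X₁ × X₂ → X₁ × X₂ → ℝ} {g : ℝ → E → X₁ × X₂ → ℝ} {h : ℝ → X₁ × X₂ → E → ℝ}
    {j' : X₁ → X₁ → ℝ} {g' : E → X₁ → ℝ} {h' : X₁ → E → ℝ} {C : ℝ}
    (hj : ∀ ε ∈ Ioc (0 : ℝ) 1, IsBddKernel (μ.prod ν) (μ.prod ν) (j ε) C)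
    (hg : ∀ ε ∈ Ioc (0 : ℝ) 1, IsBddKernel (surfaceMeasure Γ) (μ.prod ν) (g ε) C)
    (hh : ∀ ε ∈ Ioc (0 : ℝ) 1, IsBddKernel (μ.prod ν) (surfaceMeasure Γ) (h ε) C)
    (hg0 : ∀ ε x y, 0 ≤ g ε x y) (hg0' : ∀ x y, 0 ≤ g' x y)
    (hjs : IsBddKernel μ μ j' C) (hgs : IsBddKernel (surfaceMeasure Γ) μ g' C)
    (hhs : IsBddKernel μ (surfaceMeasure Γ) h' C)
    (hjm : IsBddKernel μ (μ.prod ν) (fun x y => j' x y.1) C)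
    (hj₀ : IsBddKernel (μ.prod ν) (μ.prod ν) (fun x y => j' x.1 y.1) C)
    (hg₀ : IsBddKernel (surfaceMeasure Γ) (μ.prod ν) (fun x y => g' x y.1) C)
    (hh₀ : IsBddKernel (μ.prod ν) (surfaceMeasure Γ) (fun x y => h' x.1 y) C)
    (hsmall : ∀ δ > 0, ∀ᶠ ε in 𝓝[>] (0 : ℝ),
      (∀ᵐ x ∂μ.prod ν, ∀ᵐ y ∂μ.prod ν, |j ε x y - j' x.1 y.1| ≤ δ) ∧
      (∀ᵐ x ∂surfaceMeasure Γ, ∀ᵐ y ∂μ.prod ν, |g ε x y - g' x y.1| ≤ δ) ∧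
      (∀ᵐ x ∂μ.prod ν, ∀ᵐ y ∂surfaceMeasure Γ, |h ε x y - h' x.1 y| ≤ δ))
    {u₀ : H1 Ω} {v₀ : Lp ℝ 2 (μ.prod ν)} {u : ℝ → ℝ → H1 Ω} {v : ℝ → ℝ → Lp ℝ 2 (μ.prod ν)}
    (hsol : ∀ ε ∈ Ioc (0 : ℝ) 1,
      IsWeakSolution Ω Γ (μ.prod ν) 1 (j ε) (g ε) (h ε) u₀ v₀ (u ε) (v ε)) :
    ∃ (us : ℝ → H1 Ω) (vs : ℝ → Lp ℝ 2 (μ.prod ν)), ContinuousOn vs (Ici 0) ∧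
      IsWeakSolution Ω Γ μ (ν.real univ) j' g' h' u₀ (fiberL μ ν v₀) us
        (fun t => fiberL μ ν (vs t)) ∧
      ∀ T δ : ℝ, 0 < δ → ∀ᶠ ε in 𝓝[>] (0 : ℝ), ∀ t ∈ Icc 0 T,
        ‖fnH1 (u ε t) - fnH1 (us t)‖ ≤ δ ∧ ‖v ε t - vs t‖ ≤ δ := by
  have h1 : (1 : ℝ) ∈ Ioc (0 : ℝ) 1 := ⟨one_pos, le_rfl⟩
  -- That `u₀` has a trace is not assumed; it follows from the existence of any one of the
  -- solutions, here the one for `ε = 1`.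
  obtain ⟨U₀, _, hU₀, -⟩ := (hsol 1 h1).exists_isEvolution hT (hj 1 h1) (hg 1 h1) (hh 1 h1)
  -- The limit is the solution on the full product with the limiting kernels, so that it can be
  -- compared with `(u ε, v ε)` before any fiber integration.
  obtain ⟨Us, vs, hs⟩ := exists_isEvolution_coupled hΩ hT zero_le_one hj₀ hg₀ hh₀
    (fun x y => hg0' _ _) U₀ v₀
  refine ⟨fun t => traceDomIncl Ω Γ (Us t), vs, hs.continuousOn_v, ?_, fun T δ hδ => ?_⟩
  · have := (hs.fiberIntegral hT hjs hgs hhs hjm hj₀ hg₀ hh₀).isWeakSolution hT hjs hgs hhs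
    rwa [hU₀] at this
  · obtain ⟨K, hK0, hK⟩ := hs.exists_norm_sub_le hT hj₀ hg₀ hh₀ C T
    have hKδ : K * (δ / (K + 1)) ≤ δ := by
      rw [← mul_div_assoc, div_le_iff₀ (by positivity)]
      nlinarith
    filter_upwards [hsmall (δ / (K + 1)) (by positivity), Ioc_mem_nhdsGT (one_pos (α := ℝ))]
      with ε ⟨d1, d2, d3⟩ hε t ht
    obtain ⟨U₁, U, hU₁, hU, he⟩ :=
      (hsol ε hε).exists_isEvolution hT (hj ε hε) (hg ε hε) (hh ε hε)
    rw [traceDomIncl_injective Ω Γ (hU₁.trans hU₀.symm)] at he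
    have := hK (hj ε hε) (hg ε hε) (hh ε hε) (hg0 ε) he (by positivity) d1 d2 d3 t ht
    rw [hU t ht.1] at this
    exact ⟨this.1.trans hKδ, this.2.trans hKδ⟩

end Limit

/-! ### Bounds for the rescaled kernels -/

section Kernels

theorem isBddKernel_comp {F Y Z : Type*} [NormedAddCommGroup F] [TopologicalSpace Y]
    [MeasurableSpace Y] [TopologicalSpace Z] [MeasurableSpace Z] [OpensMeasurableSpace (Y × Z)]
    {ρ : Measure Y} {ν : Measure Z} {f : F → ℝ} (hf : Continuous f) {κ : Y → Z → F}
    (hκ : Continuous fun p : Y × Z => κ p.1 p.2) {r C : ℝ} (hC0 : 0 ≤ C)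
    (hC : ∀ x, ‖x‖ ≤ r → |f x| ≤ C) (h : ∀ᵐ y ∂ρ, ∀ᵐ z ∂ν, ‖κ y z‖ ≤ r) :
    IsBddKernel ρ ν (fun y z => f (κ y z)) C :=
  ⟨(hf.comp hκ).aestronglyMeasurable, hC0, h.mono fun _ h1 => h1.mono fun _ h2 => hC _ h2⟩

variable {N₁ N₂ : ℕ}

theorem continuous_pt {X : Type*} [TopologicalSpace X] {a : X → EuclideanSpace ℝ (Fin N₁)}
    {b : X → EuclideanSpace ℝ (Fin N₂)} (ha : Continuous a) (hb : Continuous b) :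
    Continuous fun x => pt (a x) (b x) :=
  (WithLp.prod_continuous_toLp 2 _ _).comp (ha.prodMk hb)

theorem norm_pt_le (a : EuclideanSpace ℝ (Fin N₁)) (b : EuclideanSpace ℝ (Fin N₂)) :
    ‖pt a b‖ ≤ ‖a‖ + ‖b‖ := by
  rw [pt, WithLp.prod_norm_eq_of_L2]
  refine Real.sqrt_le_iff.2 ⟨by positivity, ?_⟩
  change ‖a‖ ^ 2 + ‖b‖ ^ 2 ≤ _
  nlinarith [norm_nonneg a, norm_nonneg b]

theorem pt_sub_pt (a : EuclideanSpace ℝ (Fin N₁)) (b b' : EuclideanSpace ℝ (Fin N₂)) :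
    pt a b - pt a b' = pt 0 (b - b') := by
  rw [pt, pt, pt, ← WithLp.toLp_sub, Prod.mk_sub_mk, sub_self]

theorem ae_volR_norm_le {R₁ : Set (EuclideanSpace ℝ (Fin N₁))} (hR₁ : MeasurableSet R₁)
    {R₂ : Set (EuclideanSpace ℝ (Fin N₂))} (hR₂ : MeasurableSet R₂) {r : ℝ}
    (h₁ : ∀ x ∈ R₁, ‖x‖ ≤ r) (h₂ : ∀ x ∈ R₂, ‖x‖ ≤ r) :
    ∀ᵐ y ∂volR R₁ R₂, ‖y.1‖ ≤ r ∧ ‖y.2‖ ≤ r := by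
  rw [volR, Measure.prod_restrict]
  filter_upwards [ae_restrict_mem (hR₁.prod hR₂)] with y hy using ⟨h₁ _ hy.1, h₂ _ hy.2⟩

/-- A continuous function is bounded and uniformly continuous on balls. -/
theorem Continuous.exists_bound_modulus {F : Type*} [NormedAddCommGroup F] [ProperSpace F]
    {f : F → ℝ} (hf : Continuous f) (r : ℝ) :
    (∃ C, ∀ x, ‖x‖ ≤ r → |f x| ≤ C) ∧
      ∀ δ > 0, ∃ η > 0, ∀ x y, ‖x‖ ≤ r → ‖y‖ ≤ r → ‖x - y‖ < η → |f x - f y| ≤ δ := by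
  have hK := isCompact_closedBall (0 : F) r
  constructor
  · obtain ⟨C, hC⟩ := hK.exists_bound_of_continuousOn hf.continuousOn
    exact ⟨C, fun x hx => hC x (mem_closedBall_zero_iff.2 hx)⟩
  · intro δ hδ
    obtain ⟨η, hη, h⟩ := Metric.uniformContinuousOn_iff.1
      (hK.uniformContinuousOn_of_continuous hf.continuousOn) δ hδ
    refine ⟨η, hη, fun x y hx hy hxy => ?_⟩
    have := h x (mem_closedBall_zero_iff.2 hx) y (mem_closedBall_zero_iff.2 hy)
      (by rwa [dist_eq_norm])
    exact (Real.dist_eq _ _ ▸ this).le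

theorem norm_smul_le_of_le_one {F : Type*} [NormedAddCommGroup F] [NormedSpace ℝ F] {ε : ℝ}
    (hε : ε ∈ Icc (0 : ℝ) 1) (x : F) : ‖ε • x‖ ≤ ‖x‖ := by
  rw [norm_smul, Real.norm_eq_abs, abs_of_nonneg hε.1]
  exact mul_le_of_le_one_left (norm_nonneg _) hε.2

variable {r ε : ℝ}

/-- Each component contributes at most `2 r`, because scaling by `ε ≤ 1` does not increase norms.
The two variants below treat the other kernels with the same radius. -/
theorem norm_pt_sub_smul_sub_le (hε : ε ∈ Icc (0 : ℝ) 1) {a a' : EuclideanSpace ℝ (Fin N₁)}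
    {b b' : EuclideanSpace ℝ (Fin N₂)} (ha : ‖a‖ ≤ r) (ha' : ‖a'‖ ≤ r) (hb : ‖b‖ ≤ r)
    (hb' : ‖b'‖ ≤ r) : ‖pt (a - a') (ε • (b - b'))‖ ≤ 4 * r := by
  have h1 := norm_pt_le (a - a') (ε • (b - b'))
  have h2 := norm_smul_le_of_le_one hε (b - b')
  linarith [norm_sub_le a a', norm_sub_le b b']

theorem norm_pt_sub_sub_smul_le (hε : ε ∈ Icc (0 : ℝ) 1) {a a' : EuclideanSpace ℝ (Fin N₁)}
    {b b' : EuclideanSpace ℝ (Fin N₂)} (ha : ‖a‖ ≤ r) (ha' : ‖a'‖ ≤ r) (hb : ‖b‖ ≤ r)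
    (hb' : ‖b'‖ ≤ r) : ‖pt (a - a') (b - ε • b')‖ ≤ 4 * r := by
  have h1 := norm_pt_le (a - a') (b - ε • b')
  have h2 := norm_smul_le_of_le_one hε b'
  linarith [norm_sub_le a a', norm_sub_le b (ε • b')]

theorem norm_pt_sub_smul_sub_le' (hε : ε ∈ Icc (0 : ℝ) 1) {a a' : EuclideanSpace ℝ (Fin N₁)}
    {b b' : EuclideanSpace ℝ (Fin N₂)} (ha : ‖a‖ ≤ r) (ha' : ‖a'‖ ≤ r) (hb : ‖b‖ ≤ r)
    (hb' : ‖b'‖ ≤ r) : ‖pt (a - a') (ε • b - b')‖ ≤ 4 * r := by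
  have h1 := norm_pt_le (a - a') (ε • b - b')
  have h2 := norm_smul_le_of_le_one hε b
  linarith [norm_sub_le a a', norm_sub_le (ε • b) b']

/-- The arguments of a kernel at `ε` and at `0` share their first component, so they differ by `ε`
times a bounded vector. -/
theorem norm_pt_sub_pt_le (hε : 0 ≤ ε) {a : EuclideanSpace ℝ (Fin N₁)}
    {b b' c : EuclideanSpace ℝ (Fin N₂)} (hb : ‖c‖ ≤ 2 * r) (h : b - b' = ε • c) :
    ‖pt a b - pt a b'‖ ≤ ε * (2 * r) := by
  rw [pt_sub_pt, h]
  refine (norm_pt_le _ _).trans ?_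
  rw [norm_zero, zero_add, norm_smul, Real.norm_eq_abs, abs_of_nonneg hε]
  gcongr

end Kernels

end

/-! ### Convergence of the rescaled problem -/

set_option maxHeartbeats 1000000 in
theorem theorem1p2 {N₁ N₂ : ℕ} (hN₁ : 0 < N₁) (hN₂ : 0 < N₂)
    (Ω Γ : Set (Space N₁ N₂)) (hΩo : IsOpen Ω) (hΩb : Bornology.IsBounded Ω)
    (hΩL : HasLipschitzBoundary Ω)
    (hΓ : Γ ⊆ frontier Ω) (hΓm : MeasurableSet Γ) (hΓpos : 0 < surfaceMeasure Γ Γ)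
    (R₁ : Set (EuclideanSpace ℝ (Fin N₁))) (hR₁o : IsOpen R₁) (hR₁b : Bornology.IsBounded R₁)
    (R₂ : Set (EuclideanSpace ℝ (Fin N₂))) (hR₂o : IsOpen R₂) (hR₂b : Bornology.IsBounded R₂)
    (J G : Space N₁ N₂ → ℝ)
    (hJc : Continuous J) (hJnn : ∀ x, 0 ≤ J x) (hJ0 : 0 < J 0) (hJs : ∀ x, J (-x) = J x)
    (hJi : Integrable J)
    (hGc : Continuous G) (hGnn : ∀ x, 0 ≤ G x) (hG0 : ∃ x, G x ≠ 0) (hGi : Integrable G)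
    (u₀ : H1 Ω) (v₀ : Lp ℝ 2 (volR R₁ R₂))
    (u : ℝ → ℝ → H1 Ω) (v : ℝ → ℝ → Lp ℝ 2 (volR R₁ R₂))
    (hsol : ∀ ε ∈ Set.Ioc (0 : ℝ) 1, IsRescaledSolution Ω Γ R₁ R₂ J G ε u₀ v₀ (u ε) (v ε)) :
    ∃ (V₀ : Lp ℝ 2 (volume.restrict R₁)) (V : ℝ → ℝ → Lp ℝ 2 (volume.restrict R₁))
      (uStar : ℝ → H1 Ω) (vStar : ℝ → Lp ℝ 2 (volR R₁ R₂))
      (VStar : ℝ → Lp ℝ 2 (volume.restrict R₁)),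
      IsFiberIntegral v₀ V₀ ∧
      (∀ ε ∈ Set.Ioc (0 : ℝ) 1, ∀ t, 0 ≤ t → IsFiberIntegral (v ε t) (V ε t)) ∧
      (∀ t, 0 ≤ t → IsFiberIntegral (vStar t) (VStar t)) ∧
      (∀ T : ℝ, 0 < T →
        WeakConvLinfty T (fun ε t => fnH1 (u ε t)) (fun t => fnH1 (uStar t)) ∧
        WeakConvLinfty T v vStar ∧
        WeakConvLinfty T V VStar) ∧
      IsLimitSolution Ω Γ R₁ R₂ J G u₀ V₀ uStar VStar ∧
      (∀ (u' : ℝ → H1 Ω) (V' : ℝ → Lp ℝ 2 (volume.restrict R₁)),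
        IsLimitSolution Ω Γ R₁ R₂ J G u₀ V₀ u' V' →
          ∀ t, 0 ≤ t → u' t = uStar t ∧ V' t = VStar t) := by
  have hT : HasTraceBound Ω Γ := hΩL.hasTraceBound hΩo hΩb hΓ
  have i0 : CompleteSpace (TraceDom Ω Γ) := hT.completeSpace_traceDom
  have i1 : IsFiniteMeasure (surfaceMeasure Γ) := hT.isFiniteMeasure hΩb
  have i2 : IsFiniteMeasure (volume.restrict R₁) :=
    ⟨by rw [Measure.restrict_apply_univ]; exact hR₁b.measure_lt_top⟩
  have i3 : IsFiniteMeasure (volume.restrict R₂) :=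
    ⟨by rw [Measure.restrict_apply_univ]; exact hR₂b.measure_lt_top⟩
  obtain ⟨r, hr0, hr1, hr2, hr3⟩ : ∃ r : ℝ, 0 ≤ r ∧ (∀ x ∈ R₁, ‖x‖ ≤ r) ∧ (∀ x ∈ R₂, ‖x‖ ≤ r) ∧
      ∀ x ∈ Γ, ‖x‖ ≤ r := by
    obtain ⟨a, ha⟩ := hR₁b.exists_norm_le
    obtain ⟨b, hb⟩ := hR₂b.exists_norm_le
    obtain ⟨d, hd⟩ := (hΩb.closure.subset (hΓ.trans frontier_subset_closure)).exists_norm_le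
    exact ⟨max 0 (max a (max b d)), le_max_left _ _, fun x hx => (ha x hx).trans (by simp),
      fun x hx => (hb x hx).trans (by simp), fun x hx => (hd x hx).trans (by simp)⟩
  have haR : ∀ᵐ y ∂volR R₁ R₂, ‖y.1‖ ≤ r ∧ ‖y.2‖ ≤ r :=
    ae_volR_norm_le hR₁o.measurableSet hR₂o.measurableSet hr1 hr2
  have haR₁ : ∀ᵐ y ∂volume.restrict R₁, ‖y‖ ≤ r :=
    (ae_restrict_mem hR₁o.measurableSet).mono hr1
  have haΓ : ∀ᵐ x ∂surfaceMeasure Γ, ‖x.fst‖ ≤ r ∧ ‖x.snd‖ ≤ r := by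
    filter_upwards [ae_restrict_mem hΓm] with x hx
    exact ⟨(WithLp.norm_fst_le _ x).trans (hr3 x hx), (WithLp.norm_snd_le _ x).trans (hr3 x hx)⟩
  obtain ⟨⟨CJ, hCJ⟩, hJu⟩ := hJc.exists_bound_modulus (4 * r)
  obtain ⟨⟨CG, hCG⟩, hGu⟩ := hGc.exists_bound_modulus (4 * r)
  set C : ℝ := max 0 (max CJ CG) with hC
  have hC0 : 0 ≤ C := le_max_left _ _
  replace hCJ : ∀ x, ‖x‖ ≤ 4 * r → |J x| ≤ C := fun x hx => (hCJ x hx).trans (by simp [hC])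
  replace hCG : ∀ x, ‖x‖ ≤ 4 * r → |G x| ≤ C := fun x hx => (hCG x hx).trans (by simp [hC])
  have hz : ∀ {N : ℕ}, ‖(0 : EuclideanSpace ℝ (Fin N))‖ ≤ r := by simpa using hr0
  have z01 : (0 : ℝ) ∈ Icc (0 : ℝ) 1 := ⟨le_rfl, zero_le_one⟩
  -- The value `ε = 0` is included, so that the limiting kernels on `R` are a special case with the
  -- same bound `C`.
  have hj : ∀ ε ∈ Icc (0 : ℝ) 1, IsBddKernel (volR R₁ R₂) (volR R₁ R₂)
      (fun x y => J (pt (x.1 - y.1) (ε • (x.2 - y.2)))) C := fun ε hε => by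
    refine isBddKernel_comp hJc ?_ hC0 hCJ <|
      haR.mono fun x hx => haR.mono fun y hy => norm_pt_sub_smul_sub_le hε hx.1 hy.1 hx.2 hy.2
    exact continuous_pt (by fun_prop) (by fun_prop)
  have hg : ∀ ε ∈ Icc (0 : ℝ) 1, IsBddKernel (surfaceMeasure Γ) (volR R₁ R₂)
      (fun x y => G (pt (x.fst - y.1) (x.snd - ε • y.2))) C := fun ε hε => by
    refine isBddKernel_comp hGc ?_ hC0 hCG <|
      haΓ.mono fun x hx => haR.mono fun y hy => norm_pt_sub_sub_smul_le hε hx.1 hy.1 hx.2 hy.2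
    exact continuous_pt (by fun_prop) (by fun_prop)
  have hh : ∀ ε ∈ Icc (0 : ℝ) 1, IsBddKernel (volR R₁ R₂) (surfaceMeasure Γ)
      (fun x y => G (pt (x.1 - y.fst) (ε • x.2 - y.snd))) C := fun ε hε => by
    refine isBddKernel_comp hGc ?_ hC0 hCG <|
      haR.mono fun x hx => haΓ.mono fun y hy => norm_pt_sub_smul_sub_le' hε hx.1 hy.1 hx.2 hy.2
    exact continuous_pt (by fun_prop) (by fun_prop)
  have hj₀ : IsBddKernel (volR R₁ R₂) (volR R₁ R₂) (fun x y => J (pt (x.1 - y.1) 0)) C := by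
    simpa only [zero_smul] using hj 0 z01
  have hg₀ : IsBddKernel (surfaceMeasure Γ) (volR R₁ R₂)
      (fun x y => G (pt (x.fst - y.1) (x.snd - 0))) C := by
    simpa only [zero_smul] using hg 0 z01
  have hh₀ : IsBddKernel (volR R₁ R₂) (surfaceMeasure Γ)
      (fun x y => G (pt (x.1 - y.fst) (0 - y.snd))) C := by
    simpa only [zero_smul] using hh 0 z01
  have hjs : IsBddKernel (volume.restrict R₁) (volume.restrict R₁)
      (fun x y => J (pt (x - y) 0)) C := by
    refine isBddKernel_comp hJc ?_ hC0 hCJ <|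
      haR₁.mono fun x hx => haR₁.mono fun y hy => by
        simpa only [zero_smul] using norm_pt_sub_smul_sub_le (N₂ := N₂) z01 hx hy hz hz
    exact continuous_pt (by fun_prop) (by fun_prop)
  have hjm : IsBddKernel (volume.restrict R₁) (volR R₁ R₂)
      (fun x y => J (pt (x - y.1) 0)) C := by
    refine isBddKernel_comp hJc ?_ hC0 hCJ <|
      haR₁.mono fun x hx => haR.mono fun y hy => by
        simpa only [zero_smul] using norm_pt_sub_smul_sub_le (N₂ := N₂) z01 hx hy.1 hz hz
    exact continuous_pt (by fun_prop) (by fun_prop)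
  have hgs : IsBddKernel (surfaceMeasure Γ) (volume.restrict R₁)
      (fun x y => G (pt (x.fst - y) (x.snd - 0))) C := by
    refine isBddKernel_comp hGc ?_ hC0 hCG <|
      haΓ.mono fun x hx => haR₁.mono fun y hy => by
        simpa only [zero_smul] using norm_pt_sub_sub_smul_le z01 hx.1 hy hx.2 hz
    exact continuous_pt (by fun_prop) (by fun_prop)
  have hhs : IsBddKernel (volume.restrict R₁) (surfaceMeasure Γ)
      (fun x y => G (pt (x - y.fst) (0 - y.snd))) C := by
    refine isBddKernel_comp hGc ?_ hC0 hCG <|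
      haR₁.mono fun x hx => haΓ.mono fun y hy => by
        simpa only [zero_smul] using norm_pt_sub_smul_sub_le' z01 hx hy.1 hz hy.2
    exact continuous_pt (by fun_prop) (by fun_prop)
  have I : ∀ ε ∈ Ioc (0 : ℝ) 1, ε ∈ Icc (0 : ℝ) 1 := fun ε hε => Ioc_subset_Icc_self hε
  -- All kernel arguments lie in the ball of radius `4 r`, where `J` and `G` are uniformly
  -- continuous, and they move by at most `ε * (2 * r)`.
  have hsmall : ∀ δ > 0, ∀ᶠ ε in 𝓝[>] (0 : ℝ),
      (∀ᵐ x ∂volR R₁ R₂, ∀ᵐ y ∂volR R₁ R₂,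
        |J (pt (x.1 - y.1) (ε • (x.2 - y.2))) - J (pt (x.1 - y.1) 0)| ≤ δ) ∧
      (∀ᵐ x ∂surfaceMeasure Γ, ∀ᵐ y ∂volR R₁ R₂,
        |G (pt (x.fst - y.1) (x.snd - ε • y.2)) - G (pt (x.fst - y.1) (x.snd - 0))| ≤ δ) ∧
      (∀ᵐ x ∂volR R₁ R₂, ∀ᵐ y ∂surfaceMeasure Γ,
        |G (pt (x.1 - y.fst) (ε • x.2 - y.snd)) - G (pt (x.1 - y.fst) (0 - y.snd))| ≤ δ) := by
    intro δ hδ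
    obtain ⟨η, hη, hJη⟩ := hJu δ hδ
    obtain ⟨θ, hθ, hGθ⟩ := hGu δ hδ
    have hlim : Tendsto (fun ε : ℝ => ε * (2 * r)) (𝓝[>] (0 : ℝ)) (𝓝 0) :=
      tendsto_nhdsWithin_of_tendsto_nhds (by
        have : Continuous fun ε : ℝ => ε * (2 * r) := by fun_prop
        simpa using this.tendsto 0)
    filter_upwards [Ioc_mem_nhdsGT (one_pos (α := ℝ)), hlim.eventually_lt_const hη,
      hlim.eventually_lt_const hθ] with ε hε h1 h2
    refine ⟨haR.mono fun x hx => haR.mono fun y hy => hJη _ _ ?_ ?_ (lt_of_le_of_lt ?_ h1),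
      haΓ.mono fun x hx => haR.mono fun y hy => hGθ _ _ ?_ ?_ (lt_of_le_of_lt ?_ h2),
      haR.mono fun x hx => haΓ.mono fun y hy => hGθ _ _ ?_ ?_ (lt_of_le_of_lt ?_ h2)⟩
    · exact norm_pt_sub_smul_sub_le (I ε hε) hx.1 hy.1 hx.2 hy.2
    · simpa only [zero_smul] using norm_pt_sub_smul_sub_le z01 hx.1 hy.1 hx.2 hy.2
    · refine norm_pt_sub_pt_le hε.1.le (c := x.2 - y.2) ?_ (sub_zero _)
      linarith [norm_sub_le x.2 y.2, hx.2, hy.2]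
    · exact norm_pt_sub_sub_smul_le (I ε hε) hx.1 hy.1 hx.2 hy.2
    · simpa only [zero_smul] using norm_pt_sub_sub_smul_le z01 hx.1 hy.1 hx.2 hy.2
    · refine norm_pt_sub_pt_le hε.1.le (c := -y.2) ?_ (by rw [smul_neg]; abel)
      rw [norm_neg]
      linarith [hy.2]
    · exact norm_pt_sub_smul_sub_le' (I ε hε) hx.1 hy.1 hx.2 hy.2
    · simpa only [zero_smul] using norm_pt_sub_smul_sub_le' z01 hx.1 hy.1 hx.2 hy.2
    · refine norm_pt_sub_pt_le hε.1.le (c := x.2) ?_ (by abel)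
      linarith [hx.2]
  obtain ⟨us, vs, hvs, hlim, hunif⟩ := exists_limit_of_kernels hΩo hT (fun ε hε => hj ε (I ε hε))
    (fun ε hε => hg ε (I ε hε)) (fun ε hε => hh ε (I ε hε)) (fun _ _ _ => hGnn _)
    (fun _ _ => hGnn _) hjs hgs hhs hjm hj₀ hg₀ hh₀ hsmall hsol
  have hc : (volume.restrict R₂).real univ = volume.real R₂ := measureReal_restrict_apply_univ _
  have hus := hlim.continuousOn_u
  rw [hc] at hlim
  refine ⟨fiberL _ _ v₀, fun ε t => fiberL _ _ (v ε t), us, vs,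
    fun t => fiberL _ _ (vs t), coeFn_fiberL v₀, fun ε _ t _ => coeFn_fiberL (v ε t),
    fun t _ => coeFn_fiberL (vs t), fun T hT0 => ⟨?_, ?_, ?_⟩, hlim, fun u' V' h' t ht =>
      h'.unique hΩo hT measureReal_nonneg hjs hgs hhs (fun _ _ => hGnn _) hlim ht⟩
  · refine WeakConvLinfty.of_uniform
      (fun ε hε => (fnL Ω).continuous.comp_continuousOn (hsol ε hε).continuousOn_u)
      ((fnL Ω).continuous.comp_continuousOn hus) fun δ hδ => ?_
    exact (hunif T δ hδ).mono fun ε h t ht => (h t ht).1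
  · exact WeakConvLinfty.of_uniform (fun ε hε => (hsol ε hε).continuousOn_v) hvs
      fun δ hδ => (hunif T δ hδ).mono fun ε h t ht => (h t ht).2
  · refine WeakConvLinfty.of_uniform
      (fun ε hε => (fiberL _ _).continuous.comp_continuousOn (hsol ε hε).continuousOn_v)
      ((fiberL _ _).continuous.comp_continuousOn hvs) fun δ hδ => ?_
    -- Fiber integration is bounded on `L²`, so `V^ε` inherits the uniform convergence of `v^ε`; `b
    -- + 1` avoids dividing by zero.
    set b := ‖fiberL (volume.restrict R₁) (volume.restrict R₂)‖ with hb
    have hbδ : b * (δ / (b + 1)) ≤ δ := by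
      rw [← mul_div_assoc, div_le_iff₀ (by positivity)]
      nlinarith
    refine (hunif T (δ / (b + 1)) (by positivity)).mono fun ε h t ht => ?_
    rw [← map_sub]
    exact (ContinuousLinearMap.le_opNorm _ _).trans
      ((mul_le_mul_of_nonneg_left (h t ht).2 (norm_nonneg _)).trans hbδ)
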